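/- **Corollary.** For all integers $k \ge 2$ and $p \ge 1$ there exist a constant $c$ and a polynomial-time algorithm that inputs a $k$-CNF formula $\varphi$ with $n$ variables and $m$ clauses in which every variable appears at most $2p+1$ times (a conjunction of clauses, each of which is a disjunction of $k$ literals containing pairwise different variables), and outputs a simple graph $H(\varphi,p)$ such that $|V(H(\varphi,p))| \le c\,n$ whenever $n \ge 1$, and such that the following holds for every such $\varphi$. If $m'$ is the maximum number of clauses of $\varphi$ that can be satisfied by a single valuation of the variables, then $$\operatorname{td}(H(\varphi,p)) = 2(2^k-1)m - m' + 2^k p n + 1.$$ Here the treedepth $\operatorname{td}(H)$ is the minimum depth of a rooted forest $F$ on the vertex set of $H$ such that the two ends of every edge of $H$ are in ancestor--descendant relationship in $F$; the depth of $F$ is the largest number of vertices on a root-to-leaf path. -/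

import Mathlib

/-- A literal over the Boolean variables `x_0, …, x_{n-1}`: the variable `var`, negated exactly
when `positive = false`. -/
structure Literal (n : ℕ) where
  var : Fin n
  positive : Bool

/-- A clause `ℓ_1 ∨ … ∨ ℓ_k` made of `k` literals, each containing a different variable. -/
structure Clause (k n : ℕ) where
  lit : Fin k → Literal n
  distinct : Function.Injective fun i => (lit i).var

/-- A `k`-CNF formula: a number of variables and a conjunction of clauses. -/
structure KCNF (k : ℕ) where
  numVars : ℕ
  clauses : List (Clause k numVars)

/-- The valuation `a` satisfies the clause `C`: some literal of `C` is true. -/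
def Clause.Satisfied {k n : ℕ} (a : Fin n → Bool) (C : Clause k n) : Prop :=
  ∃ i, a (C.lit i).var = (C.lit i).positive

instance {k n : ℕ} (a : Fin n → Bool) (C : Clause k n) : Decidable (C.Satisfied a) :=
  inferInstanceAs (Decidable (∃ i, a (C.lit i).var = (C.lit i).positive))

namespace KCNF

variable {k : ℕ}

/-- The number of clauses. -/
def numClauses (φ : KCNF k) : ℕ := φ.clauses.length

/-- The number of times the variable `x` appears in `φ`, negated or not. -/
def occurrences (φ : KCNF k) (x : Fin φ.numVars) : ℕ :=
  (φ.clauses.flatMap fun C => List.ofFn C.lit).countP fun l => l.var = x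

/-- The number of clauses that the valuation `a` satisfies. -/
def numSatisfied (φ : KCNF k) (a : Fin φ.numVars → Bool) : ℕ :=
  φ.clauses.countP fun C => C.Satisfied a

/-- The maximum number of clauses that can be satisfied by one valuation. -/
def maxSatisfiable (φ : KCNF k) : ℕ :=
  Finset.univ.sup φ.numSatisfied

end KCNF

/-- A `k`-CNF formula in which every variable appears at most `b` times. -/
abbrev BoundedKCNF (k b : ℕ) : Type := {φ : KCNF k // ∀ x, φ.occurrences x ≤ b}

/-- The alphabet in which formulas are written. -/
inductive FormulaSymbol
  | tick
  | pos
  | neg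
  | sep
  deriving DecidableEq

instance : Fintype FormulaSymbol where
  elems := {.tick, .pos, .neg, .sep}
  complete := by intro x; cases x <;> simp

/-- The literal on the `j`-th variable is written as `j` ticks followed by its sign. -/
def Literal.encode {n : ℕ} (l : Literal n) : List FormulaSymbol :=
  List.replicate l.var FormulaSymbol.tick ++
    [if l.positive then FormulaSymbol.pos else FormulaSymbol.neg]

/-- A clause is written as its literals, one after the other, followed by a separator. -/
def Clause.encode {k n : ℕ} (C : Clause k n) : List FormulaSymbol :=
  ((List.ofFn C.lit).flatMap Literal.encode) ++ [FormulaSymbol.sep]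

/-- A formula is written as its number of variables in unary, a separator, and then its clauses.
For formulas with a bounded number of occurrences of each variable the length of this word is at
most quadratic in the number of variables. -/
def KCNF.encode {k : ℕ} (φ : KCNF k) : List FormulaSymbol :=
  List.replicate φ.numVars FormulaSymbol.tick ++ FormulaSymbol.sep ::
    φ.clauses.flatMap Clause.encode

theorem replicate_tick_append_inj {a b : ℕ} {s t : FormulaSymbol} {l r : List FormulaSymbol}
    (hs : s ≠ FormulaSymbol.tick) (ht : t ≠ FormulaSymbol.tick)
    (h : List.replicate a FormulaSymbol.tick ++ s :: l =
      List.replicate b FormulaSymbol.tick ++ t :: r) : a = b ∧ s = t ∧ l = r := by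
  induction a generalizing b with
  | zero => cases b <;> simp_all [List.replicate_succ]
  | succ a ih =>
    cases b with
    | zero => simp_all [List.replicate_succ]
    | succ b =>
      simp only [List.replicate_succ, List.cons_append, List.cons.injEq, true_and] at h
      have := ih h
      simp_all

theorem Literal.encode_append_inj {n : ℕ} {x y : Literal n} {l r : List FormulaSymbol}
    (h : x.encode ++ l = y.encode ++ r) : x = y ∧ l = r := by
  obtain ⟨⟨i, hi⟩, s⟩ := x
  obtain ⟨⟨j, hj⟩, t⟩ := y
  simp only [Literal.encode, List.append_assoc, List.singleton_append] at h
  have := replicate_tick_append_inj (by cases s <;> simp) (by cases t <;> simp) h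
  cases s <;> cases t <;> simp_all

theorem Clause.encode_append_inj {k n : ℕ} {C D : Clause k n} {l r : List FormulaSymbol}
    (h : C.encode ++ l = D.encode ++ r) : C = D ∧ l = r := by
  have key : ∀ (A B : List (Literal n)) (l r : List FormulaSymbol), A.length = B.length →
      A.flatMap Literal.encode ++ l = B.flatMap Literal.encode ++ r → A = B ∧ l = r := by
    intro A
    induction A with
    | nil =>
      intro B l r hl h
      cases B with
      | nil => simpa using h
      | cons b B => simp at hl
    | cons x A ih =>
      intro B l r hl h
      cases B with
      | nil => simp at hl
      | cons b B =>
        simp only [List.flatMap_cons, List.append_assoc] at h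
        obtain ⟨h1, h2⟩ := Literal.encode_append_inj h
        obtain ⟨h3, h4⟩ := ih B l r (by simpa using hl) h2
        exact ⟨by rw [h1, h3], h4⟩
  obtain ⟨f, hf⟩ := C
  obtain ⟨g, hg⟩ := D
  simp only [Clause.encode, List.append_assoc] at h
  obtain ⟨h1, h2⟩ := key _ _ _ _ (by simp) h
  have h3 : f = g := List.ofFn_injective h1
  subst h3
  exact ⟨rfl, by simpa using h2⟩

/-- Different formulas are written differently. -/
theorem KCNF.encode_injective {k : ℕ} : Function.Injective (KCNF.encode (k := k)) := by
  have key : ∀ (n : ℕ) (A B : List (Clause k n)),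
      A.flatMap Clause.encode = B.flatMap Clause.encode → A = B := by
    intro n A
    induction A with
    | nil =>
      intro B h
      cases B with
      | nil => rfl
      | cons b B => simp [Clause.encode] at h
    | cons x A ih =>
      intro B h
      cases B with
      | nil => simp [Clause.encode] at h
      | cons b B =>
        simp only [List.flatMap_cons] at h
        obtain ⟨h1, h2⟩ := Clause.encode_append_inj h
        rw [h1, ih B h2]
  rintro ⟨n, A⟩ ⟨n', B⟩ h
  obtain ⟨h1, -, h2⟩ := replicate_tick_append_inj (by simp) (by simp) h
  dsimp only at h1
  subst h1
  rw [key n A B h2]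

/-- A simple graph with vertex set `{0, …, order - 1}`. -/
structure FinGraph where
  order : ℕ
  graph : SimpleGraph (Fin order)

open Classical in
/-- A graph is written as its adjacency matrix, row by row. -/
noncomputable def FinGraph.encode (G : FinGraph) : List Bool :=
  (List.ofFn fun i => List.ofFn fun j => decide (G.graph.Adj i j)).flatten

/-- Different graphs are written differently. -/
theorem FinGraph.encode_injective : Function.Injective FinGraph.encode := by
  classical
  rintro ⟨n, G⟩ ⟨n', G'⟩ h
  have hlen : ∀ F : FinGraph, F.encode.length = F.order * F.order := by
    intro F
    simp [FinGraph.encode, List.length_flatten, List.map_ofFn, Function.comp_def]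
  have hn : n = n' := by
    have := congrArg List.length h
    rw [hlen, hlen] at this
    exact Nat.mul_self_inj.mp this
  subst hn
  have h2 : (fun i => List.ofFn fun j => decide (G.Adj i j)) =
      fun i => List.ofFn fun j => decide (G'.Adj i j) := by
    apply List.ofFn_injective
    refine List.eq_iff_flatten_eq.mpr ⟨h, ?_⟩
    simp [List.map_ofFn, Function.comp_def]
  congr 1
  ext i j
  have := congrFun (List.ofFn_injective (congrFun h2 i)) j
  simpa using this

/-- A rooted forest on the vertex set `V`, given by the parent of each vertex; the roots are the
vertices without a parent. -/
structure RootedForest (V : Type*) where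
  parent : V → Option V
  wf : WellFounded fun u v => parent v = some u

namespace RootedForest

variable {V : Type*}

/-- `u` is an ancestor of `v`: it is reached from `v` by going from vertices to their parents.
Every vertex is an ancestor of itself. -/
def IsAncestor (F : RootedForest V) (u v : V) : Prop :=
  Relation.ReflTransGen (fun a b => F.parent b = some a) u v

open Classical in
/-- The depth of a forest: the largest number of vertices on a path from a root down to a vertex,
that is, the largest number of ancestors of a vertex. -/
noncomputable def depth [Fintype V] (F : RootedForest V) : ℕ :=
  Finset.univ.sup fun v => (Finset.univ.filter fun u => F.IsAncestor u v).card

/-- `F` is an elimination forest of `G`: the ends of every edge of `G` are in ancestor-descendant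
relationship in `F`. -/
def IsEliminationForest (F : RootedForest V) (G : SimpleGraph V) : Prop :=
  ∀ u v, G.Adj u v → F.IsAncestor u v ∨ F.IsAncestor v u

end RootedForest

/-- The treedepth of a finite graph: the minimum depth of an elimination forest. -/
noncomputable def SimpleGraph.treedepth {V : Type*} [Fintype V] (G : SimpleGraph V) : ℕ :=
  sInf {d | ∃ F : RootedForest V, F.IsEliminationForest G ∧ F.depth = d}

/-!
The graph of a formula with `n` variables and `m` clauses has three parts `0`, `1`, `2`. Put
`w = 2 ^ (k - 2) * p`. In each part there are `w` copies of each literal, the vertices for the literals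
of the clauses are distributed over the parts, and each part has hubs, which are adjacent to its whole
part. In part `0` the literals are hubs themselves, and there are fewer other hubs, so that the
three parts have the same number of hubs once one half of the literals is taken away. Between the
parts, different literals on a variable are adjacent, and so are the vertices of a clause; the
vertex for the `i`-th literal of a clause is adjacent to the literals which are false if that
literal is the first true one.

*Upper bound* (`treedepth_add_numSatisfied_le`). A valuation gives a trunk: the false literals, and
all vertices of clauses but one for each satisfied clause. Removing the trunk removes all edges
between different parts, and the hubs left in a part separate all of its other vertices.

*Lower bound* (`le_treedepth_add_maxSatisfiable`). In an elimination forest the hubs of a part are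
on one path from a root, and all other vertices of the part are comparable to the last of them. If
the last hubs of the three parts are pairwise incomparable, take the two of their paths with the
longest common beginning: outside of it there are no edges between different parts
among the vertices for literals. Such a set has at most `3 * w * n + m'` vertices for literals
(`card_le_of_cross`), where `m'` is the maximum number of satisfied clauses: a variable with more
than `2 * w` remaining copies of its literals has a value, the other variables get the value of the
majority of their occurrences, and this is where the bound on the number of occurrences enters. If
two of the last hubs are comparable, then there is a path that contains the hubs of two parts and
many literals of other parts, and it is too long (`le_of_comparable`). Forests are handled by their
ancestor relations, which are the tree orders (`RootedForest.exists_of_isTreeOrder`).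

*Running time* (`polyTime_listGraph`). The vertices are arranged in blocks, one for each variable,
one for each clause and one more, with vertices of the same finitely many types. Whether two
vertices are adjacent depends on their types and on one of finitely many relations between their
blocks. For each block, the program goes over a copy of the formula to find the relations to all
blocks. Numbers of variables are compared in unary: the literals of the clause of the current block
are kept in counters, which are decremented at each block met, while one tick is removed in the
copy from each literal for each block written, so that a literal has run out of ticks when the
block of its variable is written. The program is written in a small language of structured
programs, which is compiled to Turing machines with several stacks (`Prog.polyTime_of_runs`), with
a rule for each command from which the effect of the program and the number of its steps are
derived.
-/

/-! ### Structured programs on stacks -/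

namespace StackProgram

/-- Structured programs acting on a family of stacks `Γ` and an internal state `σ`.  The command
`forEach k f q` pops the elements of the stack `k` one after the other until the stack is empty;
after each of them it updates the internal state by `f` and runs `q`, which may itself use `k`. -/
inductive Prog {K : Type} (Γ : K → Type) (σ : Type) : Type
  | load (f : σ → σ)
  | push (k : K) (f : σ → Γ k)
  | pop (k : K) (f : σ → Option (Γ k) → σ)
  | seq (q r : Prog Γ σ)
  | ite (b : σ → Bool) (q r : Prog Γ σ)
  | forEach (k : K) (f : σ → Γ k → σ) (q : Prog Γ σ)

variable {K : Type} {Γ : K → Type} {σ : Type}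

namespace Prog

/-- The function labels of the machine that carries out a program. -/
def Label : Prog Γ σ → Type
  | load _ => Unit
  | push _ _ => Unit
  | pop _ _ => Unit
  | seq q r => q.Label ⊕ r.Label
  | ite _ q r => Option (q.Label ⊕ r.Label)
  | forEach _ _ q => Option q.Label

/-- A program has finitely many labels. -/
@[reducible]
def labelFintype : (q : Prog Γ σ) → Fintype q.Label
  | load _ => inferInstanceAs (Fintype Unit)
  | push _ _ => inferInstanceAs (Fintype Unit)
  | pop _ _ => inferInstanceAs (Fintype Unit)
  | seq q r =>
    letI := labelFintype q
    letI := labelFintype r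
    inferInstanceAs (Fintype (q.Label ⊕ r.Label))
  | ite _ q r =>
    letI := labelFintype q
    letI := labelFintype r
    inferInstanceAs (Fintype (Option (q.Label ⊕ r.Label)))
  | forEach _ _ q =>
    letI := labelFintype q
    inferInstanceAs (Fintype (Option q.Label))

/-- The label at which a program starts. -/
def start : (q : Prog Γ σ) → q.Label
  | load _ => ()
  | push _ _ => ()
  | pop _ _ => ()
  | seq q _ => Sum.inl q.start
  | ite _ _ _ => none
  | forEach _ _ _ => none

open Turing.TM2

/-- The statements of the machine that carries out the program `q`, where `e` renames the labels of
`q` and `x` is the statement executed when `q` has finished.  The internal state of the machine has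
an additional Boolean, by which a loop remembers whether its stack was empty; it is `false` between
any two commands. -/
def code {Λ : Type} : (q : Prog Γ σ) → (q.Label → Λ) → Stmt Γ Λ (σ × Bool) →
    q.Label → Stmt Γ Λ (σ × Bool)
  | load f, _, x => fun _ => .load (fun s => (f s.1, s.2)) x
  | push k f, _, x => fun _ => .push k (fun s => f s.1) x
  | pop k f, _, x => fun _ => .pop k (fun s a => (f s.1 a, s.2)) x
  | seq q r, e, x => fun l => Sum.casesOn (motive := fun _ => Stmt Γ Λ (σ × Bool)) l
      (q.code (fun l => e (.inl l)) (.goto fun _ => e (.inr r.start)))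
      (r.code (fun l => e (.inr l)) x)
  | ite b q r, e, x => fun l => Option.casesOn (motive := fun _ => Stmt Γ Λ (σ × Bool)) l
      (.branch (fun s => b s.1) (.goto fun _ => e (some (.inl q.start)))
        (.goto fun _ => e (some (.inr r.start))))
      fun l => Sum.casesOn (motive := fun _ => Stmt Γ Λ (σ × Bool)) l
        (q.code (fun l => e (some (.inl l))) x)
        (r.code (fun l => e (some (.inr l))) x)
  | forEach k f q, e, x => fun l => Option.casesOn (motive := fun _ => Stmt Γ Λ (σ × Bool)) l
      (.pop k (fun s a => a.elim (s.1, false) fun a => (f s.1 a, true))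
        (.branch (fun s => s.2)
          (.load (fun s => (s.1, false)) (.goto fun _ => e (some q.start))) x))
      (q.code (fun l => e (some l)) (.goto fun _ => e none))

variable [DecidableEq K]

/-- `q.Runs s s' T`: started with the internal state and the stacks `s`, the program `q` finishes
within `T` steps, with the internal state and the stacks `s'`. -/
def Runs (q : Prog Γ σ) (s s' : σ × ∀ k, List (Γ k)) (T : ℕ) : Prop :=
  ∀ (Λ : Type) (M : Λ → Stmt Γ Λ (σ × Bool)) (e : q.Label → Λ) (x : Stmt Γ Λ (σ × Bool)),
    (∀ l, M (e l) = q.code e x l) →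
    ∃ t ≤ T, (flip bind (step M))^[t] (some ⟨some (e q.start), (s.1, false), s.2⟩) =
      some (stepAux x (s'.1, false) s'.2)

theorem Runs.mono {q : Prog Γ σ} {s s' : σ × ∀ k, List (Γ k)} {T T' : ℕ} (h : q.Runs s s' T)
    (hT : T ≤ T') : q.Runs s s' T' := fun Λ M e x hM =>
  let ⟨t, ht, h⟩ := h Λ M e x hM
  ⟨t, ht.trans hT, h⟩

theorem runs_load (f : σ → σ) (s : σ × ∀ k, List (Γ k)) :
    (load f : Prog Γ σ).Runs s (f s.1, s.2) 1 := by
  intro Λ M e x hM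
  refine ⟨1, le_rfl, ?_⟩
  simp [flip, hM, code]

theorem runs_push (k : K) (f : σ → Γ k) (s : σ × ∀ k, List (Γ k)) :
    (push k f : Prog Γ σ).Runs s (s.1, Function.update s.2 k (f s.1 :: s.2 k)) 1 := by
  intro Λ M e x hM
  refine ⟨1, le_rfl, ?_⟩
  simp [flip, hM, code]

theorem runs_pop (k : K) (f : σ → Option (Γ k) → σ) (s : σ × ∀ k, List (Γ k)) :
    (pop k f : Prog Γ σ).Runs s (f s.1 (s.2 k).head?, Function.update s.2 k (s.2 k).tail) 1 := by
  intro Λ M e x hM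
  refine ⟨1, le_rfl, ?_⟩
  simp [flip, hM, code]

theorem Runs.seq {q r : Prog Γ σ} {s s' s'' : σ × ∀ k, List (Γ k)} {T T' : ℕ}
    (h : q.Runs s s' T) (h' : r.Runs s' s'' T') : (seq q r).Runs s s'' (T + T') := by
  intro Λ M e x hM
  obtain ⟨t, ht, h⟩ := h Λ M (fun l => e (.inl l)) (.goto fun _ => e (.inr r.start))
    fun l => hM (.inl l)
  obtain ⟨t', ht', h'⟩ := h' Λ M (fun l => e (.inr l)) x fun l => hM (.inr l)
  refine ⟨t' + t, by omega, ?_⟩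
  rw [Function.iterate_add_apply]
  simp only [stepAux] at h
  exact (congrArg _ h).trans h'

theorem Runs.ite {b : σ → Bool} {q r : Prog Γ σ} {s s' : σ × ∀ k, List (Γ k)} {T : ℕ}
    (h : if b s.1 then q.Runs s s' T else r.Runs s s' T) : (ite b q r).Runs s s' (T + 1) := by
  intro Λ M e x hM
  have h0 := hM none
  simp only [code] at h0
  cases hb : b s.1 with
  | true =>
    rw [if_pos hb] at h
    obtain ⟨t, ht, h⟩ := h Λ M (fun l => e (some (.inl l))) x fun l => hM (some (.inl l))
    refine ⟨t + 1, by omega, ?_⟩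
    rw [Function.iterate_succ_apply]
    simpa [flip, start, h0, hb] using h
  | false =>
    rw [if_neg (by simp [hb])] at h
    obtain ⟨t, ht, h⟩ := h Λ M (fun l => e (some (.inr l))) x fun l => hM (some (.inr l))
    refine ⟨t + 1, by omega, ?_⟩
    rw [Function.iterate_succ_apply]
    simpa [flip, start, h0, hb] using h

theorem Runs.ite_true {b : σ → Bool} {q r : Prog Γ σ} {s s' : σ × ∀ k, List (Γ k)} {T : ℕ}
    (hb : b s.1 = true) (h : q.Runs s s' T) : (Prog.ite b q r).Runs s s' (T + 1) :=
  .ite (by rwa [if_pos hb])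

theorem Runs.ite_false {b : σ → Bool} {q r : Prog Γ σ} {s s' : σ × ∀ k, List (Γ k)} {T : ℕ}
    (hb : b s.1 = false) (h : r.Runs s s' T) : (Prog.ite b q r).Runs s s' (T + 1) :=
  .ite (by rwa [if_neg (by simp [hb])])

theorem runs_forEach_nil {k : K} {f : σ → Γ k → σ} {q : Prog Γ σ} {s : σ × ∀ k, List (Γ k)}
    (hs : s.2 k = []) : (forEach k f q).Runs s s 1 := by
  intro Λ M e x hM
  have h0 := hM none
  simp only [code] at h0
  refine ⟨1, le_rfl, ?_⟩
  have : Function.update s.2 k [] = s.2 := by rw [← hs, Function.update_eq_self]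
  simp [flip, start, h0, hs, this]

theorem Runs.forEach_cons {k : K} {f : σ → Γ k → σ} {q : Prog Γ σ} {v : σ}
    {S : ∀ k, List (Γ k)} {s' s'' : σ × ∀ k, List (Γ k)} {T T' : ℕ} {a : Γ k} {l : List (Γ k)}
    (hs : S k = a :: l) (h : q.Runs (f v a, Function.update S k l) s' T)
    (h' : (forEach k f q).Runs s' s'' T') : (forEach k f q).Runs (v, S) s'' (T + T' + 1) := by
  intro Λ M e x hM
  have h0 := hM none
  simp only [code] at h0
  obtain ⟨t, ht, h⟩ := h Λ M (fun l => e (some l)) (.goto fun _ => e none) fun l => hM (some l)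
  obtain ⟨t', ht', h'⟩ := h' Λ M e x hM
  refine ⟨t' + t + 1, by omega, ?_⟩
  rw [Function.iterate_succ_apply, Function.iterate_add_apply]
  simp only [stepAux] at h
  simp only [start] at h'
  rw [← h', ← h]
  simp [flip, start, h0, hs]

/-- Running one program for each element of a fixed list. -/
def forList {ι : Type*} (f : ι → Prog Γ σ) : List ι → Prog Γ σ
  | [] => load id
  | i :: l => seq (f i) (forList f l)

theorem runs_forList_nil {ι : Type*} (f : ι → Prog Γ σ) (s : σ × ∀ k, List (Γ k)) :
    (forList f []).Runs s s 1 := runs_load _ _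

/-- The machine carrying out a program, with input stack `i` and output stack `o`. -/
def toMachine [Fintype K] [Fintype σ] (q : Prog Γ σ) (v : σ) (i o : K) [Fintype (Γ i)] :
    Turing.FinTM2 where
  K := K
  k₀ := i
  k₁ := o
  Γ := Γ
  Λ := q.Label
  main := q.start
  ΛFin := q.labelFintype
  σ := σ × Bool
  initialState := (v, false)
  m := q.code id .halt

/-- A program that turns the word `f a` on the stack `i` into the word `g a` on the stack `o`, all
other stacks being empty before and after, gives a polynomial-time computation. -/
theorem polyTime_of_runs [Fintype K] [Fintype σ] (q : Prog Γ σ) (v : σ) (i o : K)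
    [Fintype (Γ i)] {α β A B : Type} (enc : α → List A) (enc' : β → List B) (f : α → β)
    (hA : Γ i = A) (hB : Γ o = B) (T : Polynomial ℕ)
    (h : ∀ a, q.Runs
      (v, Function.update (fun _ => []) i ((enc a).map (Equiv.cast hA).symm))
      (v, Function.update (fun _ => []) o ((enc' (f a)).map (Equiv.cast hB).symm))
      (T.eval (enc a).length)) :
    Nonempty (Turing.TM2ComputableInPolyTime enc enc' f) := by
  have key : ∀ a, Nonempty (Turing.TM2OutputsInTime (q.toMachine v i o)
      ((enc a).map (Equiv.cast hA).symm) (some ((enc' (f a)).map (Equiv.cast hB).symm))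
      (T.eval (enc a).length)) := by
    intro a
    obtain ⟨t, ht, h⟩ := h a q.Label (q.code id .halt) id .halt fun _ => rfl
    refine ⟨⟨t, ?_⟩, ht⟩
    have e1 : Turing.initList (q.toMachine v i o) ((enc a).map (Equiv.cast hA).symm) =
        ⟨some q.start, (v, false),
          Function.update (fun _ => []) i ((enc a).map (Equiv.cast hA).symm)⟩ := by
      simp only [Turing.initList, toMachine]
      congr 1
      funext k
      by_cases hk : k = i
      · subst hk
        exact (dif_pos rfl).trans (Function.update_self (β := fun k => List (Γ k)) _ _ _).symm
      · exact (dif_neg hk).trans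
          (Function.update_of_ne (β := fun k => List (Γ k)) hk _ fun _ => []).symm
    have e2 : Turing.haltList (q.toMachine v i o) ((enc' (f a)).map (Equiv.cast hB).symm) =
        ⟨none, (v, false),
          Function.update (fun _ => []) o ((enc' (f a)).map (Equiv.cast hB).symm)⟩ := by
      simp only [Turing.haltList, toMachine]
      congr 1
      funext k
      by_cases hk : k = o
      · subst hk
        exact (dif_pos rfl).trans (Function.update_self (β := fun k => List (Γ k)) _ _ _).symm
      · exact (dif_neg hk).trans
          (Function.update_of_ne (β := fun k => List (Γ k)) hk _ fun _ => []).symm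
    rw [e1]
    simp only [Option.map_some, e2]
    exact h
  exact ⟨{ tm := q.toMachine v i o
           inputAlphabet := Equiv.cast hA
           outputAlphabet := Equiv.cast hB
           time := T
           outputsFun := fun a => (key a).some }⟩

end Prog

end StackProgram

/-! ### The program that writes a graph made of blocks -/

namespace BlockGraph

open StackProgram StackProgram.Prog

/-- The three kinds of blocks: one block for each variable, one for each clause, and one more. -/
inductive Kind
  | var
  | special
  | clause
  deriving DecidableEq

instance : Fintype Kind where
  elems := {.var, .special, .clause}
  complete := by intro x; cases x <;> simp

/-- A block: its kind, its position in the list of all blocks and, for the block of a clause, the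
literals of the clause, given by the position of the block of the variable and by the sign. -/
structure Block (k : ℕ) where
  kind : Kind
  idx : ℕ
  lits : Fin k → Option (ℕ × Bool)

/-- For each literal of a block, its sign if it is a literal on the block at position `c`. -/
def incidence {k : ℕ} (L : Fin k → Option (ℕ × Bool)) (c : ℕ) : Fin k → Option Bool :=
  fun j => (L j).bind fun x => if x.1 = c then some x.2 else none

/-- What the adjacencies between the vertices of two blocks depend on. -/
structure Info (k : ℕ) where
  rowKind : Kind
  colKind : Kind
  self : Bool
  rowInc : Fin k → Option Bool
  colInc : Fin k → Option Bool

noncomputable instance (k : ℕ) : Fintype (Info k) :=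
  Fintype.ofInjective (fun i => (i.rowKind, i.colKind, i.self, i.rowInc, i.colInc)) <| by
    rintro ⟨⟩ ⟨⟩ h
    simpa using h

/-- The relation between two blocks. -/
def Block.info {k : ℕ} (b b' : Block k) : Info k where
  rowKind := b.kind
  colKind := b'.kind
  self := b.idx == b'.idx
  rowInc := incidence b.lits b'.idx
  colInc := incidence b'.lits b.idx

/-- The block of the `j`-th literal of a clause, and the sign of the literal. -/
def literalData {k n : ℕ} (C : Clause k n) (j : Fin k) : ℕ × Bool :=
  ((C.lit j).var, (C.lit j).positive)

/-- The block of the variable at position `y`. -/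
def varBlock (k y : ℕ) : Block k := ⟨.var, y, fun _ => none⟩

/-- The special block of a formula with `n` variables. -/
def specialBlock (k n : ℕ) : Block k := ⟨.special, n, fun _ => none⟩

/-- The block, at position `c`, of a clause with the literals `D`. -/
def clauseBlock {k : ℕ} (c : ℕ) (D : Fin k → ℕ × Bool) : Block k :=
  ⟨.clause, c, fun j => some (D j)⟩

/-- The blocks of the clauses, from position `c` on. -/
def clauseBlocks {k : ℕ} : ℕ → List (Fin k → ℕ × Bool) → List (Block k)
  | _, [] => []
  | c, D :: l => clauseBlock c D :: clauseBlocks (c + 1) l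

/-- The blocks of a formula with `n` variables and the clauses `l`. -/
def blockList {k : ℕ} (n : ℕ) (l : List (Fin k → ℕ × Bool)) : List (Block k) :=
  (List.range n).map (varBlock k) ++ specialBlock k n :: clauseBlocks (n + 1) l

/-- The stacks of the program: the input, its reversal, a marked copy of the input and a second
stack over which it is moved, a counter for each literal of the current clause, the relations of
the current block to all blocks and a second stack over which they are moved, and the output. -/
inductive Stk (k : ℕ)
  | inp
  | rev
  | tape
  | tape2
  | cnt (j : Fin k)
  | row
  | row2
  | out
  deriving DecidableEq, Fintype

/-- The alphabets of the stacks. -/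
abbrev Alph (k : ℕ) : Stk k → Type
  | .inp => FormulaSymbol
  | .rev => FormulaSymbol
  | .tape => FormulaSymbol × Bool
  | .tape2 => FormulaSymbol × Bool
  | .cnt _ => Unit
  | .row => Info k
  | .row2 => Info k
  | .out => Bool

/-- The stacks with given contents. -/
abbrev contents {k : ℕ} (inp rev : List FormulaSymbol) (tape tape2 : List (FormulaSymbol × Bool))
    (cnt : Fin k → List Unit) (row row2 : List (Info k)) (out : List Bool) :
    ∀ s : Stk k, List (Alph k s)
  | .inp => inp
  | .rev => rev
  | .tape => tape
  | .tape2 => tape2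
  | .cnt j => cnt j
  | .row => row
  | .row2 => row2
  | .out => out

section update

variable {k : ℕ} (inp rev inp' : List FormulaSymbol)
  (tape tape2 tape' : List (FormulaSymbol × Bool))
  (cnt : Fin k → List Unit) (row row2 row' : List (Info k)) (out out' : List Bool)

theorem update_inp : Function.update (contents inp rev tape tape2 cnt row row2 out) .inp inp' =
    contents inp' rev tape tape2 cnt row row2 out := by
  funext s; cases s <;> rfl

theorem update_rev : Function.update (contents inp rev tape tape2 cnt row row2 out) .rev inp' =
    contents inp inp' tape tape2 cnt row row2 out := by
  funext s; cases s <;> rfl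

theorem update_tape : Function.update (contents inp rev tape tape2 cnt row row2 out) .tape tape' =
    contents inp rev tape' tape2 cnt row row2 out := by
  funext s; cases s <;> rfl

theorem update_tape2 : Function.update (contents inp rev tape tape2 cnt row row2 out) .tape2 tape' =
    contents inp rev tape tape' cnt row row2 out := by
  funext s; cases s <;> rfl

theorem update_cnt (j : Fin k) (l : List Unit) :
    Function.update (contents inp rev tape tape2 cnt row row2 out) (.cnt j) l =
      contents inp rev tape tape2 (Function.update cnt j l) row row2 out := by
  funext s
  cases s with
  | cnt i =>
    by_cases h : i = j
    · subst h; simp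
    · rw [Function.update_of_ne (by simpa using h)]; simp [h]
  | _ => rfl

theorem update_row : Function.update (contents inp rev tape tape2 cnt row row2 out) .row row' =
    contents inp rev tape tape2 cnt row' row2 out := by
  funext s; cases s <;> rfl

theorem update_row2 : Function.update (contents inp rev tape tape2 cnt row row2 out) .row2 row' =
    contents inp rev tape tape2 cnt row row' out := by
  funext s; cases s <;> rfl

theorem update_out : Function.update (contents inp rev tape tape2 cnt row row2 out) .out out' =
    contents inp rev tape tape2 cnt row row2 out' := by
  funext s; cases s <;> rfl

end update

/-- What the outer pass over the formula does with a symbol. -/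
inductive Action
  | nothing
  | count
  | writeRow
  deriving DecidableEq

instance : Fintype Action where
  elems := {.nothing, .count, .writeRow}
  complete := by intro x; cases x <;> simp

/-- The internal state of the outer pass: whether it is in the header, the number of literals of
the current clause read so far, the signs of those literals whose counter has not run out, the
kind of the current block, and the action caused by the current symbol. -/
structure Outer (k : ℕ) where
  header : Bool
  pos : Fin (k + 1)
  live : Fin k → Option Bool
  kind : Kind
  action : Action
  deriving Fintype

/-- The internal state of the inner pass: whether it is in the header, the number of literals of
the current clause read so far, whether no tick of the current literal has been read, whether the
current block of the outer pass has been met, the incidences of the current clauses of the inner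
and of the outer pass, the marked symbol to be written back, the kind of the block ending at the
current symbol, and whether it is the current block of the outer pass. -/
structure Inner (k : ℕ) where
  header : Bool
  pos : Fin (k + 1)
  fresh : Bool
  seen : Bool
  colInc : Fin k → Option Bool
  rowInc : Fin k → Option Bool
  emit : Option (FormulaSymbol × Bool)
  col : Option Kind
  self : Bool

noncomputable instance (k : ℕ) : Fintype (Inner k) :=
  Fintype.ofInjective (fun i => (i.header, i.pos, i.fresh, i.seen, i.colInc, i.rowInc, i.emit,
    i.col, i.self)) <| by
    rintro ⟨⟩ ⟨⟩ h
    simpa using h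

/-- The internal state of the program: those of the two passes, and registers for an unmarked
symbol and for a relation. -/
structure State (k : ℕ) where
  outer : Outer k
  inner : Inner k
  sym : FormulaSymbol
  cur : Info k

noncomputable instance (k : ℕ) : Fintype (State k) :=
  Fintype.ofInjective (fun v => (v.outer, v.inner, v.sym, v.cur)) <| by
    rintro ⟨⟩ ⟨⟩ h
    simpa using h

variable {k : ℕ}

/-- The inner pass at its start. -/
def Inner.init (k : ℕ) : Inner k where
  header := true
  pos := 0
  fresh := true
  seen := false
  colInc := fun _ => none
  rowInc := fun _ => none
  emit := none
  col := none
  self := false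

/-- The outer pass at its start. -/
def Outer.init (k : ℕ) : Outer k where
  header := true
  pos := 0
  live := fun _ => none
  kind := .var
  action := .nothing

/-- The content of the register for relations when it is not in use. -/
def Info.blank (k : ℕ) : Info k := ⟨.var, .var, false, fun _ => none, fun _ => none⟩

/-- The internal state between two rounds of the inner pass. -/
def State.rest (o : Outer k) : State k := ⟨o, Inner.init k, .tick, Info.blank k⟩

/-- The effect of a symbol on the state of the outer pass. -/
def Outer.next (o : Outer k) (a : FormulaSymbol) : Outer k :=
  if o.header then
    if a = .tick then { o with kind := .var, action := .writeRow }
    else { o with kind := .special, action := .writeRow, header := false }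
  else
    match a with
    | .tick => { o with action := .count }
    | .sep => { o with kind := .clause, action := .writeRow, pos := 0 }
    | .pos => { o with
        live := fun j => if j.val = o.pos.val then some true else o.live j
        pos := Fin.ofNat (k + 1) (o.pos.val + 1) }
    | .neg => { o with
        live := fun j => if j.val = o.pos.val then some false else o.live j
        pos := Fin.ofNat (k + 1) (o.pos.val + 1) }

/-- The effect, on the state of the inner pass, of the last symbol of a block of kind `κ`. -/
def Inner.nextBlock (i : Inner k) (κ : Kind) (a : FormulaSymbol × Bool) : Inner k :=
  { i with
    header := i.header && κ == .var
    seen := i.seen || !a.2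
    self := !i.seen && !a.2
    col := some κ
    emit := some (a.1, a.2 || !i.seen) }

/-- The effect of the sign of a literal on the state of the inner pass. -/
def Inner.nextSign (i : Inner k) (s : Bool) (a : FormulaSymbol × Bool) : Inner k :=
  { i with
    colInc := fun j => if j.val = i.pos.val then
      (if i.fresh && !a.2 then some s else none) else i.colInc j
    emit := some (a.1, a.2 || i.fresh)
    fresh := true
    pos := Fin.ofNat (k + 1) (i.pos.val + 1) }

/-- The effect of a symbol on the state of the inner pass. -/
def Inner.next (i : Inner k) (a : FormulaSymbol × Bool) : Inner k :=
  if i.header then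
    match a.1 with
    | .tick => i.nextBlock .var a
    | _ => i.nextBlock .special a
  else
    match a.1 with
    | .tick => if i.fresh then { i with fresh := false } else { i with emit := some a }
    | .sep => i.nextBlock .clause a
    | .pos => i.nextSign true a
    | .neg => i.nextSign false a

/-- One step of the counter of the `j`-th literal of the current clause. -/
def State.popCounter (v : State k) (j : Fin k) (c : Option Unit) : State k :=
  { v with
    outer := { v.outer with
      live := fun i => if i = j then (if c.isSome then v.outer.live j else none)
        else v.outer.live i }
    inner := { v.inner with
      rowInc := fun i => if i = j then (if c.isSome then none else v.outer.live j)
        else v.inner.rowInc i } }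

/-- The relation found by the inner pass. -/
def State.found (v : State k) : Info k :=
  ⟨v.outer.kind, v.inner.col.getD .var, v.inner.self, v.inner.rowInc, v.inner.colInc⟩

/-- The state of the inner pass after the relation to a block has been recorded. -/
def Inner.afterBlock (i : Inner k) : Inner k :=
  { Inner.init k with header := i.header, seen := i.seen }

/-- Writing back a symbol of the inner pass and, at the end of a block, recording the relation. -/
def innerBody (k : ℕ) : Prog (Alph k) (State k) :=
  .seq (.ite (fun v => v.inner.emit.isSome)
      (.push .tape2 fun v => v.inner.emit.getD (.tick, false)) (.load id)) <|
    .seq (.load fun v => { v with inner := { v.inner with emit := none } }) <|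
    .ite (fun v => v.inner.col.isSome)
      (.seq (forList (fun j => .pop (.cnt j) fun v c => v.popCounter j c) (List.finRange k)) <|
        .seq (.push .row fun v => v.found) <|
          .load fun v => { v with inner := v.inner.afterBlock })
      (.load id)

/-- The inner pass, which finds the relations of the current block to all blocks. -/
def innerPass (k : ℕ) : Prog (Alph k) (State k) :=
  .forEach .tape (fun v a => { v with inner := v.inner.next a }) (innerBody k)

/-- Moving the marked copy of the formula back. -/
def moveBack (k : ℕ) : Prog (Alph k) (State k) :=
  .forEach .tape2 (fun v a => { v with inner := { v.inner with emit := some a } })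
    (.seq (.push .tape fun v => v.inner.emit.getD (.tick, false))
      (.load fun v => { v with inner := Inner.init k }))

/-- Reversing the list of relations. -/
def flipRow (k : ℕ) : Prog (Alph k) (State k) :=
  .forEach .row (fun v a => { v with cur := a })
    (.seq (.push .row2 fun v => v.cur) (.load fun v => { v with cur := Info.blank k }))

variable {τ : Type} (typs : List τ) (bit : Info k → τ → τ → Bool)

/-- Writing the row of the adjacency matrix of the vertex of type `t` in the current block. -/
def writeVertex (t : τ) : Prog (Alph k) (State k) :=
  .forEach .row2 (fun v a => { v with cur := a })
    (.seq (.push .row fun v => v.cur) <|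
      .seq (forList (fun t' => .push .out fun v => bit v.cur t t') typs) <|
        .load fun v => { v with cur := Info.blank k })

/-- Writing the rows of all vertices of the current block. -/
def writeRows : Prog (Alph k) (State k) :=
  .seq (innerPass k) <| .seq (.load fun v => { v with inner := Inner.init k }) <|
    .seq (moveBack k) <|
    .seq (forList (fun t => .seq (flipRow k) (writeVertex typs bit t)) typs) <|
    .forEach .row (fun v _ => v) (.load id)

/-- The outer pass: it loads the counters of the literals, and writes rows at the end of each
block. -/
def outerPass : Prog (Alph k) (State k) :=
  .forEach .inp (fun v a => { v with outer := v.outer.next a })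
    (.seq (.ite (fun v => v.outer.action == .writeRow) (writeRows typs bit)
        (forList (fun j => .ite (fun v => v.outer.action == .count && v.outer.pos.val == j.val)
          (.push (.cnt j) fun _ => ()) (.load id)) (List.finRange k)))
      (.load fun v => { v with outer := { v.outer with action := .nothing } }))

/-- Reversing the input. -/
def readInput (k : ℕ) : Prog (Alph k) (State k) :=
  .forEach .inp (fun v a => { v with sym := a }) (.push .rev fun v => v.sym)

/-- Restoring the input, and making the copy in which symbols can be marked. -/
def copyInput (k : ℕ) : Prog (Alph k) (State k) :=
  .forEach .rev (fun v a => { v with sym := a })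
    (.seq (.push .inp fun v => v.sym) (.push .tape fun v => (v.sym, false)))

/-- The program that writes the adjacency matrix. -/
def program : Prog (Alph k) (State k) :=
  .seq (readInput k) <| .seq (copyInput k) <| .seq (.load fun _ => State.rest (Outer.init k)) <|
    .seq (outerPass typs bit) <| .seq (.forEach .tape (fun v _ => v) (.load id)) <|
      .load fun _ => State.rest (Outer.init k)

end BlockGraph

/-! ### The inner pass: the relations of one block to all blocks -/

namespace BlockGraph

open StackProgram StackProgram.Prog

/-- The symbol for the sign of a literal. -/
def signSymbol (s : Bool) : FormulaSymbol := if s then .pos else .neg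

/-- A literal on the marked copy of the formula while the row `r` is written: its first `r` ticks
have been removed, and its sign is marked as soon as there was no tick left to be removed. -/
def tapeLiteral (r : ℕ) (x : ℕ × Bool) : List (FormulaSymbol × Bool) :=
  if r ≤ x.1 then List.replicate (x.1 - r) (.tick, false) ++ [(signSymbol x.2, false)]
  else [(signSymbol x.2, true)]

/-- A clause, whose block is at position `c`, on the marked copy of the formula. -/
def tapeClause {k : ℕ} (r c : ℕ) (D : Fin k → ℕ × Bool) : List (FormulaSymbol × Bool) :=
  (List.finRange k).flatMap (fun j => tapeLiteral r (D j)) ++ [(.sep, decide (c < r))]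

/-- The clauses on the marked copy of the formula. -/
def tapeClauses {k : ℕ} (r : ℕ) : ℕ → List (Fin k → ℕ × Bool) → List (FormulaSymbol × Bool)
  | _, [] => []
  | c, D :: l => tapeClause r c D ++ tapeClauses r (c + 1) l

/-- The marked copy of the formula while the row `r` is written. -/
def tapeWord {k : ℕ} (r n : ℕ) (l : List (Fin k → ℕ × Bool)) : List (FormulaSymbol × Bool) :=
  (List.range n).map (fun y => (.tick, decide (y < r))) ++
    (.sep, decide (n < r)) :: tapeClauses r (n + 1) l

variable {k : ℕ}

/-- The counters after the first `c` columns of a row with the literals `L`. -/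
def counters (L : Fin k → Option (ℕ × Bool)) (c : ℕ) : Fin k → List Unit :=
  fun j => (L j).elim [] fun x => List.replicate (x.1 - c) ()

/-- The signs of the literals whose counter has not run out after the first `c` columns. -/
def liveSigns (L : Fin k → Option (ℕ × Bool)) (c : ℕ) : Fin k → Option Bool :=
  fun j => (L j).bind fun x => if c ≤ x.1 then some x.2 else none

section

variable (inp rev : List FormulaSymbol) (out : List Bool)

/-- A configuration of the inner pass. -/
abbrev innerCfg (o : Outer k) (i : Inner k) (tape tape2 : List (FormulaSymbol × Bool))
    (cnt : Fin k → List Unit) (row : List (Info k)) : State k × ∀ s, List (Alph k s) :=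
  (⟨o, i, .tick, Info.blank k⟩, contents inp rev tape tape2 cnt row [] out)

variable {inp rev out}

/-- The counter of a literal of the current block runs out exactly at the block of its variable,
which is how the incidences of the current block are found. -/
theorem runs_popCounters (L : Fin k → Option (ℕ × Bool)) (c : ℕ) (tape tape2 row row2)
    (l : List (Fin k)) (hl : l.Nodup) (v : State k) (cnt : Fin k → List Unit)
    (hv : ∀ j ∈ l, v.outer.live j = liveSigns L c j) (hc : ∀ j ∈ l, cnt j = counters L c j) :
    (forList (fun j => .pop (.cnt j) fun v c => v.popCounter j c) l : Prog (Alph k) (State k)).Runs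
      (v, contents inp rev tape tape2 cnt row row2 out)
      ({ v with
          outer := { v.outer with
            live := fun j => if j ∈ l then liveSigns L (c + 1) j else v.outer.live j }
          inner := { v.inner with
            rowInc := fun j => if j ∈ l then incidence L c j else v.inner.rowInc j } },
        contents inp rev tape tape2 (fun j => if j ∈ l then counters L (c + 1) j else cnt j)
          row row2 out) (l.length + 1) := by
  induction l generalizing v cnt with
  | nil => simpa using runs_forList_nil _ _
  | cons j l ih =>
    rw [List.nodup_cons] at hl
    have h1 := runs_pop (Γ := Alph k) (.cnt j) (fun (v : State k) c => v.popCounter j c)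
      (v, contents inp rev tape tape2 cnt row row2 out)
    simp only [update_cnt] at h1
    have h2 := ih hl.2 (v.popCounter j (cnt j).head?) (Function.update cnt j (cnt j).tail)
      (by
        intro i hi
        have : i ≠ j := by rintro rfl; exact hl.1 hi
        simp [State.popCounter, this, hv i (by simp [hi])])
      (by
        intro i hi
        have : i ≠ j := by rintro rfl; exact hl.1 hi
        simp [this, hc i (by simp [hi])])
    refine Runs.mono ?_ (show 1 + (l.length + 1) ≤ (j :: l).length + 1 by simp; omega)
    have key : (cnt j).tail = counters L (c + 1) j ∧
        (if (cnt j).head?.isSome then v.outer.live j else none) = liveSigns L (c + 1) j ∧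
        (if (cnt j).head?.isSome then none else v.outer.live j) = incidence L c j := by
      rw [hv j (by simp), hc j (by simp)]
      cases hL : L j with
      | none => simp [counters, liveSigns, incidence, hL]
      | some x =>
        rcases lt_trichotomy c x.1 with h | h | h
        · have e : x.1 - c = (x.1 - (c + 1)) + 1 := by omega
          have e1 : c ≤ x.1 := h.le
          have e2 : c + 1 ≤ x.1 := h
          have e3 : x.1 ≠ c := h.ne'
          simp [counters, liveSigns, incidence, hL, e, e1, e3, h, List.replicate_succ]
        · have e : x.1 - (c + 1) = 0 := by omega
          have e2 : ¬ c + 1 ≤ x.1 := by omega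
          simp [counters, liveSigns, incidence, hL, h]
        · have e : x.1 - c = 0 := by omega
          have e1 : ¬ c ≤ x.1 := by omega
          have e2 : ¬ c + 1 ≤ x.1 := by omega
          have e3 : x.1 ≠ c := h.ne
          have e4 : x.1 - (c + 1) = 0 := by omega
          have e5 : ¬ c < x.1 := by omega
          simp [counters, liveSigns, incidence, hL, e, e1, e3, e4, e5]
    obtain ⟨k1, k2, k3⟩ := key
    have e1 : (fun i => if i ∈ j :: l then counters L (c + 1) i else cnt i) = fun i =>
        if i ∈ l then counters L (c + 1) i else Function.update cnt j (cnt j).tail i := by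
      funext i
      by_cases hi : i = j
      · subst hi; simp [hl.1, k1]
      · simp [hi]
    have e2 : (fun i => if i ∈ j :: l then liveSigns L (c + 1) i else v.outer.live i) = fun i =>
        if i ∈ l then liveSigns L (c + 1) i
        else (v.popCounter j (cnt j).head?).outer.live i := by
      funext i
      by_cases hi : i = j
      · subst hi; simp [hl.1, State.popCounter, ← k2]
      · simp [hi, State.popCounter]
    have e3 : (fun i => if i ∈ j :: l then incidence L c i else v.inner.rowInc i) = fun i =>
        if i ∈ l then incidence L c i
        else (v.popCounter j (cnt j).head?).inner.rowInc i := by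
      funext i
      by_cases hi : i = j
      · subst hi; simp [hl.1, State.popCounter, ← k3]
      · simp [hi, State.popCounter]
    rw [e1, e2, e3]
    exact h1.seq h2

variable {o : Outer k} {i : Inner k} {tape tape2 : List (FormulaSymbol × Bool)}
  {cnt : Fin k → List Unit} {row : List (Info k)}

theorem runs_innerBody_silent (hi : i.emit = none) (hc : i.col = none) :
    (innerBody k).Runs (innerCfg inp rev out o i tape tape2 cnt row)
      (innerCfg inp rev out o i tape tape2 cnt row) (k + 7) := by
  refine Runs.mono ((Runs.ite_false (by simp [hi]) (runs_load _ _)).seq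
    ((runs_load _ _).seq (Runs.ite_false (by simp [hc]) ?_)))
    (show (1 + 1) + (1 + (1 + 1)) ≤ k + 7 by omega)
  have : ({ i with emit := none } : Inner k) = i := by cases i; simp_all
  simp only [id, this]
  exact runs_load _ _

theorem runs_innerBody_emit {a : FormulaSymbol × Bool} (hi : i.emit = some a)
    (hc : i.col = none) :
    (innerBody k).Runs (innerCfg inp rev out o i tape tape2 cnt row)
      (innerCfg inp rev out o { i with emit := none } tape (a :: tape2) cnt row) (k + 7) := by
  refine Runs.mono ((Runs.ite_true (by simp [hi]) (runs_push _ _ _)).seq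
    ((runs_load _ _).seq (Runs.ite_false (by simp [hc]) ?_)))
    (show (1 + 1) + (1 + (1 + 1)) ≤ k + 7 by omega)
  simp only [update_tape2, hi, Option.getD_some]
  exact runs_load _ _

theorem runs_innerBody_block {a : FormulaSymbol × Bool} {κ : Kind} {L : Fin k → Option (ℕ × Bool)}
    {c : ℕ} (hi : i.emit = some a) (hc : i.col = some κ) (ho : o.live = liveSigns L c) :
    (innerBody k).Runs (innerCfg inp rev out o i tape tape2 (counters L c) row)
      (innerCfg inp rev out { o with live := liveSigns L (c + 1) } i.afterBlock tape (a :: tape2)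
        (counters L (c + 1)) (⟨o.kind, κ, i.self, incidence L c, i.colInc⟩ :: row)) (k + 7) := by
  have h := runs_popCounters (inp := inp) (rev := rev) (out := out) L c tape (a :: tape2) row []
    (List.finRange k) (List.nodup_finRange k) ⟨o, { i with emit := none }, .tick, Info.blank k⟩
    (counters L c) (by simp [ho]) (by simp)
  simp only [List.mem_finRange, if_true, List.length_finRange] at h
  refine Runs.mono ((Runs.ite_true (by simp [hi]) (runs_push _ _ _)).seq
    ((runs_load _ _).seq (Runs.ite_true (by simp [hc]) ?_)))
    (show (1 + 1) + (1 + ((k + 1) + (1 + 1) + 1)) ≤ k + 7 by omega)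
  simp only [update_tape2, hi, Option.getD_some]
  have h1 := runs_push (Γ := Alph k) .row (fun v : State k => v.found)
    (⟨{ o with live := liveSigns L (c + 1) },
      { i with emit := none, rowInc := incidence L c }, .tick, Info.blank k⟩,
      contents inp rev tape (a :: tape2) (counters L (c + 1)) row [] out)
  have e : State.found ⟨{ o with live := liveSigns L (c + 1) },
      { i with emit := none, rowInc := incidence L c }, .tick, Info.blank k⟩ =
      ⟨o.kind, κ, i.self, incidence L c, i.colInc⟩ := by
    simp [State.found, hc]
  simp only [update_row, e] at h1
  exact h.seq (h1.seq (runs_load _ _))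

/-- As in all lemmas on the passes below, the steps on the first symbols of a stack are put before a
run that starts with the remaining symbols. -/
theorem innerPass_cons {a : FormulaSymbol × Bool} {s s' : State k × ∀ s, List (Alph k s)} {T : ℕ}
    (h : (innerBody k).Runs (innerCfg inp rev out o (i.next a) tape tape2 cnt row) s (k + 7))
    (h' : (innerPass k).Runs s s' T) :
    (innerPass k).Runs (innerCfg inp rev out o i (a :: tape) tape2 cnt row) s' (T + (k + 8)) := by
  refine Runs.mono (Runs.forEach_cons rfl (T := k + 7) (s' := s) ?_ h')
    (by omega)
  simpa only [update_tape] using h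

end

end BlockGraph

namespace BlockGraph

open StackProgram StackProgram.Prog

variable {k : ℕ}

/-- The state of the inner pass inside a clause, after `P` literals whose incidences with the
current block are given by `f`. -/
abbrev Inner.reading (sn : Bool) (P : ℕ) (f : Fin k → Option Bool) : Inner k :=
  { Inner.init k with header := false, seen := sn, pos := Fin.ofNat (k + 1) P, colInc := f }

theorem Inner.next_sign {i : Inner k} (hi : i.header = false) (s b : Bool) :
    i.next (signSymbol s, b) = i.nextSign s (signSymbol s, b) := by
  cases s <;> simp [Inner.next, hi, signSymbol]

section

variable {inp rev : List FormulaSymbol} {out : List Bool} {o : Outer k} {i : Inner k}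
  {tape tape2 : List (FormulaSymbol × Bool)} {cnt : Fin k → List Unit} {row : List (Info k)}
  {s' : State k × ∀ s, List (Alph k s)} {T : ℕ}

/-- The first tick of a literal is removed and sets `fresh` to `false`; its other ticks are kept. -/
theorem innerPass_ticks (d : ℕ) (h1 : i.header = false) (h2 : i.fresh = false)
    (h3 : i.emit = none) (h4 : i.col = none)
    (h : (innerPass k).Runs (innerCfg inp rev out o i tape
      (List.replicate d (.tick, false) ++ tape2) cnt row) s' T) :
    (innerPass k).Runs (innerCfg inp rev out o i (List.replicate d (.tick, false) ++ tape)
      tape2 cnt row) s' (T + d * (k + 8)) := by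
  induction d generalizing tape2 with
  | zero => simpa using h
  | succ d ih =>
    have e : i.next (.tick, false) = { i with emit := some (.tick, false) } := by
      simp [Inner.next, h1, h2]
    have e' : ({ ({ i with emit := some (.tick, false) } : Inner k) with emit := none } : Inner k)
        = i := by
      cases i; simp_all
    have hb := runs_innerBody_emit (inp := inp) (rev := rev) (out := out) (o := o)
      (i := { i with emit := some (.tick, false) })
      (tape := List.replicate d (.tick, false) ++ tape) (tape2 := tape2) (cnt := cnt) (row := row)
      rfl h4
    rw [e', ← e] at hb
    refine Runs.mono (innerPass_cons hb (ih (tape2 := (.tick, false) :: tape2) ?_))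
      (show T + d * (k + 8) + (k + 8) ≤ T + (d + 1) * (k + 8) by ring_nf; rfl)
    rw [List.replicate_succ', List.append_assoc] at h
    exact h

theorem innerPass_sign {sn : Bool} {P : ℕ} (hP : P ≤ k) {f : Fin k → Option Bool} (s b fr : Bool)
    (h : (innerPass k).Runs (innerCfg inp rev out o (Inner.reading sn (P + 1)
      fun j => if j.val = P then (if fr && !b then some s else none) else f j)
      tape ((signSymbol s, b || fr) :: tape2) cnt row) s' T) :
    (innerPass k).Runs (innerCfg inp rev out o { Inner.reading sn P f with fresh := fr }
      ((signSymbol s, b) :: tape) tape2 cnt row) s' (T + (k + 8)) := by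
  have hb := runs_innerBody_emit (inp := inp) (rev := rev) (out := out) (o := o)
    (i := ({ Inner.reading sn P f with fresh := fr } : Inner k).next (signSymbol s, b))
    (tape := tape) (tape2 := tape2) (cnt := cnt) (row := row)
    (a := (signSymbol s, b || fr)) (by rw [Inner.next_sign rfl]; rfl)
    (by rw [Inner.next_sign rfl]; rfl)
  refine innerPass_cons hb ?_
  have hm : P % (k + 1) = P := Nat.mod_eq_of_lt (by omega)
  have e : ({ ({ Inner.reading sn P f with fresh := fr } : Inner k).nextSign s (signSymbol s, b)
      with emit := none } : Inner k) = Inner.reading sn (P + 1)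
        fun j => if j.val = P then (if fr && !b then some s else none) else f j := by
    simp [Inner.nextSign, hm, Inner.reading, Inner.init]
  rw [Inner.next_sign rfl, e]
  exact h

/-- A literal without ticks that is not yet marked is a literal on the current block. -/
theorem innerPass_literal {r : ℕ} {x : ℕ × Bool} {sn : Bool} {P : ℕ} (hP : P ≤ k)
    {f : Fin k → Option Bool}
    (h : (innerPass k).Runs (innerCfg inp rev out o (Inner.reading sn (P + 1)
      fun j => if j.val = P then (if x.1 = r then some x.2 else none) else f j)
      tape ((tapeLiteral (r + 1) x).reverse ++ tape2) cnt row) s' T) :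
    (innerPass k).Runs (innerCfg inp rev out o (Inner.reading sn P f) (tapeLiteral r x ++ tape)
      tape2 cnt row) s' (T + (tapeLiteral r x).length * (k + 8)) := by
  obtain ⟨v, s⟩ := x
  rcases lt_trichotomy v r with hv | rfl | hv
  · have e1 : ¬ r ≤ v := by omega
    have e2 : ¬ r + 1 ≤ v := by omega
    have e3 : v ≠ r := by omega
    simp only [tapeLiteral, e1, e2, e3, if_false, List.length_singleton, one_mul] at h ⊢
    exact innerPass_sign hP s true true (by simpa using h)
  · have e2 : ¬ v + 1 ≤ v := by omega
    simp only [tapeLiteral, e2, if_false, le_refl, if_true, Nat.sub_self, List.replicate_zero,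
      List.nil_append, List.length_singleton, one_mul] at h ⊢
    exact innerPass_sign hP s false true (by simpa using h)
  · obtain ⟨d, rfl⟩ : ∃ d, v = r + (d + 1) := ⟨v - r - 1, by omega⟩
    have e1 : r ≤ r + (d + 1) := by omega
    have e2 : r + 1 ≤ r + (d + 1) := by omega
    have e3 : r + (d + 1) ≠ r := by omega
    have e4 : r + (d + 1) - r = d + 1 := by omega
    have e5 : r + (d + 1) - (r + 1) = d := by omega
    simp only [tapeLiteral, e1, e2, e3, e4, e5, if_false, if_true, List.replicate_succ,
      List.cons_append, List.append_assoc, List.reverse_append, List.reverse_singleton,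
      List.reverse_replicate, List.nil_append] at h ⊢
    have hb := runs_innerBody_silent (inp := inp) (rev := rev) (out := out) (o := o)
      (i := (Inner.reading sn P f).next (.tick, false))
      (tape := List.replicate d (.tick, false) ++ (signSymbol s, false) :: tape)
      (tape2 := tape2) (cnt := cnt) (row := row) rfl rfl
    refine Runs.mono (innerPass_cons hb (innerPass_ticks d rfl rfl rfl rfl
      (innerPass_sign hP s false false (by simpa using h)))) (le_of_eq ?_)
    simp; ring

theorem innerPass_literals {r : ℕ} (D : Fin k → ℕ × Bool) {sn : Bool}
    (h : (innerPass k).Runs (innerCfg inp rev out o (Inner.reading sn k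
      fun j => if (D j).1 = r then some (D j).2 else none) tape
      (((List.finRange k).flatMap fun j => tapeLiteral (r + 1) (D j)).reverse ++ tape2) cnt row)
      s' T) :
    (innerPass k).Runs (innerCfg inp rev out o (Inner.reading sn 0 fun _ => none)
      ((List.finRange k).flatMap (fun j => tapeLiteral r (D j)) ++ tape) tape2 cnt row) s'
      (T + ((List.finRange k).flatMap fun j => tapeLiteral r (D j)).length * (k + 8)) := by
  -- The literals are processed from the last one backwards.
  have key : ∀ (d : ℕ) (P : ℕ), P + d = k → ∀ (tape2 : List (FormulaSymbol × Bool)),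
      (innerPass k).Runs (innerCfg inp rev out o (Inner.reading sn k
        fun j => if (D j).1 = r then some (D j).2 else none) tape
        ((((List.finRange k).drop P).flatMap fun j => tapeLiteral (r + 1) (D j)).reverse ++ tape2)
        cnt row) s' T →
      (innerPass k).Runs (innerCfg inp rev out o (Inner.reading sn P fun j =>
          if j.val < P then (if (D j).1 = r then some (D j).2 else none) else none)
        (((List.finRange k).drop P).flatMap (fun j => tapeLiteral r (D j)) ++ tape) tape2 cnt row)
        s' (T + (((List.finRange k).drop P).flatMap fun j => tapeLiteral r (D j)).length *
          (k + 8)) := by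
    intro d
    induction d with
    | zero =>
      intro P hP tape2 h
      obtain rfl : P = k := by omega
      have : (List.finRange P).drop P = [] := by simp
      rw [this] at h ⊢
      simpa using h
    | succ d ih =>
      intro P hP tape2 h
      have hlt : P < k := by omega
      have e : (List.finRange k).drop P = ⟨P, hlt⟩ :: (List.finRange k).drop (P + 1) := by
        rw [List.drop_eq_getElem_cons (by simpa using hlt)]
        simp
      rw [e] at h ⊢
      simp only [List.flatMap_cons, List.append_assoc, List.reverse_append] at h ⊢
      have h1 := ih (P + 1) (by omega) _ h
      refine (innerPass_literal (T := T + (((List.finRange k).drop (P + 1)).flatMap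
        fun j => tapeLiteral r (D j)).length * (k + 8)) (by omega) ?_).mono (le_of_eq ?_)
      · have e : (fun j : Fin k => if j.val = P then
              (if (D ⟨P, hlt⟩).1 = r then some (D ⟨P, hlt⟩).2 else none)
            else if j.val < P then (if (D j).1 = r then some (D j).2 else none) else none) =
            fun j : Fin k => if j.val < P + 1 then
              (if (D j).1 = r then some (D j).2 else none) else none := by
          funext j
          by_cases hj : j.val = P
          · have : j = ⟨P, hlt⟩ := Fin.ext hj
            subst this
            simp
          · have : j.val < P + 1 ↔ j.val < P := by omega
            simp only [hj, this, if_false]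
        rw [e]
        exact h1
      · simp only [List.length_append]
        ring
  have := key k 0 (by omega) tape2 (by simpa using h)
  simpa using this

end

end BlockGraph

namespace BlockGraph

open StackProgram StackProgram.Prog

variable {k : ℕ}

section

variable {inp rev : List FormulaSymbol} {out : List Bool} {o : Outer k} {i : Inner k}
  {tape tape2 : List (FormulaSymbol × Bool)} {row : List (Info k)}
  {s' : State k × ∀ s, List (Alph k s)} {T : ℕ} {L : Fin k → Option (ℕ × Bool)} {r : ℕ}

/-- The last symbol of the block at position `c` is marked if and only if the row of the block
has been written; the first block that is not marked is the current one. -/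
theorem innerPass_block {κ : Kind} {a : FormulaSymbol} {c : ℕ} (ho : o.live = liveSigns L c)
    (hi : i.seen = decide (r < c))
    (hn : i.next (a, decide (c < r)) = i.nextBlock κ (a, decide (c < r)))
    (h : (innerPass k).Runs (innerCfg inp rev out { o with live := liveSigns L (c + 1) }
      { Inner.init k with header := i.header && κ == .var, seen := decide (r < c + 1) }
      tape ((a, decide (c < r + 1)) :: tape2) (counters L (c + 1))
      (⟨o.kind, κ, r == c, incidence L c, i.colInc⟩ :: row)) s' T) :
    (innerPass k).Runs (innerCfg inp rev out o i ((a, decide (c < r)) :: tape) tape2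
      (counters L c) row) s' (T + (k + 8)) := by
  have e1 : (decide (c < r) || !i.seen) = decide (c < r + 1) := by
    rw [hi, Bool.eq_iff_iff]; simp; omega
  have e2 : (i.seen || !decide (c < r)) = decide (r < c + 1) := by
    rw [hi, Bool.eq_iff_iff]; simp; omega
  have e3 : (!i.seen && !decide (c < r)) = (r == c) := by
    rw [hi, Bool.eq_iff_iff]; simp; omega
  have hb := runs_innerBody_block (inp := inp) (rev := rev) (out := out)
    (i := i.nextBlock κ (a, decide (c < r))) (tape := tape) (tape2 := tape2) (row := row)
    (κ := κ) rfl rfl ho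
  rw [← hn] at hb
  refine innerPass_cons hb ?_
  rw [hn]
  simp only [Inner.nextBlock, Inner.afterBlock, e1, e2, e3]
  exact h

theorem innerPass_clauses (B : Block k) (hB : B.lits = L) (hr : B.idx = r) (hk : B.kind = o.kind)
    (l : List (Fin k → ℕ × Bool)) (c : ℕ) (ho : o.live = liveSigns L c) :
    (innerPass k).Runs
      (innerCfg inp rev out o (Inner.reading (decide (r < c)) 0 fun _ => none)
        (tapeClauses r c l) tape2 (counters L c) row)
      (innerCfg inp rev out { o with live := liveSigns L (c + l.length) }
        (Inner.reading (decide (r < c + l.length)) 0 fun _ => none) []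
        ((tapeClauses (r + 1) c l).reverse ++ tape2) (counters L (c + l.length))
        (((clauseBlocks c l).map B.info).reverse ++ row))
      ((tapeClauses r c l).length * (k + 8) + 1) := by
  induction l generalizing c o tape2 row with
  | nil =>
    have : ({ o with live := liveSigns L c } : Outer k) = o := by rw [← ho]
    simp only [List.length_nil, add_zero, this, tapeClauses, clauseBlocks, List.map_nil,
      List.reverse_nil, List.nil_append, zero_mul, zero_add]
    exact runs_forEach_nil rfl
  | cons D l ih =>
    have h := ih (o := { o with live := liveSigns L (c + 1) }) (c := c + 1)
      (tape2 := (.sep, decide (c < r + 1)) ::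
        (((List.finRange k).flatMap fun j => tapeLiteral (r + 1) (D j)).reverse ++ tape2))
      (row := B.info (clauseBlock c D) :: row) hk rfl
    have hm : k % (k + 1) = k := Nat.mod_eq_of_lt (by omega)
    have hD : incidence (fun j => some (D j)) r =
        fun j => if (D j).1 = r then some (D j).2 else none := by
      funext j
      simp [incidence]
    have hinfo : (⟨o.kind, .clause, r == c, incidence L c,
        fun j => if (D j).1 = r then some (D j).2 else none⟩ : Info k) =
        B.info (clauseBlock c D) := by
      simp [Block.info, clauseBlock, hB, hr, hk, hD]
    have h1 := innerPass_literals (inp := inp) (rev := rev) (out := out) (o := o) (r := r)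
      (sn := decide (r < c)) (tape := (.sep, decide (c < r)) :: tapeClauses r (c + 1) l)
      (tape2 := tape2) (cnt := counters L c) (row := row) D
      (innerPass_block (κ := .clause) ho rfl rfl (by rw [hinfo]; exact h))
    have e : c + (D :: l).length = c + 1 + l.length := by simp; omega
    rw [e]
    simp only [tapeClauses, tapeClause, clauseBlocks, List.map_cons, List.reverse_cons,
      List.append_assoc, List.reverse_append, List.cons_append, List.nil_append]
    refine h1.mono (le_of_eq ?_)
    simp only [List.length_append, List.length_cons]
    ring

theorem innerPass_header (B : Block k) (hB : B.lits = L) (hr : B.idx = r) (hk : B.kind = o.kind)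
    (d c : ℕ) (ho : o.live = liveSigns L c)
    (h : (innerPass k).Runs
      (innerCfg inp rev out { o with live := liveSigns L (c + d) }
        { Inner.init k with seen := decide (r < c + d) } tape
        (((List.range' c d).map fun y => (.tick, decide (y < r + 1))).reverse ++ tape2)
        (counters L (c + d))
        (((List.range' c d).map fun y => B.info (varBlock k y)).reverse ++ row))
      s' T) :
    (innerPass k).Runs
      (innerCfg inp rev out o { Inner.init k with seen := decide (r < c) }
        ((List.range' c d).map (fun y => (.tick, decide (y < r))) ++ tape) tape2 (counters L c) row)
      s' (T + d * (k + 8)) := by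
  induction d generalizing c o tape2 row with
  | zero =>
    have : ({ o with live := liveSigns L c } : Outer k) = o := by rw [← ho]
    simp only [add_zero, this] at h
    simpa using h
  | succ d ih =>
    have hinfo : (⟨o.kind, .var, r == c, incidence L c, fun _ => none⟩ : Info k) =
        B.info (varBlock k c) := by
      have : incidence (fun _ : Fin k => none) r = fun _ => none := by
        funext j; simp [incidence]
      simp [Block.info, varBlock, hB, hr, hk, this]
    have e : c + 1 + d = c + (d + 1) := by omega
    have h1 := ih (o := { o with live := liveSigns L (c + 1) }) (c := c + 1)
      (tape2 := (.tick, decide (c < r + 1)) :: tape2) (row := B.info (varBlock k c) :: row) hk rfl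
      (by
        rw [e]
        simp only [List.range'_succ, List.map_cons, List.reverse_cons, List.append_assoc,
          List.singleton_append] at h
        exact h)
    simp only [List.range'_succ, List.map_cons, List.cons_append]
    refine (innerPass_block (κ := .var) ho rfl rfl (by
      simp only [Inner.init]
      rw [hinfo]
      exact h1)).mono (le_of_eq ?_)
    ring

/-- One round of the inner pass: it finds the relations of the current block to all blocks. -/
theorem runs_innerPass (B : Block k) (hk : B.kind = o.kind) (n : ℕ) (l : List (Fin k → ℕ × Bool))
    (ho : o.live = liveSigns B.lits 0) :
    (innerPass k).Runs
      (innerCfg inp rev out o (Inner.init k) (tapeWord B.idx n l) [] (counters B.lits 0) [])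
      (innerCfg inp rev out { o with live := liveSigns B.lits (n + 1 + l.length) }
        (Inner.reading (decide (B.idx < n + 1 + l.length)) 0 fun _ => none) []
        (tapeWord (B.idx + 1) n l).reverse (counters B.lits (n + 1 + l.length))
        ((blockList n l).map B.info).reverse)
      ((tapeWord B.idx n l).length * (k + 8) + 1) := by
  have hinfo : (⟨o.kind, .special, B.idx == n, incidence B.lits n, fun _ => none⟩ : Info k) =
      B.info (specialBlock k n) := by
    have : incidence (fun _ : Fin k => none) B.idx = fun _ => none := by
      funext j; simp [incidence]
    simp [Block.info, specialBlock, hk, this]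
  have h1 := innerPass_clauses (inp := inp) (rev := rev) (out := out)
    (o := { o with live := liveSigns B.lits (n + 1) })
    (tape2 := (.sep, decide (n < B.idx + 1)) ::
      ((List.range n).map fun y => (FormulaSymbol.tick, decide (y < B.idx + 1))).reverse)
    (row := B.info (specialBlock k n) ::
      ((List.range n).map fun y => B.info (varBlock k y)).reverse) B rfl rfl hk l (n + 1) rfl
  have h2 := innerPass_block (inp := inp) (rev := rev) (out := out)
    (o := { o with live := liveSigns B.lits n })
    (i := { Inner.init k with seen := decide (B.idx < n) }) (κ := .special) (a := .sep)
    (L := B.lits) (r := B.idx) (c := n) (tape := tapeClauses B.idx (n + 1) l)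
    (tape2 := ((List.range n).map fun y => (FormulaSymbol.tick, decide (y < B.idx + 1))).reverse)
    (row := ((List.range n).map fun y => B.info (varBlock k y)).reverse) rfl rfl rfl
    (by
      simp only [Inner.init]
      rw [hinfo]
      exact h1)
  have h3 := innerPass_header (inp := inp) (rev := rev) (out := out) (o := o)
    (tape := (.sep, decide (n < B.idx)) :: tapeClauses B.idx (n + 1) l) (tape2 := []) (row := [])
    B rfl rfl hk n 0 ho (by
      rw [zero_add, ← List.range_eq_range', List.append_nil, List.append_nil]
      exact h2)
  have e : ({ Inner.init k with seen := decide (B.idx < 0) } : Inner k) = Inner.init k := by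
    simp [Inner.init]
  rw [e, ← List.range_eq_range'] at h3
  have e2 : (List.map (fun y => (FormulaSymbol.tick, decide (y < B.idx + 1))) (List.range n) ++
      (FormulaSymbol.sep, decide (n < B.idx + 1)) :: tapeClauses (B.idx + 1) (n + 1) l).reverse =
      (tapeClauses (B.idx + 1) (n + 1) l).reverse ++ (FormulaSymbol.sep, decide (n < B.idx + 1)) ::
        (List.map (fun y => (FormulaSymbol.tick, decide (y < B.idx + 1)))
          (List.range n)).reverse := by
    simp
  have e3 : ((blockList n l).map B.info).reverse = ((clauseBlocks (n + 1) l).map B.info).reverse ++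
      B.info (specialBlock k n) :: ((List.range n).map fun y => B.info (varBlock k y)).reverse := by
    simp [blockList, Function.comp_def]
  rw [e3]
  simp only [tapeWord]
  rw [e2]
  refine h3.mono (le_of_eq ?_)
  simp only [List.length_append, List.length_cons, List.length_map, List.length_range]
  ring

end

end BlockGraph

/-! ### Writing the rows of a block -/

namespace BlockGraph

open StackProgram StackProgram.Prog

variable {k : ℕ}

section rows

variable {inp rev : List FormulaSymbol} {out : List Bool} {o : Outer k}
  {tape tape2 : List (FormulaSymbol × Bool)} {cnt : Fin k → List Unit} {row row2 : List (Info k)}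

theorem runs_moveBack :
    (moveBack k).Runs (innerCfg inp rev out o (Inner.init k) tape tape2 cnt row)
      (innerCfg inp rev out o (Inner.init k) (tape2.reverse ++ tape) [] cnt row)
      (tape2.length * 3 + 1) := by
  induction tape2 generalizing tape with
  | nil => exact Runs.mono (T := 1) (runs_forEach_nil rfl) (by simp)
  | cons a l ih =>
    refine Runs.mono (Runs.forEach_cons (T := 2) rfl
      ((runs_push (Γ := Alph k) .tape _ _).seq (runs_load _ _)) ?_)
      (show 2 + (l.length * 3 + 1) + 1 ≤ (a :: l).length * 3 + 1 by simp; omega)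
    simp only [update_tape2, update_tape, Option.getD_some, List.reverse_cons, List.append_assoc,
      List.singleton_append]
    exact ih

theorem runs_flipRow :
    (flipRow k).Runs (State.rest o, contents inp rev tape tape2 cnt row row2 out)
      (State.rest o, contents inp rev tape tape2 cnt [] (row.reverse ++ row2) out)
      (row.length * 3 + 1) := by
  induction row generalizing row2 with
  | nil => exact Runs.mono (T := 1) (runs_forEach_nil rfl) (by simp)
  | cons a l ih =>
    refine Runs.mono (Runs.forEach_cons (T := 2) rfl
      ((runs_push (Γ := Alph k) .row2 _ _).seq (runs_load _ _)) ?_)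
      (show 2 + (l.length * 3 + 1) + 1 ≤ (a :: l).length * 3 + 1 by simp; omega)
    simp only [update_row2, update_row, List.reverse_cons, List.append_assoc,
      List.singleton_append]
    exact ih

variable {τ : Type} (typs : List τ) (bit : Info k → τ → τ → Bool)

theorem runs_pushBits (t : τ) (l : List τ) (v : State k) :
    (forList (fun t' => .push .out fun v => bit v.cur t t') l : Prog (Alph k) (State k)).Runs
      (v, contents inp rev tape tape2 cnt row row2 out)
      (v, contents inp rev tape tape2 cnt row row2 ((l.map (bit v.cur t)).reverse ++ out))
      (l.length + 1) := by
  induction l generalizing out with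
  | nil => simpa using runs_forList_nil _ _
  | cons a l ih =>
    refine Runs.mono ((runs_push (Γ := Alph k) .out _ _).seq ?_)
      (show 1 + (l.length + 1) ≤ (a :: l).length + 1 by simp; omega)
    simp only [update_out, List.map_cons, List.reverse_cons, List.append_assoc,
      List.singleton_append]
    exact ih

theorem runs_writeVertex (t : τ) :
    (writeVertex typs bit t).Runs (State.rest o, contents inp rev tape tape2 cnt row row2 out)
      (State.rest o, contents inp rev tape tape2 cnt (row2.reverse ++ row) []
        ((row2.flatMap fun x => typs.map (bit x t)).reverse ++ out))
      (row2.length * (typs.length + 4) + 1) := by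
  induction row2 generalizing row out with
  | nil => exact Runs.mono (T := 1) (runs_forEach_nil rfl) (by simp)
  | cons a l ih =>
    have h := runs_pushBits (inp := inp) (rev := rev) (out := out) (tape := tape)
      (tape2 := tape2) (cnt := cnt) (row := a :: row) (row2 := l) bit t typs
      ⟨o, Inner.init k, .tick, a⟩
    have h0 := runs_push (Γ := Alph k) .row (fun v : State k => v.cur)
      (⟨o, Inner.init k, .tick, a⟩, contents inp rev tape tape2 cnt row l out)
    simp only [update_row] at h0
    have h1 := ih (row := a :: row) (out := (typs.map (bit a t)).reverse ++ out)
    rw [List.flatMap_cons, List.reverse_append, List.append_assoc, List.reverse_cons,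
      List.append_assoc, List.singleton_append]
    refine Runs.mono (Runs.forEach_cons (T := 1 + (typs.length + 1 + 1)) rfl ?_ h1) ?_
    · simp only [update_row2]
      exact h0.seq (h.seq (runs_load _ _))
    · simp only [List.length_cons]
      apply le_of_eq
      ring

theorem runs_discardRow :
    (.forEach .row (fun v _ => v) (.load id) : Prog (Alph k) (State k)).Runs
      (State.rest o, contents inp rev tape tape2 cnt row row2 out)
      (State.rest o, contents inp rev tape tape2 cnt [] row2 out) (row.length * 2 + 1) := by
  induction row with
  | nil => exact Runs.mono (T := 1) (runs_forEach_nil rfl) (by simp)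
  | cons a l ih =>
    refine Runs.mono (Runs.forEach_cons (T := 1) rfl (runs_load _ _) ?_)
      (show 1 + (l.length * 2 + 1) + 1 ≤ (a :: l).length * 2 + 1 by simp; omega)
    simp only [update_row]
    exact ih

theorem runs_discardTape :
    (.forEach .tape (fun v _ => v) (.load id) : Prog (Alph k) (State k)).Runs
      (State.rest o, contents inp rev tape tape2 cnt row row2 out)
      (State.rest o, contents inp rev [] tape2 cnt row row2 out) (tape.length * 2 + 1) := by
  induction tape with
  | nil => exact Runs.mono (T := 1) (runs_forEach_nil rfl) (by simp)
  | cons a l ih =>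
    refine Runs.mono (Runs.forEach_cons (T := 1) rfl (runs_load _ _) ?_)
      (show 1 + (l.length * 2 + 1) + 1 ≤ (a :: l).length * 2 + 1 by simp; omega)
    simp only [update_tape]
    exact ih

theorem runs_writeVertices (l : List τ) :
    (forList (fun t => .seq (flipRow k) (writeVertex typs bit t)) l).Runs
      (State.rest o, contents inp rev tape tape2 cnt row [] out)
      (State.rest o, contents inp rev tape tape2 cnt row []
        ((l.flatMap fun t => row.reverse.flatMap fun x => typs.map (bit x t)).reverse ++ out))
      (l.length * (row.length * (typs.length + 7) + 2) + 1) := by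
  induction l generalizing out with
  | nil => exact Runs.mono (T := 1) (runs_forList_nil _ _) (by simp)
  | cons t l ih =>
    have h := runs_writeVertex (o := o) (inp := inp) (rev := rev) (tape := tape) (tape2 := tape2)
      (cnt := cnt) (row := []) (row2 := row.reverse) (out := out) typs bit t
    have h1 := runs_flipRow (o := o) (inp := inp) (rev := rev) (tape := tape) (tape2 := tape2)
      (cnt := cnt) (row := row) (row2 := []) (out := out)
    simp only [List.append_nil, List.reverse_reverse] at h h1
    rw [List.flatMap_cons, List.reverse_append, List.append_assoc]
    refine ((h1.seq h).seq ih).mono ?_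
    simp only [List.length_cons, List.length_reverse]
    apply le_of_eq
    ring

/-- The bits that are written for the block `B` of a formula with `n` variables and the
clauses `l`. -/
def rowBits (n : ℕ) (l : List (Fin k → ℕ × Bool)) (B : Block k) : List Bool :=
  typs.flatMap fun t => (blockList n l).flatMap fun b => typs.map (bit (B.info b) t)

theorem length_clauseBlocks (c : ℕ) (l : List (Fin k → ℕ × Bool)) :
    (clauseBlocks c l).length = l.length := by
  induction l generalizing c with
  | nil => rfl
  | cons D l ih => simp [clauseBlocks, ih]

theorem length_blockList (n : ℕ) (l : List (Fin k → ℕ × Bool)) :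
    (blockList n l).length = n + 1 + l.length := by
  simp [blockList, length_clauseBlocks]
  omega

theorem length_tapeLiteral (r : ℕ) (x : ℕ × Bool) :
    (tapeLiteral r x).length ≤ (tapeLiteral 0 x).length := by
  unfold tapeLiteral
  split <;> simp

theorem length_tapeClauses (r c : ℕ) (l : List (Fin k → ℕ × Bool)) :
    (tapeClauses r c l).length ≤ (tapeClauses 0 c l).length ∧
      l.length ≤ (tapeClauses r c l).length := by
  induction l generalizing c with
  | nil => simp [tapeClauses]
  | cons D l ih =>
    have := ih (c + 1)
    have h : ((List.finRange k).flatMap fun j => tapeLiteral r (D j)).length ≤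
        ((List.finRange k).flatMap fun j => tapeLiteral 0 (D j)).length := by
      simp only [List.length_flatMap]
      exact List.sum_le_sum fun j _ => length_tapeLiteral r (D j)
    simp only [tapeClauses, tapeClause, List.length_append, List.length_cons]
    omega

theorem length_tapeWord (r n : ℕ) (l : List (Fin k → ℕ × Bool)) :
    (tapeWord r n l).length ≤ (tapeWord 0 n l).length := by
  have := (length_tapeClauses r (n + 1) l).1
  simp only [tapeWord, List.length_append, List.length_map, List.length_cons]
  omega

theorem length_blockList_le (n : ℕ) (l : List (Fin k → ℕ × Bool)) :
    (blockList n l).length ≤ (tapeWord 0 n l).length := by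
  have := (length_tapeClauses 0 (n + 1) l).2
  simp only [length_blockList, tapeWord, List.length_append, List.length_map, List.length_cons,
    List.length_range]
  omega

/-- A bound for the time to write the rows of one block, divided by one more than the length of
the formula. -/
def rowTime (k t : ℕ) : ℕ := k + 20 + t * (t + 9)

/-- One step of the outer pass at the end of a block: the rows of the vertices of the block are
written, and the copy of the formula is prepared for the next block. -/
theorem runs_writeRows (B : Block k) (hk : B.kind = o.kind) (n : ℕ) (l : List (Fin k → ℕ × Bool))
    (ho : o.live = liveSigns B.lits 0)
    (hB : ∀ j, ∀ x ∈ B.lits j, x.1 < n) :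
    (writeRows typs bit).Runs
      (State.rest o, contents inp rev (tapeWord B.idx n l) [] (counters B.lits 0) [] [] out)
      (State.rest { o with live := fun _ => none }, contents inp rev (tapeWord (B.idx + 1) n l) []
        (fun _ => []) [] [] ((rowBits typs bit n l B).reverse ++ out))
      (((tapeWord 0 n l).length + 1) * rowTime k typs.length) := by
  have h1 := runs_innerPass (inp := inp) (rev := rev) (out := out) B hk n l ho
  have e1 : liveSigns B.lits (n + 1 + l.length) = fun _ => none := by
    funext j
    rw [liveSigns]
    cases h : B.lits j with
    | none => rfl
    | some x =>
      have := hB j x (by simp [h])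
      simp only [Option.bind_some, ite_eq_right_iff]
      omega
  have e2 : counters B.lits (n + 1 + l.length) = fun _ => [] := by
    funext j
    rw [counters]
    cases h : B.lits j with
    | none => rfl
    | some x =>
      have := hB j x (by simp [h])
      simp only [Option.elim_some, List.replicate_eq_nil_iff]
      omega
  rw [e1, e2] at h1
  have h2 := runs_moveBack (inp := inp) (rev := rev) (out := out)
    (o := { o with live := fun _ => none }) (tape := [])
    (tape2 := (tapeWord (B.idx + 1) n l).reverse) (cnt := fun _ => [])
    (row := ((blockList n l).map B.info).reverse)
  have h3 := runs_writeVertices (inp := inp) (rev := rev) (out := out)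
    (o := { o with live := fun _ => none }) (tape := tapeWord (B.idx + 1) n l) (tape2 := [])
    (cnt := fun _ => []) (row := ((blockList n l).map B.info).reverse) typs bit typs
  have h4 := runs_discardRow (inp := inp) (rev := rev)
    (out := (rowBits typs bit n l B).reverse ++ out)
    (o := { o with live := fun _ => none }) (tape := tapeWord (B.idx + 1) n l) (tape2 := [])
    (cnt := fun _ => []) (row := ((blockList n l).map B.info).reverse) (row2 := [])
  rw [List.reverse_reverse, List.append_nil] at h2
  simp only [List.reverse_reverse, List.flatMap_map] at h3
  refine (h1.seq ((runs_load _ _).seq (h2.seq (h3.seq h4)))).mono ?_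
  have b1 := length_tapeWord B.idx n l
  have b2 := length_tapeWord (B.idx + 1) n l
  have b3 := length_blockList_le n l
  simp only [List.length_reverse, List.length_map, rowTime]
  generalize (tapeWord B.idx n l).length = x1 at *
  generalize (tapeWord (B.idx + 1) n l).length = x2 at *
  generalize (blockList n l).length = x3 at *
  generalize (tapeWord 0 n l).length = N at *
  generalize typs.length = t
  calc _ ≤ N * (k + 8) + 1 + (1 + (N * 3 + 1 + (t * (N * (t + 7) + 2) + 1 + (N * 2 + 1)))) := by
        gcongr
    _ ≤ _ := by nlinarith [Nat.zero_le (N * t), Nat.zero_le (t * t), Nat.zero_le k]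

end rows

end BlockGraph

/-! ### The outer pass: all blocks -/

namespace BlockGraph

open StackProgram StackProgram.Prog

variable {k : ℕ} {τ : Type} (typs : List τ) (bit : Info k → τ → τ → Bool)

/-- The word for a clause with the literals `D`. -/
def clauseWord (D : Fin k → ℕ × Bool) : List FormulaSymbol :=
  (List.finRange k).flatMap (fun j => List.replicate (D j).1 .tick ++ [signSymbol (D j).2]) ++
    [.sep]

/-- The word for a formula with `n` variables and the clauses `l`. -/
def formulaWord (n : ℕ) (l : List (Fin k → ℕ × Bool)) : List FormulaSymbol :=
  List.replicate n .tick ++ .sep :: l.flatMap clauseWord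

theorem tapeClauses_zero (c : ℕ) (l : List (Fin k → ℕ × Bool)) :
    tapeClauses 0 c l = (l.flatMap clauseWord).map fun a => (a, false) := by
  induction l generalizing c with
  | nil => rfl
  | cons D l ih =>
    simp [tapeClauses, tapeClause, ih, clauseWord, tapeLiteral, List.map_flatMap]

theorem tapeWord_zero (n : ℕ) (l : List (Fin k → ℕ × Bool)) :
    tapeWord 0 n l = (formulaWord n l).map fun a => (a, false) := by
  have : (List.range n).map (fun _ => (FormulaSymbol.tick, false)) =
      List.replicate n (.tick, false) := by
    rw [List.map_const', List.length_range]
  simp [tapeWord, formulaWord, tapeClauses_zero, this]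

section

variable {inp : List FormulaSymbol} {out : List Bool} {o : Outer k}
  {tape : List (FormulaSymbol × Bool)} {cnt : Fin k → List Unit}
  {s' : State k × ∀ s, List (Alph k s)} {T : ℕ} {n : ℕ} {cs : List (Fin k → ℕ × Bool)}

variable (inp out) in
/-- A configuration of the outer pass. -/
abbrev outerCfg (o : Outer k) (tape : List (FormulaSymbol × Bool)) (cnt : Fin k → List Unit) :
    State k × ∀ s, List (Alph k s) :=
  (State.rest o, contents inp [] tape [] cnt [] [] out)

/-- In the outer pass a tick inside a clause is added to the counter of the current literal. -/
theorem runs_count (l : List (Fin k)) (hl : l.Nodup) :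
    (forList (fun j => .ite (fun v => v.outer.action == .count && v.outer.pos.val == j.val)
      (.push (.cnt j) fun _ => ()) (.load id)) l : Prog (Alph k) (State k)).Runs
      (outerCfg inp out o tape cnt)
      (outerCfg inp out o tape fun j =>
        if j ∈ l ∧ o.action = .count ∧ o.pos.val = j.val then () :: cnt j else cnt j)
      (l.length * 2 + 1) := by
  induction l generalizing cnt with
  | nil => simpa using runs_forList_nil _ _
  | cons i l ih =>
    rw [List.nodup_cons] at hl
    have h : (.ite (fun v => v.outer.action == .count && v.outer.pos.val == i.val)
        (.push (.cnt i) fun _ => ()) (.load id) : Prog (Alph k) (State k)).Runs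
        (outerCfg inp out o tape cnt) (outerCfg inp out o tape
          (if o.action = .count ∧ o.pos.val = i.val then Function.update cnt i (() :: cnt i)
            else cnt)) 2 := by
      by_cases hc : o.action = .count ∧ o.pos.val = i.val
      · rw [if_pos hc]
        have := runs_push (Γ := Alph k) (.cnt i) (fun _ : State k => ())
          (outerCfg inp out o tape cnt)
        simp only [update_cnt] at this
        exact Runs.ite_true (by simpa [State.rest] using hc) this
      · rw [if_neg hc]
        refine Runs.ite_false ?_ (runs_load _ _)
        rw [Bool.eq_false_iff]
        simpa [State.rest] using hc
    have e : (fun j => if j ∈ i :: l ∧ o.action = .count ∧ o.pos.val = j.val then () :: cnt j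
        else cnt j) = fun j => if j ∈ l ∧ o.action = .count ∧ o.pos.val = j.val then
          () :: (if o.action = .count ∧ o.pos.val = i.val then Function.update cnt i (() :: cnt i)
            else cnt) j
          else (if o.action = .count ∧ o.pos.val = i.val then Function.update cnt i (() :: cnt i)
            else cnt) j := by
      funext j
      by_cases hj : j = i
      · subst hj
        by_cases hc : o.action = .count ∧ o.pos.val = j.val
        · simp [hl.1, hc]
        · simp [hc]
      · by_cases hc : o.action = .count ∧ o.pos.val = i.val <;> simp [hj, hc]
    rw [e]
    refine (h.seq (ih hl.2)).mono ?_
    simp only [List.length_cons]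
    omega

/-- The time for one step of the outer pass on a formula of length `N`. -/
def outerTime (k t N : ℕ) : ℕ := (N + 1) * rowTime k t + 2 * k + 10

theorem outerPass_cons {a : FormulaSymbol} {N : ℕ}
    (h : (Prog.ite (fun v => v.outer.action == .writeRow) (writeRows typs bit)
        (forList (fun j => .ite (fun v => v.outer.action == .count && v.outer.pos.val == j.val)
          (.push (.cnt j) fun _ => ()) (.load id)) (List.finRange k))).Runs
      (outerCfg inp out (o.next a) tape cnt) s' ((N + 1) * rowTime k typs.length + 2 * k + 2))
    {s'' : State k × ∀ s, List (Alph k s)}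
    (h' : (outerPass typs bit).Runs
      ({ s'.1 with outer := { s'.1.outer with action := .nothing } }, s'.2) s'' T) :
    (outerPass typs bit).Runs (outerCfg (a :: inp) out o tape cnt) s''
      (T + outerTime k typs.length N) := by
  refine Runs.mono (Runs.forEach_cons
    (T := ((N + 1) * rowTime k typs.length + 2 * k + 2) + 1) rfl ?_ h') ?_
  · simp only [update_inp]
    exact h.seq (runs_load _ _)
  · simp only [outerTime]
    omega

/-- A symbol that ends the block `B`. -/
theorem outerPass_block (B : Block k) {a : FormulaSymbol}
    (h1 : (o.next a).action = .writeRow) (h2 : B.kind = (o.next a).kind)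
    (h3 : (o.next a).live = liveSigns B.lits 0) (hB : ∀ j, ∀ x ∈ B.lits j, x.1 < n)
    (h : (outerPass typs bit).Runs (outerCfg inp ((rowBits typs bit n cs B).reverse ++ out)
      { o.next a with live := fun _ => none, action := .nothing } (tapeWord (B.idx + 1) n cs)
      fun _ => []) s' T) :
    (outerPass typs bit).Runs
      (outerCfg (a :: inp) out o (tapeWord B.idx n cs) (counters B.lits 0)) s'
      (T + outerTime k typs.length (tapeWord 0 n cs).length) := by
  have hw := runs_writeRows (inp := inp) (rev := []) (out := out) typs bit B h2 n cs h3 hB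
  refine outerPass_cons typs bit (Runs.mono (Runs.ite_true ?_ hw) ?_) h
  · simp [State.rest, h1]
  · omega

/-- A symbol that does not end a block. -/
theorem outerPass_silent {a : FormulaSymbol} (N : ℕ)
    (h1 : (o.next a).action ≠ .writeRow)
    (h : (outerPass typs bit).Runs (outerCfg inp out { o.next a with action := .nothing } tape
      fun j => if (o.next a).action = .count ∧ (o.next a).pos.val = j.val then () :: cnt j
        else cnt j) s' T) :
    (outerPass typs bit).Runs (outerCfg (a :: inp) out o tape cnt) s'
      (T + outerTime k typs.length N) := by
  have hw := runs_count (inp := inp) (out := out) (o := o.next a) (tape := tape) (cnt := cnt)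
    (List.finRange k) (List.nodup_finRange k)
  simp only [List.mem_finRange, true_and, List.length_finRange] at hw
  refine outerPass_cons typs bit (Runs.mono (Runs.ite_false ?_ hw) ?_) h
  · simpa [State.rest] using h1
  · have := Nat.zero_le ((N + 1) * rowTime k typs.length)
    omega

/-- The state of the outer pass inside the clauses, after `P` literals of the current clause,
the signs of which are given by `f`. -/
abbrev Outer.reading (κ : Kind) (P : ℕ) (f : Fin k → Option Bool) : Outer k :=
  ⟨false, Fin.ofNat (k + 1) P, f, κ, .nothing⟩

theorem Outer.next_sign {P : ℕ} (hP : P < k) (κ : Kind) (f : Fin k → Option Bool) (s : Bool) :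
    { (Outer.reading κ P f).next (signSymbol s) with action := .nothing } =
      Outer.reading κ (P + 1) fun j => if j.val = P then some s else f j := by
  have hm : P % (k + 1) = P := Nat.mod_eq_of_lt (by omega)
  cases s <;> simp [Outer.next, signSymbol, hm]

theorem Outer.next_tick (κ : Kind) (P : ℕ) (f : Fin k → Option Bool) :
    (Outer.reading κ P f).next .tick = { Outer.reading κ P f with action := .count } := by
  simp [Outer.next]

/-- Reading a literal of a clause loads its counter and records its sign. -/
theorem outerPass_literal (N : ℕ) {κ : Kind} {P : ℕ} (hP : P < k) {f : Fin k → Option Bool}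
    (x : ℕ × Bool)
    (h : (outerPass typs bit).Runs (outerCfg inp out (Outer.reading κ (P + 1)
      fun j => if j.val = P then some x.2 else f j) tape
      fun j => if j.val = P then List.replicate x.1 () ++ cnt j else cnt j) s' T) :
    (outerPass typs bit).Runs (outerCfg (List.replicate x.1 .tick ++ signSymbol x.2 :: inp) out
      (Outer.reading κ P f) tape cnt) s' (T + (x.1 + 1) * outerTime k typs.length N) := by
  obtain ⟨v, s⟩ := x
  have hm : P % (k + 1) = P := Nat.mod_eq_of_lt (by omega)
  induction v generalizing cnt with
  | zero =>
    have e : (fun j : Fin k => if j.val = P then List.replicate 0 () ++ cnt j else cnt j) =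
        cnt := by
      funext j; simp
    rw [e] at h
    refine (outerPass_silent typs bit N ?_ ?_).mono (T := T + outerTime k typs.length N) (by simp)
    · cases s <;> simp [Outer.next, signSymbol]
    · have e' : (fun j : Fin k => if ((Outer.reading κ P f).next (signSymbol s)).action = .count ∧
          ((Outer.reading κ P f).next (signSymbol s)).pos.val = j.val then () :: cnt j
          else cnt j) = cnt := by
        funext j; cases s <;> simp [Outer.next, signSymbol]
      rw [Outer.next_sign hP, e']
      exact h
  | succ v ih =>
    have e : (fun j : Fin k => if j.val = P then List.replicate (v + 1) () ++ cnt j else cnt j) =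
        fun j : Fin k => if j.val = P then List.replicate v () ++
          (fun j : Fin k => if P = j.val then () :: cnt j else cnt j) j else
          (fun j : Fin k => if P = j.val then () :: cnt j else cnt j) j := by
      funext j
      by_cases hj : j.val = P
      · simp [hj, List.replicate_succ']
      · simp [hj, Ne.symm hj]
    dsimp only at h
    rw [e] at h
    have h1 := ih h
    refine (outerPass_silent typs bit N
      (T := T + (v + 1) * outerTime k typs.length N) ?_ ?_).mono ?_
    · simp [Outer.next]
    · have e1 : ({ (Outer.reading κ P f).next .tick with action := .nothing } : Outer k) =
          Outer.reading κ P f := by rw [Outer.next_tick]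
      have e2 : (fun j : Fin k => if ((Outer.reading κ P f).next .tick).action = .count ∧
          ((Outer.reading κ P f).next .tick).pos.val = j.val then () :: cnt j else cnt j) =
          fun j : Fin k => if P = j.val then () :: cnt j else cnt j := by
        funext j; simp [Outer.next_tick, hm]
      rw [e1, e2]
      exact h1
    · apply le_of_eq; ring

end

end BlockGraph

namespace BlockGraph

open StackProgram StackProgram.Prog

variable {k : ℕ} {τ : Type} (typs : List τ) (bit : Info k → τ → τ → Bool)

section

variable {inp : List FormulaSymbol} {out : List Bool} {o : Outer k}
  {tape : List (FormulaSymbol × Bool)} {cnt : Fin k → List Unit}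
  {s' : State k × ∀ s, List (Alph k s)} {T : ℕ} {n : ℕ} {cs : List (Fin k → ℕ × Bool)}

theorem outerPass_literals (N : ℕ) (D : Fin k → ℕ × Bool) {κ : Kind}
    (h : (outerPass typs bit).Runs (outerCfg inp out (Outer.reading κ k fun j => some (D j).2) tape
      fun j => List.replicate (D j).1 ()) s' T) :
    (outerPass typs bit).Runs (outerCfg ((List.finRange k).flatMap (fun j =>
        List.replicate (D j).1 .tick ++ [signSymbol (D j).2]) ++ inp) out
      (Outer.reading κ 0 fun _ => none) tape fun _ => []) s'
      (T + ((List.finRange k).flatMap (fun j =>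
        List.replicate (D j).1 .tick ++ [signSymbol (D j).2])).length *
        outerTime k typs.length N) := by
  -- The literals are processed from the last one backwards.
  have key : ∀ (d : ℕ) (P : ℕ), P + d = k →
      (outerPass typs bit).Runs (outerCfg (((List.finRange k).drop P).flatMap (fun j =>
          List.replicate (D j).1 .tick ++ [signSymbol (D j).2]) ++ inp) out
        (Outer.reading κ P fun j => if j.val < P then some (D j).2 else none) tape
        fun j => if j.val < P then List.replicate (D j).1 () else []) s'
        (T + (((List.finRange k).drop P).flatMap (fun j =>
          List.replicate (D j).1 .tick ++ [signSymbol (D j).2])).length *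
          outerTime k typs.length N) := by
    intro d
    induction d with
    | zero =>
      intro P hP
      obtain rfl : P = k := by omega
      have : (List.finRange P).drop P = [] := by simp
      rw [this]
      simpa using h
    | succ d ih =>
      intro P hP
      have hlt : P < k := by omega
      have e : (List.finRange k).drop P = ⟨P, hlt⟩ :: (List.finRange k).drop (P + 1) := by
        rw [List.drop_eq_getElem_cons (by simpa using hlt)]
        simp
      rw [e]
      simp only [List.flatMap_cons, List.append_assoc, List.cons_append, List.nil_append]
      have h1 := ih (P + 1) (by omega)
      have hcase : ∀ {β : Type} (u : Fin k → β) (z : β), (fun j : Fin k => if j.val = P then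
          u ⟨P, hlt⟩ else if j.val < P then u j else z) =
          fun j : Fin k => if j.val < P + 1 then u j else z := by
        intro β u z
        funext j
        by_cases hj : j.val = P
        · obtain rfl : j = ⟨P, hlt⟩ := Fin.ext hj
          simp
        · have : j.val < P + 1 ↔ j.val < P := by omega
          simp only [hj, this, if_false]
      have e2 : (fun j : Fin k => if j.val = P then List.replicate (D ⟨P, hlt⟩).1 () ++
          (if j.val < P then List.replicate (D j).1 () else []) else
          if j.val < P then List.replicate (D j).1 () else []) =
          fun j : Fin k => if j.val < P + 1 then List.replicate (D j).1 () else [] := by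
        rw [← hcase]
        funext j
        by_cases hj : j.val = P <;> simp [hj]
      rw [← hcase (fun j => some (D j).2), ← e2] at h1
      refine (outerPass_literal typs bit N hlt _ h1).mono (le_of_eq ?_)
      simp only [List.length_append, List.length_cons, List.length_replicate]
      ring
  have := key k 0 (by omega)
  simpa using this

theorem outerPass_clauses (l : List (Fin k → ℕ × Bool)) (hl : ∀ D ∈ l, ∀ j, (D j).1 < n) (c : ℕ)
    (κ : Kind) :
    ∃ κ', (outerPass typs bit).Runs (outerCfg (l.flatMap clauseWord) out
        (Outer.reading κ 0 fun _ => none) (tapeWord c n cs) fun _ => [])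
      (outerCfg [] (((clauseBlocks c l).flatMap (rowBits typs bit n cs)).reverse ++ out)
        (Outer.reading κ' 0 fun _ => none) (tapeWord (c + l.length) n cs) fun _ => [])
      ((l.flatMap clauseWord).length * outerTime k typs.length (tapeWord 0 n cs).length + 1) := by
  induction l generalizing c κ out with
  | nil =>
    refine ⟨κ, ?_⟩
    simp only [List.flatMap_nil, clauseBlocks, List.reverse_nil, List.nil_append, List.length_nil,
      add_zero, zero_mul, zero_add]
    exact runs_forEach_nil rfl
  | cons D l ih =>
    obtain ⟨κ', h⟩ := ih (out := (rowBits typs bit n cs (clauseBlock c D)).reverse ++ out)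
      (fun E hE => hl E (by simp [hE])) (c + 1) .clause
    refine ⟨κ', ?_⟩
    have e1 : (fun j => some (D j).2) = liveSigns (clauseBlock c D).lits 0 := by
      funext j; simp [liveSigns, clauseBlock]
    have e2 : (fun j => List.replicate (D j).1 ()) = counters (clauseBlock c D).lits 0 := by
      funext j; simp [counters, clauseBlock]
    have hb : ∀ j, ∀ x ∈ (clauseBlock c D).lits j, x.1 < n := by
      intro j x hx
      obtain rfl : D j = x := by simpa [clauseBlock] using hx
      exact hl D (by simp) j
    have h1 := outerPass_literals typs bit (tapeWord 0 n cs).length D (κ := κ)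
      (tape := tapeWord c n cs) (out := out) (inp := .sep :: l.flatMap clauseWord)
      (by
        rw [e1, e2]
        exact outerPass_block typs bit (clauseBlock c D)
          (o := Outer.reading κ k (liveSigns (clauseBlock c D).lits 0))
          (by simp [Outer.next]) (by simp [Outer.next, clauseBlock]) (by simp [Outer.next]) hb h)
    have e3 : c + (D :: l).length = c + 1 + l.length := by simp; omega
    rw [e3]
    simp only [List.flatMap_cons, clauseBlocks, List.reverse_append, List.append_assoc, clauseWord,
      List.cons_append, List.nil_append] at h1 ⊢
    refine h1.mono (le_of_eq ?_)
    simp only [List.length_append, List.length_cons]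
    ring

theorem outerPass_header (l : List (Fin k → ℕ × Bool)) (hl : ∀ D ∈ l, ∀ j, (D j).1 < n)
    (d r : ℕ) (h : r + d = n) :
    ∃ κ', (outerPass typs bit).Runs
      (outerCfg (List.replicate d .tick ++ .sep :: l.flatMap clauseWord) out
        (Outer.init k) (tapeWord r n cs) fun _ => [])
      (outerCfg [] ((((List.range' r d).map (varBlock k) ++
          specialBlock k n :: clauseBlocks (n + 1) l).flatMap
            (rowBits typs bit n cs)).reverse ++ out)
        (Outer.reading κ' 0 fun _ => none) (tapeWord (n + 1 + l.length) n cs) fun _ => [])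
      ((d + 1 + (l.flatMap clauseWord).length) *
        outerTime k typs.length (tapeWord 0 n cs).length + 1) := by
  induction d generalizing r out with
  | zero =>
    obtain rfl : r = n := by omega
    obtain ⟨κ', h1⟩ := outerPass_clauses typs bit
      (out := (rowBits typs bit r cs (specialBlock k r)).reverse ++ out) (cs := cs) l hl (r + 1)
      .special
    refine ⟨κ', ?_⟩
    have h2 := outerPass_block typs bit (specialBlock k r) (o := Outer.init k) (a := .sep)
      (by simp [Outer.next, Outer.init]) (by simp [Outer.next, Outer.init, specialBlock])
      (by simp [Outer.next, Outer.init, specialBlock]; rfl) (by simp [specialBlock]) h1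
    simp only [List.replicate_zero, List.nil_append, List.range'_zero, List.map_nil,
      List.flatMap_cons, List.reverse_append, List.append_assoc]
    refine h2.mono (le_of_eq ?_)
    ring
  | succ d ih =>
    obtain ⟨κ', h1⟩ := ih (r + 1) (by omega)
      (out := (rowBits typs bit n cs (varBlock k r)).reverse ++ out)
    refine ⟨κ', ?_⟩
    have h2 := outerPass_block typs bit (varBlock k r) (o := Outer.init k) (a := .tick)
      (by simp [Outer.next, Outer.init]) (by simp [Outer.next, Outer.init, varBlock])
      (by simp [Outer.next, Outer.init, varBlock]; rfl) (by simp [varBlock]) h1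
    simp only [List.replicate_succ, List.cons_append, List.range'_succ, List.map_cons,
      List.flatMap_cons, List.reverse_append, List.append_assoc] at h2 ⊢
    refine h2.mono (le_of_eq ?_)
    ring

theorem runs_outerPass (l : List (Fin k → ℕ × Bool)) (hl : ∀ D ∈ l, ∀ j, (D j).1 < n) :
    ∃ κ', (outerPass typs bit).Runs
      (outerCfg (formulaWord n l) out (Outer.init k) (tapeWord 0 n l) fun _ => [])
      (outerCfg [] (((blockList n l).flatMap (rowBits typs bit n l)).reverse ++ out)
        (Outer.reading κ' 0 fun _ => none) (tapeWord (n + 1 + l.length) n l) fun _ => [])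
      ((formulaWord n l).length *
        outerTime k typs.length (formulaWord n l).length + 1) := by
  obtain ⟨κ', h⟩ := outerPass_header typs bit (out := out) (cs := l) l hl n 0 (by omega)
  refine ⟨κ', ?_⟩
  have e : (tapeWord 0 n l).length = (formulaWord n l).length := by simp [tapeWord_zero]
  rw [e, ← List.range_eq_range'] at h
  refine h.mono (le_of_eq ?_)
  simp only [formulaWord, List.length_append, List.length_replicate, List.length_cons]
  ring

end

end BlockGraph

/-! ### The whole program -/

namespace BlockGraph

open StackProgram StackProgram.Prog

variable {k : ℕ} {τ : Type} (typs : List τ) (bit : Info k → τ → τ → Bool)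

section

variable {inp rev : List FormulaSymbol} {tape : List (FormulaSymbol × Bool)}

theorem runs_readInput (v : State k) :
    ∃ v', (readInput k).Runs (v, contents inp rev [] [] (fun _ => []) [] [] [])
      (v', contents [] (inp.reverse ++ rev) [] [] (fun _ => []) [] [] []) (inp.length * 2 + 1) := by
  induction inp generalizing rev v with
  | nil => exact ⟨v, runs_forEach_nil rfl⟩
  | cons a l ih =>
    obtain ⟨v', h⟩ := ih (rev := a :: rev) { v with sym := a }
    refine ⟨v', Runs.mono (Runs.forEach_cons (T := 1) rfl (runs_push (Γ := Alph k) .rev _ _) ?_)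
      (show 1 + (l.length * 2 + 1) + 1 ≤ (a :: l).length * 2 + 1 by simp; omega)⟩
    simp only [update_inp, update_rev, List.reverse_cons, List.append_assoc, List.singleton_append]
    exact h

theorem runs_copyInput (v : State k) :
    ∃ v', (copyInput k).Runs (v, contents inp rev tape [] (fun _ => []) [] [] [])
      (v', contents (rev.reverse ++ inp) [] (rev.reverse.map (fun a => (a, false)) ++ tape) []
        (fun _ => []) [] [] []) (rev.length * 3 + 1) := by
  induction rev generalizing inp tape v with
  | nil => exact ⟨v, runs_forEach_nil rfl⟩
  | cons a l ih =>
    obtain ⟨v', h⟩ := ih (inp := a :: inp) (tape := (a, false) :: tape) { v with sym := a }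
    refine ⟨v', Runs.mono (Runs.forEach_cons (T := 2) rfl
      ((runs_push (Γ := Alph k) .inp _ _).seq (runs_push (Γ := Alph k) .tape _ _)) ?_)
      (show 2 + (l.length * 3 + 1) + 1 ≤ (a :: l).length * 3 + 1 by simp; omega)⟩
    simp only [update_inp, update_rev, update_tape, List.reverse_cons, List.append_assoc,
      List.singleton_append, List.map_append, List.map_cons, List.map_nil]
    exact h

/-- The running time of the program on a formula of length `N`. -/
def programTime (k t N : ℕ) : ℕ := N * outerTime k t N + 7 * N + 6

theorem runs_program (n : ℕ) (l : List (Fin k → ℕ × Bool)) (hl : ∀ D ∈ l, ∀ j, (D j).1 < n) :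
    (program typs bit).Runs
      (State.rest (Outer.init k), contents (formulaWord n l) [] [] [] (fun _ => []) [] [] [])
      (State.rest (Outer.init k), contents [] [] [] [] (fun _ => []) [] []
        ((blockList n l).flatMap (rowBits typs bit n l)).reverse)
      (programTime k typs.length (formulaWord n l).length) := by
  obtain ⟨v1, h1⟩ := runs_readInput (inp := formulaWord n l) (rev := []) (State.rest (Outer.init k))
  obtain ⟨v2, h2⟩ := runs_copyInput (inp := []) (rev := (formulaWord n l).reverse) (tape := []) v1
  obtain ⟨κ, h3⟩ := runs_outerPass typs bit (out := []) l hl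
  have h4 := runs_discardTape (k := k) (inp := []) (rev := [])
    (o := Outer.reading κ 0 fun _ => none)
    (tape := tapeWord (n + 1 + l.length) n l) (tape2 := []) (cnt := fun _ => []) (row := [])
    (row2 := []) (out := ((blockList n l).flatMap (rowBits typs bit n l)).reverse)
  simp only [List.append_nil, List.reverse_reverse, ← tapeWord_zero] at h1 h2 h3
  refine (h1.seq (h2.seq ((runs_load _ _).seq (h3.seq (h4.seq (runs_load _ _)))))).mono ?_
  have b := length_tapeWord (n + 1 + l.length) n l
  rw [show (tapeWord 0 n l).length = (formulaWord n l).length by simp [tapeWord_zero]] at b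
  simp only [List.length_reverse, programTime]
  omega

end

section encode

theorem clause_encode_eq {n : ℕ} (C : Clause k n) : C.encode = clauseWord (literalData C) := by
  simp only [Clause.encode, clauseWord, List.ofFn_eq_map, List.flatMap_map]
  rfl

theorem formula_encode_eq (φ : KCNF k) :
    φ.encode = formulaWord φ.numVars (φ.clauses.map literalData) := by
  have : (Clause.encode : Clause k φ.numVars → _) = fun C => clauseWord (literalData C) :=
    funext clause_encode_eq
  simp only [KCNF.encode, formulaWord, List.flatMap_map, this]

/-- The list of all pairs of a block and a type. -/
def pairs (bs : List (Block k)) : List (Block k × τ) := bs.flatMap fun b => typs.map (b, ·)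

/-- The bits of all rows, in the order in which they are pushed. Since the output is read from
the top of its stack, it is the adjacency matrix for the reversed list of vertices. -/
theorem flatMap_rowBits (n : ℕ) (l : List (Fin k → ℕ × Bool)) :
    (blockList n l).flatMap (rowBits typs bit n l) =
      (pairs typs (blockList n l)).flatMap fun u =>
        (pairs typs (blockList n l)).map fun v => bit (u.1.info v.1) u.2 v.2 := by
  simp only [pairs, List.flatMap_assoc, List.flatMap_map, List.map_flatMap, List.map_map]
  rfl

/-- The graph on a list of pairs of a block and a type in which the adjacency of two pairs is that
of a given graph. -/
def listGraph {V : Type*} (G : SimpleGraph V) (l : List V) : FinGraph where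
  order := l.length
  graph := G.comap l.get

open Classical in
theorem encode_listGraph {V : Type*} (G : SimpleGraph V) (l : List V) (adj : V → V → Bool)
    (h : ∀ u v, G.Adj u v ↔ adj u v = true) :
    (listGraph G l).encode = l.flatMap fun u => l.map fun v => adj u v := by
  have : ∀ u v, decide (G.Adj u v) = adj u v := fun u v => by
    rw [Bool.eq_iff_iff, decide_eq_true_iff, h]
  have e : ∀ {β : Type} (g : V → β), List.ofFn (fun i : Fin l.length => g (l.get i)) = l.map g := by
    intro β g
    conv_rhs => rw [← List.ofFn_get l, List.map_ofFn]
    rfl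
  simp only [FinGraph.encode, listGraph, SimpleGraph.comap_adj, this]
  rw [List.flatMap_def, ← e]
  congr 2
  funext i
  rw [← e]

/-- The graph made of the blocks of a formula, on pairs of a block and a type, is computed in
polynomial time if the adjacency of two pairs depends on their types and on the relation between
their blocks only. -/
theorem polyTime_listGraph {b : ℕ} (G : SimpleGraph (Block k × τ))
    (h : ∀ u v, G.Adj u v ↔ bit (u.1.info v.1) u.2 v.2 = true) :
    Nonempty (Turing.TM2ComputableInPolyTime (fun φ : BoundedKCNF k b => φ.1.encode)
      FinGraph.encode fun φ => listGraph G
        (pairs typs (blockList φ.1.numVars (φ.1.clauses.map literalData))).reverse) := by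
  have : Fintype (Alph k .inp) := inferInstanceAs (Fintype FormulaSymbol)
  have hx : ∀ N, ((.X * ((.X + 1) * .C (rowTime k typs.length) + .C (2 * k) + 10) + 7 * .X + 6 :
      Polynomial ℕ)).eval N = programTime k typs.length N := by
    intro N
    simp [programTime, outerTime]
  refine polyTime_of_runs (program typs bit) (State.rest (Outer.init k)) .inp .out _ _ _ rfl rfl
    (.X * ((.X + 1) * .C (rowTime k typs.length) + .C (2 * k) + 10) + 7 * .X + 6) fun φ => ?_
  rw [hx, encode_listGraph G _ (fun u v => bit (u.1.info v.1) u.2 v.2) h, formula_encode_eq]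
  have := runs_program typs bit φ.1.numVars (φ.1.clauses.map literalData) (by
    intro D hD j
    obtain ⟨C, -, rfl⟩ := List.mem_map.mp hD
    exact (C.lit j).var.isLt)
  have e1 : Function.update (fun s : Stk k => ([] : List (Alph k s))) .inp
      (formulaWord φ.1.numVars (φ.1.clauses.map literalData)) = contents (k := k)
      (formulaWord φ.1.numVars (φ.1.clauses.map literalData)) [] [] [] (fun _ => []) [] [] [] := by
    funext s; cases s <;> rfl
  have e2 : ∀ o : List Bool, Function.update (fun s : Stk k => ([] : List (Alph k s))) .out o =
      contents (k := k)
      [] [] [] [] (fun _ => []) [] [] o := by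
    intro o; funext s; cases s <;> rfl
  have e3 : ∀ {A : Type} (l : List A) (hA : A = A), l.map (Equiv.cast hA).symm = l := by
    intro A l hA; exact List.map_id l
  erw [e3, e3, e1, e2]
  rw [flatMap_rowBits, List.reverse_flatMap] at this
  simp only [Function.comp_def, ← List.map_reverse] at this
  exact this

end encode

end BlockGraph

/-! ### The adjacencies between the vertices of two blocks -/

namespace BlockGraph

/-- The types of the vertices of a block. The vertices are divided into three parts. The block of a
variable has `w` copies of each literal in each of the parts, and `w` hubs in the parts `1` and
`2`; the block of a clause has a vertex for each literal and `g` hubs in each part; the special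
block has one vertex in each part. To keep the blocks alike, every block has a vertex of each type,
which is isolated if the type is not meant for the block. -/
inductive Typ (k w g : ℕ)
  | lit (c : Fin w) (s : Bool) (a : Fin 3)
  | varHub (c : Fin w) (b : Fin 2)
  | cl (i : Fin k)
  | clauseHub (c : Fin g) (a : Fin 3)
  | special (a : Fin 3)
  deriving DecidableEq, Fintype

variable {k w g : ℕ}

/-- The part of the vertex for the `i`-th literal of a clause. Literals of the same clause are in
the same part only if neither of them is one of the first two. -/
def clausePart (i : Fin k) : Fin 3 := if i.val = 0 then 1 else if i.val = 1 then 2 else 0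

namespace Typ

/-- The part of a vertex. -/
def part : Typ k w g → Fin 3
  | lit _ _ a => a
  | varHub _ b => b.succ
  | cl i => clausePart i
  | clauseHub _ a => a
  | special a => a

/-- The hubs of the parts. In part `0`, the literals take the role of the hubs of the variables. -/
def isHub : Typ k w g → Bool
  | lit _ _ a => a == 0
  | varHub _ _ => true
  | cl _ => false
  | clauseHub _ _ => true
  | special _ => false

/-- The kind of the blocks for which a type is meant. -/
def kind : Typ k w g → Kind
  | lit _ _ _ => .var
  | varHub _ _ => .var
  | cl _ => .clause
  | clauseHub _ _ => .clause
  | special _ => .special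

end Typ

/-- The relation with the columns and the rows interchanged. -/
def Info.swap (i : Info k) : Info k := ⟨i.colKind, i.rowKind, i.self, i.colInc, i.rowInc⟩

theorem Block.info_swap (b b' : Block k) : (b.info b').swap = b'.info b := by
  simp only [Block.info, Info.swap, Info.mk.injEq, true_and, and_true]
  rw [Bool.eq_iff_iff, beq_iff_eq, beq_iff_eq, eq_comm]

/-- The adjacencies between different parts: different literals on one variable are adjacent, and
so are the vertices for the literals of a clause. The vertex for the `i`-th literal is adjacent to
the literals which are false in the case that this literal is the first true one of the clause. -/
def crossBit (i : Info k) : Typ k w g → Typ k w g → Bool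
  | .lit _ s _, .lit _ s' _ => i.self && s != s'
  | .lit _ s _, .cl l => decide (∃ j, j < l ∧ i.colInc j = some s ∨ j = l ∧ i.colInc j = some !s)
  | .cl _, .cl _ => i.self
  | _, _ => false

/-- The adjacency of two vertices: inside the parts, hubs are adjacent to everything. -/
def bit (i : Info k) (t t' : Typ k w g) : Bool :=
  i.rowKind == t.kind && i.colKind == t'.kind && !(i.self && t == t') &&
    if t.part = t'.part then t.isHub || t'.isHub else crossBit i t t' || crossBit i.swap t' t

theorem bit_swap (i : Info k) (t t' : Typ k w g) : bit i.swap t' t = bit i t t' := by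
  have h : (t' == t) = (t == t') := by rw [Bool.eq_iff_iff, beq_iff_eq, beq_iff_eq, eq_comm]
  simp only [bit, Info.swap, h, eq_comm (a := t'.part), Bool.or_comm t'.isHub,
    Bool.or_comm (crossBit _ t' t)]
  cases i.rowKind == t.kind <;> cases i.colKind == t'.kind <;> rfl

/-- The graph made of all possible blocks. -/
def blockGraph (k w g : ℕ) : SimpleGraph (Block k × Typ k w g) where
  Adj u v := bit (u.1.info v.1) u.2 v.2 = true
  symm := ⟨fun u v h => by
    rw [← Block.info_swap, bit_swap]
    exact h⟩
  loopless := ⟨fun u => by simp [bit, Block.info]⟩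

end BlockGraph

/-! ### The graph of a formula -/

namespace BlockGraph

/-- The vertices of the graph of a formula with `n` variables and `m` clauses, apart from the
isolated ones. -/
inductive Vtx (k w g n m : ℕ)
  | lit (x : Fin n) (c : Fin w) (s : Bool) (a : Fin 3)
  | varHub (x : Fin n) (c : Fin w) (b : Fin 2)
  | cl (C : Fin m) (i : Fin k)
  | clauseHub (C : Fin m) (c : Fin g) (a : Fin 3)
  | special (a : Fin 3)
  deriving DecidableEq, Fintype

namespace Vtx

variable {k w g n m : ℕ}

/-- The type of a vertex. -/
def typ : Vtx k w g n m → Typ k w g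
  | lit _ c s a => .lit c s a
  | varHub _ c b => .varHub c b
  | cl _ i => .cl i
  | clauseHub _ c a => .clauseHub c a
  | special a => .special a

/-- The part of a vertex. -/
abbrev part (v : Vtx k w g n m) : Fin 3 := v.typ.part

/-- The hubs of the parts. -/
abbrev isHub (v : Vtx k w g n m) : Bool := v.typ.isHub

theorem sum_eq (f : Vtx k w g n m → ℕ) :
    ∑ v, f v = ∑ q : Fin n × Fin w × Bool × Fin 3, f (lit q.1 q.2.1 q.2.2.1 q.2.2.2) +
      ∑ q : Fin n × Fin w × Fin 2, f (varHub q.1 q.2.1 q.2.2) +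
      ∑ q : Fin m × Fin k, f (cl q.1 q.2) +
      ∑ q : Fin m × Fin g × Fin 3, f (clauseHub q.1 q.2.1 q.2.2) + ∑ a, f (special a) := by
  let e : Vtx k w g n m ≃ ((((Fin n × Fin w × Bool × Fin 3) ⊕ (Fin n × Fin w × Fin 2)) ⊕
      (Fin m × Fin k)) ⊕ (Fin m × Fin g × Fin 3)) ⊕ Fin 3 :=
    { toFun := fun v => match v with
        | lit x c s a => .inl (.inl (.inl (.inl (x, c, s, a))))
        | varHub x c b => .inl (.inl (.inl (.inr (x, c, b))))
        | cl C i => .inl (.inl (.inr (C, i)))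
        | clauseHub C c a => .inl (.inr (C, c, a))
        | special a => .inr a
      invFun := fun q => match q with
        | .inl (.inl (.inl (.inl q))) => lit q.1 q.2.1 q.2.2.1 q.2.2.2
        | .inl (.inl (.inl (.inr q))) => varHub q.1 q.2.1 q.2.2
        | .inl (.inl (.inr q)) => cl q.1 q.2
        | .inl (.inr q) => clauseHub q.1 q.2.1 q.2.2
        | .inr a => special a
      left_inv := fun v => by cases v <;> rfl
      right_inv := fun q => by rcases q with (((q | q) | q) | q) | q <;> rfl }
  rw [← e.symm.sum_comp f]
  simp only [Fintype.sum_sum_type]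
  rfl

variable (X : Fin m → Fin k → Fin n) (sg : Fin m → Fin k → Bool)

/-- The adjacencies, in one direction, between different parts of the graph of a formula, where
`X C i` is the variable of the `i`-th literal of the clause `C`, and `sg C i` is its sign. -/
def Cross : Vtx k w g n m → Vtx k w g n m → Prop
  | lit x _ s _, lit x' _ s' _ => x = x' ∧ s ≠ s'
  | lit x _ s _, cl C i => ∃ j, X C j = x ∧ (j < i ∧ sg C j = s ∨ j = i ∧ sg C j ≠ s)
  | cl C _, cl C' _ => C = C'
  | _, _ => False

/-- The adjacencies of the graph of a formula. -/
def Adj (u v : Vtx k w g n m) : Prop :=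
  u ≠ v ∧ if u.part = v.part then u.isHub ∨ v.isHub else Cross X sg u v ∨ Cross X sg v u

variable {X sg}

theorem Adj.symm {u v : Vtx k w g n m} (h : Adj X sg u v) : Adj X sg v u := by
  refine ⟨h.1.symm, ?_⟩
  have := h.2
  by_cases e : u.part = v.part
  · rw [if_pos e] at this
    rw [if_pos e.symm]
    exact this.symm
  · rw [if_neg e] at this
    rw [if_neg (Ne.symm e)]
    exact this.symm

theorem adj_of_cross {u v : Vtx k w g n m} (h : Cross X sg u v) (hp : u.part ≠ v.part) :
    Adj X sg u v :=
  ⟨fun e => hp (by rw [e]), by rw [if_neg hp]; exact .inl h⟩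

variable (X sg)

/-- The literals of a clause in the form used by the blocks. -/
def blockLits (C : Fin m) (j : Fin k) : ℕ × Bool := (X C j, sg C j)

/-- The block of a vertex. -/
def block : Vtx k w g n m → Block k
  | lit x _ _ _ => varBlock k x
  | varHub x _ _ => varBlock k x
  | cl C _ => clauseBlock (n + 1 + C) (blockLits X sg C)
  | clauseHub C _ _ => clauseBlock (n + 1 + C) (blockLits X sg C)
  | special _ => specialBlock k n

theorem kind_block (v : Vtx k w g n m) : (v.block X sg).kind = v.typ.kind := by
  cases v <;> rfl

theorem eq_iff (u v : Vtx k w g n m) :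
    u = v ↔ (u.block X sg).idx = (v.block X sg).idx ∧ u.typ = v.typ := by
  constructor
  · rintro rfl
    simp
  · rintro ⟨h1, h2⟩
    cases u <;> cases v <;> simp [typ] at h2 <;>
      simp [block, varBlock, clauseBlock, Fin.val_inj] at h1 <;> simp [h1, h2]

theorem crossBit_iff (u v : Vtx k w g n m) :
    crossBit ((u.block X sg).info (v.block X sg)) u.typ v.typ = true ↔ Cross X sg u v := by
  cases u <;> cases v <;>
    simp [crossBit, Cross, typ, block, Block.info, varBlock, clauseBlock, incidence,
      blockLits, Fin.val_inj]
  rename_i x c s a C i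
  refine exists_congr fun j => ?_
  cases s <;> by_cases h : sg C j <;> simp [h] <;> tauto

theorem blockGraph_adj (u v : Vtx k w g n m) :
    (blockGraph k w g).Adj (u.block X sg, u.typ) (v.block X sg, v.typ) ↔ Adj X sg u v := by
  have h := eq_iff X sg u v
  simp only [blockGraph, bit, Block.info_swap, Adj, Ne]
  have e1 : ((u.block X sg).info (v.block X sg)).rowKind = u.typ.kind := kind_block X sg u
  have e2 : ((u.block X sg).info (v.block X sg)).colKind = v.typ.kind := kind_block X sg v
  have e3 : (((u.block X sg).info (v.block X sg)).self && u.typ == v.typ) = true ↔ u = v := by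
    rw [h]
    simp [Block.info]
  rw [e1, e2, ← e3, ← crossBit_iff, ← crossBit_iff]
  simp only [BEq.rfl, Bool.true_and, Bool.and_eq_true, Bool.not_eq_true']
  split_ifs <;> simp

theorem block_typ_injective :
    Function.Injective fun v : Vtx k w g n m => (v.block X sg, v.typ) := by
  intro u v h
  simp only [Prod.mk.injEq] at h
  rw [eq_iff X sg, h.1, h.2]
  simp

end Vtx

section vertices

variable {k w g : ℕ} (φ : KCNF k)

/-- The variable of the `i`-th literal of the clause at position `C`. -/
def litVar (C : Fin φ.clauses.length) (i : Fin k) : Fin φ.numVars := ((φ.clauses.get C).lit i).var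

/-- The sign of the `i`-th literal of the clause at position `C`. -/
def litSign (C : Fin φ.clauses.length) (i : Fin k) : Bool := ((φ.clauses.get C).lit i).positive

/-- The blocks of a formula. -/
abbrev blocks : List (Block k) := blockList φ.numVars (φ.clauses.map literalData)

theorem clauseBlocks_eq (c : ℕ) (l : List (Fin k → ℕ × Bool)) :
    clauseBlocks c l = List.ofFn fun i : Fin l.length => clauseBlock (c + i) (l.get i) := by
  induction l generalizing c with
  | nil => rfl
  | cons D l ih =>
    rw [clauseBlocks, ih, List.ofFn_succ]
    simp only [Fin.val_zero, add_zero, List.get_cons_zero, Fin.val_succ]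
    congr 2
    funext i
    rw [show c + (i.val + 1) = c + 1 + i.val by omega]
    rfl

theorem mem_blocks {b : Block k} : b ∈ blocks φ ↔ (∃ x : Fin φ.numVars, b = varBlock k x) ∨
    b = specialBlock k φ.numVars ∨ ∃ C : Fin φ.clauses.length,
      b = clauseBlock (φ.numVars + 1 + C) (Vtx.blockLits (litVar φ) (litSign φ) C) := by
  simp only [blocks, blockList, List.mem_append, List.mem_map, List.mem_range, List.mem_cons,
    clauseBlocks_eq, List.mem_ofFn]
  refine or_congr ?_ (or_congr Iff.rfl ?_)
  · exact ⟨fun ⟨a, h, e⟩ => ⟨⟨a, h⟩, e.symm⟩, fun ⟨x, e⟩ => ⟨x, x.isLt, e.symm⟩⟩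
  · constructor
    · rintro ⟨i, rfl⟩
      refine ⟨⟨i, by simpa using i.isLt⟩, ?_⟩
      simp
      rfl
    · rintro ⟨C, rfl⟩
      refine ⟨⟨C, by simp⟩, ?_⟩
      simp
      rfl

theorem nodup_blocks : (blocks φ).Nodup := by
  apply List.Nodup.of_map Block.idx
  have h : ∀ (c : ℕ) (l : List (Fin k → ℕ × Bool)),
      (clauseBlocks c l).map Block.idx = List.range' c l.length := by
    intro c l
    induction l generalizing c with
    | nil => rfl
    | cons D l ih => simp [clauseBlocks, ih, List.range'_succ, clauseBlock]
  have e : (blocks φ).map Block.idx = List.range (φ.numVars + (1 + φ.clauses.length)) := by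
    simp only [blocks, blockList, List.map_append, List.map_cons, h, List.map_map]
    rw [List.range_add, List.length_map]
    congr 1
    · exact List.map_id _
    · rw [add_comm 1, List.range_succ_eq_map]
      simp only [specialBlock, List.range'_eq_map_range, List.map_cons, List.map_map,
        add_zero, List.cons.injEq, true_and, Function.comp_def, Nat.succ_eq_add_one]
      refine List.map_congr_left fun a _ => by omega
  rw [e]
  exact List.nodup_range

/-- The list of the vertices of the graph of a formula, including isolated ones. -/
noncomputable def vertexList (w g : ℕ) : List (Block k × Typ k w g) :=
  (pairs (Finset.univ : Finset (Typ k w g)).toList (blocks φ)).reverse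

/-- The graph of a formula. -/
noncomputable def formulaGraph (w g : ℕ) : FinGraph :=
  listGraph (blockGraph k w g) (vertexList φ w g)

theorem mem_vertexList {b : Block k} {t : Typ k w g} :
    (b, t) ∈ vertexList φ w g ↔ b ∈ blocks φ := by
  simp [vertexList, pairs]

theorem nodup_vertexList : (vertexList φ w g).Nodup := by
  rw [vertexList, List.nodup_reverse, pairs]
  have : (blocks φ).flatMap (fun b => (Finset.univ : Finset (Typ k w g)).toList.map (b, ·)) =
      blocks φ ×ˢ (Finset.univ : Finset (Typ k w g)).toList := rfl
  rw [this]
  exact (nodup_blocks φ).product (Finset.nodup_toList _)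

theorem length_vertexList : (vertexList φ w g).length =
    (φ.numVars + 1 + φ.clauses.length) * Fintype.card (Typ k w g) := by
  simp [vertexList, pairs, List.length_flatMap, length_blockList, Finset.card_univ]

theorem exists_vtx {b : Block k} {t : Typ k w g} (hb : b ∈ blocks φ) (h : b.kind = t.kind) :
    ∃ v : Vtx k w g φ.numVars φ.clauses.length,
      v.block (litVar φ) (litSign φ) = b ∧ v.typ = t := by
  rcases (mem_blocks φ).mp hb with ⟨x, rfl⟩ | rfl | ⟨C, rfl⟩ <;> cases t <;>
    simp [Typ.kind, varBlock, specialBlock, clauseBlock] at h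
  · exact ⟨.lit x _ _ _, rfl, rfl⟩
  · exact ⟨.varHub x _ _, rfl, rfl⟩
  · exact ⟨.special _, rfl, rfl⟩
  · exact ⟨.cl C _, rfl, rfl⟩
  · exact ⟨.clauseHub C _ _, rfl, rfl⟩

/-- The graph of a formula consists of the vertices of `Vtx` and of isolated vertices. -/
theorem exists_embedding :
    ∃ e : Vtx k w g φ.numVars φ.clauses.length → Fin (formulaGraph φ w g).order,
    Function.Injective e ∧
    (∀ u v, (formulaGraph φ w g).graph.Adj (e u) (e v) ↔
      Vtx.Adj (litVar φ) (litSign φ) u v) ∧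
    ∀ i j, (formulaGraph φ w g).graph.Adj i j → ∃ u, e u = i := by
  have h : ∀ v : Vtx k w g φ.numVars φ.clauses.length, ∃ i : Fin (vertexList φ w g).length,
      (vertexList φ w g).get i = (v.block (litVar φ) (litSign φ), v.typ) := by
    intro v
    rw [← List.mem_iff_get, mem_vertexList, mem_blocks]
    cases v with
    | lit x | varHub x => exact .inl ⟨x, rfl⟩
    | cl C | clauseHub C => exact .inr (.inr ⟨C, rfl⟩)
    | special a => exact .inr (.inl rfl)
  choose e he using h
  refine ⟨e, fun u v huv => ?_, fun u v => ?_, fun i j hij => ?_⟩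
  · apply Vtx.block_typ_injective (litVar φ) (litSign φ)
    dsimp only
    rw [← he, ← he, huv]
  · change (blockGraph k w g).Adj ((vertexList φ w g).get (e u)) ((vertexList φ w g).get (e v)) ↔ _
    rw [he, he, Vtx.blockGraph_adj]
  · obtain ⟨u, h1, h2⟩ := exists_vtx (t := ((vertexList φ w g).get i).2) φ
      ((mem_vertexList φ).mp (List.get_mem (vertexList φ w g) i)) (by
        have : bit _ _ _ = true := hij
        simp only [bit, Bool.and_eq_true, beq_iff_eq] at this
        exact this.1.1.1)
    refine ⟨u, List.nodup_iff_injective_get.mp (nodup_vertexList φ) ?_⟩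
    rw [he, h1, h2]

end vertices

end BlockGraph

/-! ### Treedepth and tree orders -/

/-- A tree order: a partial order in which the elements below any element form a chain. -/
structure IsTreeOrder {V : Type*} (A : V → V → Prop) : Prop where
  refl : ∀ v, A v v
  trans : ∀ {u v w}, A u v → A v w → A u w
  antisymm : ∀ {u v}, A u v → A v u → u = v
  chain : ∀ {u v w}, A u w → A v w → A u v ∨ A v u

namespace RootedForest

variable {V : Type*}

theorem isTreeOrder (F : RootedForest V) : IsTreeOrder F.IsAncestor where
  refl _ := .refl
  trans := .trans
  antisymm {u v} h h' := by
    by_contra hne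
    rw [IsAncestor, Relation.reflTransGen_iff_eq_or_transGen] at h h'
    have h1 := h.resolve_left (Ne.symm hne)
    have h2 := h'.resolve_left hne
    exact F.wf.transGen.irrefl.irrefl u (h1.trans h2)
  chain {u v w} h h' := by
    induction h generalizing v with
    | refl => exact .inr h'
    | tail h1 h2 ih =>
      rcases Relation.ReflTransGen.cases_tail h' with rfl | ⟨c, h3, h4⟩
      · exact .inl (h1.tail h2)
      · rw [h2, Option.some.injEq] at h4
        subst h4
        exact ih h3

open Classical in
/-- Every tree order on a finite set is the ancestor relation of a rooted forest: the parent of an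
element is the largest element strictly below it. -/
theorem exists_of_isTreeOrder [Fintype V] {A : V → V → Prop} (hA : IsTreeOrder A) :
    ∃ F : RootedForest V, F.IsAncestor = A := by
  let P : V → V → Prop := fun v u => A u v ∧ u ≠ v ∧ ∀ u', A u' v → u' ≠ v → A u' u
  let c : V → ℕ := fun v => (Finset.univ.filter fun u => A u v).card
  have hc : ∀ {u v}, A u v → u ≠ v → c u < c v := by
    intro u v h hne
    refine Finset.card_lt_card ⟨fun x hx => ?_, fun hs => ?_⟩
    · simp only [Finset.mem_filter, Finset.mem_univ, true_and] at hx ⊢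
      exact hA.trans hx h
    · have : v ∈ Finset.univ.filter fun x => A x u := hs (by simp [hA.refl])
      simp only [Finset.mem_filter, Finset.mem_univ, true_and] at this
      exact hne (hA.antisymm h this)
  have hex : ∀ {u v}, A u v → u ≠ v → ∃ p, P v p := by
    intro u v h hne
    obtain ⟨p, hp, hmax⟩ := Finset.exists_max_image (Finset.univ.filter fun x => A x v ∧ x ≠ v) c
      ⟨u, by simp [h, hne]⟩
    simp only [Finset.mem_filter, Finset.mem_univ, true_and] at hp hmax
    refine ⟨p, hp.1, hp.2, fun u' h1 h2 => ?_⟩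
    rcases hA.chain h1 hp.1 with h3 | h3
    · exact h3
    · by_contra h4
      have : p ≠ u' := by rintro rfl; exact h4 (hA.refl _)
      exact absurd (hmax u' ⟨h1, h2⟩) (not_le.mpr (hc h3 this))
  have hu : ∀ {v p p'}, P v p → P v p' → p = p' := fun h h' =>
    hA.antisymm (h'.2.2 _ h.1 h.2.1) (h.2.2 _ h'.1 h'.2.1)
  let par : V → Option V := fun v => if h : ∃ p, P v p then some h.choose else none
  have hpar : ∀ {v p}, par v = some p ↔ P v p := by
    intro v p
    by_cases h : ∃ p, P v p
    · simp only [par, h, dif_pos, Option.some.injEq]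
      exact ⟨fun e => e ▸ h.choose_spec, fun hp => hu h.choose_spec hp⟩
    · simp only [par, h, dif_neg, not_false_eq_true, reduceCtorEq, false_iff]
      exact fun hp => h ⟨p, hp⟩
  refine ⟨⟨par, Subrelation.wf (r := InvImage (· < ·) c) (fun {u v} h => ?_)
    (InvImage.wf c Nat.lt_wfRel.wf)⟩, ?_⟩
  · have := hpar.mp h
    exact hc this.1 this.2.1
  · funext u v
    refine propext ⟨fun h => ?_, fun h => ?_⟩
    · induction h with
      | refl => exact hA.refl _
      | tail _ h2 ih => exact hA.trans ih (hpar.mp h2).1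
    · induction hn : c v using Nat.strong_induction_on generalizing v with
      | _ N ih =>
        by_cases hne : u = v
        · subst hne
          exact .refl
        · obtain ⟨p, hp⟩ := hex h hne
          exact (ih (c p) (hn ▸ hc hp.1 hp.2.1) p (hp.2.2 u h hne) rfl).tail (hpar.mpr hp)

end RootedForest

namespace SimpleGraph

variable {V : Type*} [Fintype V] (G : SimpleGraph V)

theorem treedepth_le {A : V → V → Prop} (hA : IsTreeOrder A) (hG : ∀ u v, G.Adj u v → A u v ∨ A v u)
    {d : ℕ} (hd : ∀ v (s : Finset V), (∀ u ∈ s, A u v) → s.card ≤ d) : G.treedepth ≤ d := by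
  classical
  obtain ⟨F, rfl⟩ := RootedForest.exists_of_isTreeOrder hA
  have hF : F.depth ∈ {d | ∃ F : RootedForest V, F.IsEliminationForest G ∧ F.depth = d} :=
    ⟨F, hG, rfl⟩
  exact (Nat.sInf_le hF).trans
    (Finset.sup_le fun v _ => hd v _ fun u hu => (Finset.mem_filter.mp hu).2)

theorem exists_isTreeOrder : ∃ A : V → V → Prop, IsTreeOrder A ∧
    (∀ u v, G.Adj u v → A u v ∨ A v u) ∧
    ∀ v (s : Finset V), (∀ u ∈ s, A u v) → s.card ≤ G.treedepth := by
  classical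
  have hne : {d | ∃ F : RootedForest V, F.IsEliminationForest G ∧ F.depth = d}.Nonempty := by
    -- Any linear order is a tree order for which all vertices are comparable.
    let e := Fintype.equivFin V
    have h : IsTreeOrder fun u v => e u ≤ e v :=
      ⟨fun _ => le_rfl, le_trans, fun h h' => e.injective (le_antisymm h h'),
        fun _ _ => le_total _ _⟩
    obtain ⟨F, hF⟩ := RootedForest.exists_of_isTreeOrder h
    refine ⟨F.depth, F, fun u v _ => ?_, rfl⟩
    rw [hF]
    exact le_total _ _
  obtain ⟨F, hF, hd⟩ := Nat.sInf_mem hne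
  refine ⟨F.IsAncestor, F.isTreeOrder, hF, fun v s hs => ?_⟩
  rw [treedepth, ← hd]
  refine le_trans (Finset.card_le_card (t := Finset.univ.filter fun u => F.IsAncestor u v)
    fun u hu => by simpa using hs u hu) ?_
  exact Finset.le_sup (f := fun v => (Finset.univ.filter fun u => F.IsAncestor u v).card)
    (Finset.mem_univ v)

end SimpleGraph

/-! ### The upper bound -/

namespace BlockGraph

open Finset

variable {k w g : ℕ} (φ : KCNF k)

/-- The vertices of the graph of a formula that are not isolated. -/
abbrev FVtx (w g : ℕ) : Type := Vtx k w g φ.numVars φ.clauses.length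

section counting

theorem countP_eq_sum {α : Type*} (l : List α) (q : α → Prop) [DecidablePred q] :
    l.countP (fun x => q x) = ∑ i : Fin l.length, if q (l.get i) then 1 else 0 := by
  induction l with
  | nil => rfl
  | cons y l ih =>
    rw [List.countP_cons, ih]
    change _ = ∑ i : Fin (l.length + 1), _
    rw [Fin.sum_univ_succ, add_comm]
    by_cases h : q y <;> simp [h]

theorem countP_flatMap_eq_sum {α β : Type*} (l : List α) (f : α → List β) (q : β → Prop)
    [DecidablePred q] : (l.flatMap f).countP (fun x => q x) =
      ∑ i : Fin l.length, (f (l.get i)).countP fun x => q x := by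
  induction l with
  | nil => rfl
  | cons y l ih =>
    rw [List.flatMap_cons, List.countP_append, ih]
    change _ = ∑ i : Fin (l.length + 1), _
    rw [Fin.sum_univ_succ]
    rfl

theorem countP_ofFn {β : Type*} {n : ℕ} (f : Fin n → β) (q : β → Prop) [DecidablePred q] :
    (List.ofFn f).countP (fun x => q x) = ∑ i, if q (f i) then 1 else 0 := by
  induction n with
  | zero => rfl
  | succ n ih =>
    rw [List.ofFn_succ, List.countP_cons, ih, Fin.sum_univ_succ, add_comm]
    by_cases h : q (f 0) <;> simp [h]

theorem numSatisfied_eq (a : Fin φ.numVars → Bool) : φ.numSatisfied a =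
    ∑ C, if ∃ i, a (litVar φ C i) = litSign φ C i then 1 else 0 :=
  countP_eq_sum φ.clauses fun C => C.Satisfied a

theorem occurrences_eq (x : Fin φ.numVars) :
    φ.occurrences x = ∑ C, ∑ i, if litVar φ C i = x then 1 else 0 := by
  rw [KCNF.occurrences, countP_flatMap_eq_sum]
  exact Finset.sum_congr rfl fun C _ => countP_ofFn _ _

end counting

section

variable {φ} (a : Fin φ.numVars → Bool)

/-- The vertices that form the trunk of the forest given by a valuation: the false literals, and the
vertices of the clauses except, in each satisfied clause, the one of the first true literal. -/
def trunk : FVtx φ w g → Prop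
  | .lit x _ s _ => s ≠ a x
  | .cl C i => ¬(a (litVar φ C i) = litSign φ C i ∧ ∀ j < i, a (litVar φ C j) ≠ litSign φ C j)
  | _ => False

instance : DecidablePred (trunk (w := w) (g := g) a) := fun v => by
  cases v <;> unfold trunk <;> infer_instance

/-- The hubs of the part `b` outside of the trunk. They form one of three branches. -/
def branch (b : Fin 3) (v : FVtx φ w g) : Prop :=
  ¬ trunk a v ∧ v.isHub = true ∧ v.part = b

/-- The level of a vertex: `0` in the trunk, `1` in the branches, and `2` for leaves. -/
noncomputable def level (v : FVtx φ w g) : ℕ := if trunk a v then 0 else if v.isHub then 1 else 2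

theorem level_eq_zero {v : FVtx φ w g} : level a v = 0 ↔ trunk a v := by
  unfold level; split_ifs <;> simp_all

theorem level_eq_one {v : FVtx φ w g} : level a v = 1 ↔ ¬ trunk a v ∧ v.isHub = true := by
  unfold level; split_ifs <;> simp_all

/-- The lexicographic order by the level and by an enumeration of the vertices. -/
def lexLT (u v : FVtx φ w g) : Prop :=
  level a u < level a v ∨ level a u = level a v ∧ Fintype.equivFin _ u < Fintype.equivFin _ v

theorem lexLT_trans {u v x : FVtx φ w g} (h : lexLT a u v) (h' : lexLT a v x) : lexLT a u x := by
  unfold lexLT at *; omega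

theorem lexLT_total {u v : FVtx φ w g} (h : u ≠ v) : lexLT a u v ∨ lexLT a v u := by
  have : Fintype.equivFin _ u ≠ Fintype.equivFin _ v :=
    fun e => h ((Fintype.equivFin _).injective e)
  unfold lexLT; omega

/-- The strict order of the forest: the trunk is below everything, and each branch is below the rest
of its part. -/
def below (u v : FVtx φ w g) : Prop :=
  lexLT a u v ∧ (level a u = 0 ∨ level a u = 1 ∧ u.part = v.part)

theorem isTreeOrder_below : IsTreeOrder fun u v : FVtx φ w g => u = v ∨ below a u v where
  refl _ := .inl rfl
  trans {u v x} h h' := by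
    rcases h with rfl | h
    · exact h'
    rcases h' with rfl | h'
    · exact .inr h
    refine .inr ⟨lexLT_trans a h.1 h'.1, ?_⟩
    rcases h.2 with h0 | ⟨h1, e⟩
    · exact .inl h0
    · rcases h'.2 with h0 | ⟨_, e'⟩
      · have := h.1
        unfold lexLT at this
        omega
      · exact .inr ⟨h1, e.trans e'⟩
  antisymm {u v} h h' := by
    rcases h with h | h
    · exact h
    rcases h' with h' | h'
    · exact h'.symm
    have h1 := h.1
    have h2 := h'.1
    unfold lexLT at h1 h2
    omega
  chain {u v x} h h' := by
    rcases h with rfl | h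
    · rcases h' with rfl | h'
      · exact .inl (.inl rfl)
      · exact .inr (.inr h')
    rcases h' with rfl | h'
    · exact .inl (.inr h)
    by_cases e : u = v
    · exact .inl (.inl e)
    have key : ∀ {u v : FVtx φ w g}, below a u x → below a v x → lexLT a u v → below a u v := by
      intro u v h h' hl
      refine ⟨hl, ?_⟩
      rcases h.2 with h0 | ⟨h1, e⟩
      · exact .inl h0
      · rcases h'.2 with h0 | ⟨_, e'⟩
        · unfold lexLT at hl
          omega
        · exact .inr ⟨h1, e.trans e'.symm⟩
    rcases lexLT_total a e with hl | hl
    · exact .inl (.inr (key h h' hl))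
    · exact .inr (.inr (key h' h hl))

/-- Outside of the trunk there are no edges between different parts. -/
theorem trunk_of_cross {u v : FVtx φ w g} (h : Vtx.Cross (litVar φ) (litSign φ) u v)
    (hp : u.part ≠ v.part) : trunk a u ∨ trunk a v := by
  by_contra hc
  rw [not_or] at hc
  obtain ⟨h1, h2⟩ := hc
  cases u with
  | lit x c s b =>
    have e1 : s = a x := by simpa [trunk] using h1
    cases v with
    | lit x' c' s' b' =>
      have e2 : s' = a x' := by simpa [trunk] using h2
      obtain ⟨rfl, hne⟩ := h
      exact hne (e1.trans e2.symm)
    | cl C i =>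
      simp only [trunk, not_not] at h2
      obtain ⟨j, rfl, ⟨hj, e⟩ | ⟨rfl, e⟩⟩ := h
      · exact h2.2 j hj (by rw [e, e1])
      · exact e (by rw [← h2.1, e1])
    | _ => exact h
  | cl C i =>
    cases v with
    | cl C' i' =>
      obtain rfl : C = C' := h
      simp only [trunk, not_not] at h1 h2
      rcases lt_trichotomy i i' with hi | rfl | hi
      · exact h2.2 i hi h1.1
      · exact hp rfl
      · exact h1.2 i' hi h2.1
    | _ => exact h
  | _ => exact h

theorem below_of_adj {u v : FVtx φ w g} (h : Vtx.Adj (litVar φ) (litSign φ) u v) :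
    below a u v ∨ below a v u := by
  have key : ∀ {u v : FVtx φ w g}, Vtx.Adj (litVar φ) (litSign φ) u v → lexLT a u v →
      below a u v := by
    intro u v h hl
    refine ⟨hl, ?_⟩
    by_cases hp : u.part = v.part
    · have h1 := h.2
      rw [if_pos hp] at h1
      by_cases h0 : level a u = 0
      · exact .inl h0
      · right
        refine ⟨?_, hp⟩
        rw [level_eq_zero] at h0
        rcases h1 with h1 | h1
        · exact (level_eq_one a).mpr ⟨h0, h1⟩
        · by_cases h2 : trunk a v
          · have := (level_eq_zero a).mpr h2
            rw [← level_eq_zero] at h0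
            unfold lexLT at hl
            omega
          · have := (level_eq_one a).mpr ⟨h2, h1⟩
            rw [← level_eq_zero] at h0
            unfold lexLT at hl
            omega
    · have h1 := h.2
      rw [if_neg hp] at h1
      have h2 : trunk a u ∨ trunk a v := by
        rcases h1 with h1 | h1
        · exact trunk_of_cross a h1 hp
        · exact (trunk_of_cross a h1 (Ne.symm hp)).symm
      left
      rcases h2 with h2 | h2
      · exact (level_eq_zero a).mpr h2
      · have := (level_eq_zero a).mpr h2
        unfold lexLT at hl
        omega
  rcases lexLT_total a h.1 with hl | hl
  · exact .inl (key h hl)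
  · exact .inr (key h.symm hl)

open Classical in
theorem card_below_le (v : FVtx φ w g) :
    (univ.filter fun u => u = v ∨ below a u v).card + φ.numSatisfied a ≤
      4 * w * φ.numVars + (k + g) * φ.numClauses + 1 := by
  -- All vertices below `v` are in the trunk or in the branch in the part of `v`.
  obtain ⟨b, hvb⟩ : ∃ b, v.part = b := ⟨_, rfl⟩
  let f : FVtx φ w g → ℕ := fun u =>
    (if trunk a u then 1 else 0) + if branch a b u then 1 else 0
  have h1 : (univ.filter fun u => u = v ∨ below a u v).card ≤ ∑ u, f u + 1 := by
    calc _ = ∑ u, if u = v ∨ below a u v then 1 else 0 := card_filter _ _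
      _ ≤ ∑ u, (f u + if u = v then 1 else 0) := by
        refine sum_le_sum fun u _ => ?_
        by_cases e : u = v
        · simp [e]
        · by_cases hb : below a u v
          · have : trunk a u ∨ branch a b u := by
              rcases hb.2 with h | ⟨h, hp⟩
              · exact .inl ((level_eq_zero a).mp h)
              · have := (level_eq_one a).mp h
                exact .inr ⟨this.1, this.2, hp.trans hvb⟩
            rcases this with h | h <;> simp [f, e, h, hb]
          · simp [e, hb]
      _ = _ := by simp [sum_add_distrib]
  have hv : ∀ x c, ∑ s, ∑ b, f (.lit x c s b) + ∑ b, f (.varHub x c b) = 4 := by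
    intro x c
    simp only [Fintype.sum_bool, Fin.sum_univ_three, Fin.sum_univ_two]
    cases hx : a x <;> fin_cases b <;>
      simp [f, trunk, branch, hx, Typ.isHub, Typ.part, Vtx.typ, Vtx.part, Vtx.isHub]
  have hc : ∀ C, ∑ i, f (.cl C i) +
      (if ∃ i, a (litVar φ C i) = litSign φ C i then 1 else 0) ≤ k := by
    intro C
    have e : ∀ i, f (.cl C i) + (if a (litVar φ C i) = litSign φ C i ∧
        ∀ j < i, a (litVar φ C j) ≠ litSign φ C j then 1 else 0) = 1 := by
      intro i
      have : ¬ branch a b (.cl C i : FVtx φ w g) := fun h => by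
        simpa [Typ.isHub, Vtx.typ, Vtx.isHub] using h.2.1
      simp only [f, trunk, this]
      split_ifs <;> simp_all
    have e1 : ∑ i, (f (.cl C i) + (if a (litVar φ C i) = litSign φ C i ∧
        ∀ j < i, a (litVar φ C j) ≠ litSign φ C j then 1 else 0)) = k := by
      simp [e]
    rw [sum_add_distrib] at e1
    refine le_trans (Nat.add_le_add_left ?_ _) e1.le
    split_ifs with hs
    · obtain ⟨i, hi, hmin⟩ := exists_min_image
        (univ.filter fun i => a (litVar φ C i) = litSign φ C i) id
        (by obtain ⟨i, hi⟩ := hs; exact ⟨i, by simpa using hi⟩)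
      simp only [mem_filter, mem_univ, true_and, id] at hi hmin
      refine le_trans ?_ (single_le_sum (fun _ _ => Nat.zero_le _) (mem_univ i))
      rw [if_pos ⟨hi, fun j hj hj' => absurd (hmin j hj') (not_le.mpr hj)⟩]
    · exact Nat.zero_le _
  have hg : ∀ C c, ∑ b, f (.clauseHub C c b) = 1 := by
    intro C c
    simp [f, trunk, branch, Typ.isHub, Typ.part, Vtx.typ, Vtx.part, Vtx.isHub]
  have hs : ∀ b, f (.special b) = 0 := by
    intro b
    simp [f, trunk, branch, Typ.isHub, Vtx.typ, Vtx.part, Vtx.isHub]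
  have h2 : ∑ u, f u + φ.numSatisfied a ≤ 4 * w * φ.numVars + (k + g) * φ.numClauses := by
    rw [Vtx.sum_eq, numSatisfied_eq]
    simp only [Fintype.sum_prod_type, hg, hs]
    have e1 := sum_congr rfl fun x (_ : x ∈ univ) => sum_congr rfl fun c (_ : c ∈ univ) => hv x c
    have e2 := sum_le_sum fun C (_ : C ∈ univ) => hc C
    simp only [sum_add_distrib] at e1 e2
    simp only [sum_const, card_univ, Fintype.card_fin, smul_eq_mul, mul_one, mul_zero,
      KCNF.numClauses] at e1 e2 ⊢
    linarith
  omega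

/-- Every valuation gives an upper bound for the treedepth. -/
theorem treedepth_add_numSatisfied_le :
    (formulaGraph φ w g).graph.treedepth + φ.numSatisfied a ≤
      4 * w * φ.numVars + (k + g) * φ.numClauses + 1 := by
  classical
  obtain ⟨e, he, hadj, hiso⟩ := exists_embedding (w := w) (g := g) φ
  have hsat : φ.numSatisfied a + 1 ≤ 4 * w * φ.numVars + (k + g) * φ.numClauses + 1 := by
    have := card_below_le (w := w) (g := g) a (.special 0)
    have h1 : 0 < (univ.filter fun u : FVtx φ w g => u = .special 0 ∨
      below a u (.special 0)).card := card_pos.mpr ⟨.special 0, by simp⟩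
    omega
  let A : Fin (formulaGraph φ w g).order → Fin (formulaGraph φ w g).order → Prop := fun i j =>
    i = j ∨ ∃ u v, e u = i ∧ e v = j ∧ (u = v ∨ below a u v)
  have hT := isTreeOrder_below (w := w) (g := g) a
  have hA : ∀ u v, A (e u) (e v) ↔ u = v ∨ below a u v := by
    intro u v
    constructor
    · rintro (h | ⟨u', v', h1, h2, h⟩)
      · exact .inl (he h)
      · rwa [← he h1, ← he h2]
    · exact fun h => .inr ⟨u, v, rfl, rfl, h⟩
  have hTA : IsTreeOrder A := by
    refine ⟨fun _ => .inl rfl, ?_, ?_, ?_⟩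
    · rintro i j l (rfl | ⟨u, v, rfl, rfl, h⟩) h'
      · exact h'
      · rcases h' with rfl | ⟨u', v', h1, rfl, h'⟩
        · exact (hA _ _).mpr h
        · rw [he h1] at h'
          exact (hA _ _).mpr (hT.trans h h')
    · rintro i j (rfl | ⟨u, v, rfl, rfl, h⟩) h'
      · rfl
      · rw [hT.antisymm h ((hA _ _).mp h')]
    · rintro i j l (rfl | ⟨u, v, rfl, rfl, h⟩) h'
      · exact .inr h'
      · rcases h' with rfl | ⟨u', v', rfl, h1, h'⟩
        · exact .inl ((hA _ _).mpr h)
        · rw [he h1] at h'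
          rw [hA, hA]
          exact hT.chain h h'
  have hd : (formulaGraph φ w g).graph.treedepth ≤
      4 * w * φ.numVars + (k + g) * φ.numClauses + 1 - φ.numSatisfied a := by
    refine SimpleGraph.treedepth_le _ hTA (fun i j hij => ?_) fun j => ?_
    · obtain ⟨u, rfl⟩ := hiso i j hij
      obtain ⟨v, rfl⟩ := hiso j _ hij.symm
      rw [hA, hA]
      rcases below_of_adj a ((hadj u v).mp hij) with h | h
      · exact .inl (.inr h)
      · exact .inr (.inr h)
    · intro s hs
      by_cases hj : ∃ v, e v = j
      · obtain ⟨v, rfl⟩ := hj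
        have := card_below_le (w := w) (g := g) a v
        have hle : s.card ≤
            (univ.filter fun u : FVtx φ w g => u = v ∨ below a u v).card := by
          rw [← card_map ⟨e, he⟩]
          refine card_le_card fun i hi => ?_
          simp only [mem_filter, mem_univ, true_and, mem_map, Function.Embedding.coeFn_mk]
          rcases hs i hi with rfl | ⟨u, v', rfl, h1, h⟩
          · exact ⟨v, .inl rfl, rfl⟩
          · rw [he h1] at h
            exact ⟨u, h, rfl⟩
        omega
      · have : s ⊆ {j} := by
          intro i hi
          rcases hs i hi with h | ⟨u, v, -, h, -⟩
          · simp [h]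
          · exact absurd ⟨v, h⟩ hj
        have := card_le_card this
        rw [card_singleton] at this
        omega
  omega

end

end BlockGraph

/-! ### Sets of vertices without edges between different parts -/

namespace BlockGraph

open Finset

variable {k w g : ℕ} (φ : KCNF k)

theorem numSatisfied_le (a : Fin φ.numVars → Bool) : φ.numSatisfied a ≤ φ.maxSatisfiable :=
  le_sup (f := φ.numSatisfied) (mem_univ a)

variable {φ} {K : FVtx φ w g → Prop}

open Classical in
/-- The number of copies of the literals on a variable in a set of vertices. -/
noncomputable def litCount (K : FVtx φ w g → Prop) (x : Fin φ.numVars) : ℕ :=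
  ∑ c, ∑ s, ∑ b, if K (.lit x c s b) then 1 else 0

/-- If there are more than `2 * w` literals on a variable, then they have the same sign and are
found in all three parts. -/
theorem litCount_le
    (hK : ∀ u v, Vtx.Cross (litVar φ) (litSign φ) u v → u.part ≠ v.part → K u → ¬ K v)
    (x : Fin φ.numVars) :
    litCount K x ≤ 2 * w ∨ litCount K x ≤ 3 * w ∧ ∃ s, ∀ b, ∃ c, K (.lit x c s b) := by
  classical
  let N : Bool → Fin 3 → ℕ := fun s b => ∑ c, if K (.lit x c s b) then 1 else 0
  have hN : litCount K x = ∑ s, ∑ b, N s b := by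
    simp only [litCount, N]
    rw [sum_comm]
    exact sum_congr rfl fun s _ => sum_comm
  have hw : ∀ s b, N s b ≤ w := by
    intro s b
    refine (sum_le_sum (g := fun _ => 1) fun c _ => ?_).trans (by simp)
    split_ifs <;> simp
  have hpos : ∀ s b, N s b = 0 ∨ ∃ c, K (.lit x c s b) := by
    intro s b
    by_cases h : ∃ c, K (.lit x c s b)
    · exact .inr h
    · rw [not_exists] at h
      exact .inl (by simp [N, h])
  have hne : ∀ b b', b ≠ b' → N true b = 0 ∨ N false b' = 0 := by
    intro b b' hb
    rcases hpos true b with h | ⟨c, h⟩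
    · exact .inl h
    rcases hpos false b' with h' | ⟨c', h'⟩
    · exact .inr h'
    exact absurd h' (hK (.lit x c true b) (.lit x c' false b') ⟨rfl, by simp⟩ hb h)
  have h1 : litCount K x ≤ 2 * w ∨
      litCount K x ≤ 3 * w ∧ (N true 0 ≠ 0 ∧ N true 1 ≠ 0 ∧ N true 2 ≠ 0) ∨
      litCount K x ≤ 3 * w ∧ (N false 0 ≠ 0 ∧ N false 1 ≠ 0 ∧ N false 2 ≠ 0) := by
    rw [hN]
    simp only [Fintype.sum_bool, Fin.sum_univ_three]
    have a1 := hne 0 1 (by decide)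
    have a2 := hne 0 2 (by decide)
    have a3 := hne 1 0 (by decide)
    have a4 := hne 1 2 (by decide)
    have a5 := hne 2 0 (by decide)
    have a6 := hne 2 1 (by decide)
    have b1 := hw true 0
    have b2 := hw true 1
    have b3 := hw true 2
    have b4 := hw false 0
    have b5 := hw false 1
    have b6 := hw false 2
    omega
  have h2 : ∀ s, (N s 0 ≠ 0 ∧ N s 1 ≠ 0 ∧ N s 2 ≠ 0) → ∀ b, ∃ c, K (.lit x c s b) := by
    rintro s ⟨e0, e1, e2⟩ b
    refine (hpos s b).resolve_left ?_
    fin_cases b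
    exacts [e0, e1, e2]
  rcases h1 with h | ⟨h, h'⟩ | ⟨h, h'⟩
  · exact .inl h
  · exact .inr ⟨h, true, h2 _ h'⟩
  · exact .inr ⟨h, false, h2 _ h'⟩

/-- One of the two signs is that of at most half of the occurrences of a variable. -/
theorem exists_majority {p : ℕ} {x : Fin φ.numVars} (h : φ.occurrences x ≤ 2 * p + 1) :
    ∃ s, ∑ C, ∑ i, (if litVar φ C i = x ∧ litSign φ C i ≠ s then 1 else 0) ≤ p := by
  have e : (∑ C, ∑ i, if litVar φ C i = x ∧ litSign φ C i ≠ true then 1 else 0) +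
      (∑ C, ∑ i, if litVar φ C i = x ∧ litSign φ C i ≠ false then 1 else 0) ≤ 2 * p + 1 := by
    refine le_trans (le_of_eq ?_) h
    rw [occurrences_eq]
    simp only [← sum_add_distrib]
    refine sum_congr rfl fun C _ => sum_congr rfl fun i _ => ?_
    by_cases h1 : litVar φ C i = x <;> cases h2 : litSign φ C i <;> simp [h1]
  by_contra hc
  simp only [not_exists, not_le] at hc
  have h1 := hc true
  have h2 := hc false
  omega

theorem clausePart_injective (hk : k < 4) : Function.Injective (clausePart : Fin k → Fin 3) := by
  intro i j h
  have hi := i.isLt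
  have hj := j.isLt
  unfold clausePart at h
  apply Fin.ext
  split_ifs at h <;> omega

open Classical in
/-- A set of literals and of vertices for clauses without edges between different parts has at most
`3 * w * n + m'` elements, where `m'` is the maximum number of clauses that can be satisfied.

Call a variable dense if there are more than `2 * w` literals on it; these literals then give its
value, and every other variable gets the value of the majority of its occurrences. A clause with
`r` vertices in the set is satisfied or loses `r` vertices to occurrences of variables that are
not dense, and at most `w` vertices can be lost to each of these variables: for `k ≤ 3` there is at
most one vertex for each clause, and only false literals count, of which there are at most
`p ≤ w`, and for `k ≥ 4` there are at most `2 * p + 1 ≤ w` occurrences. -/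
theorem card_le_of_cross {p : ℕ} (hk : 2 ≤ k) (hp : 1 ≤ p) (hw : w = 2 ^ (k - 2) * p)
    (hocc : ∀ x, φ.occurrences x ≤ 2 * p + 1)
    (hK : ∀ u v, Vtx.Cross (litVar φ) (litSign φ) u v → u.part ≠ v.part → K u → ¬ K v) :
    ∑ x, litCount K x + ∑ C, ∑ i, (if K (.cl C i) then 1 else 0) ≤
      3 * w * φ.numVars + φ.maxSatisfiable := by
  let D : Finset (Fin φ.numVars) := univ.filter fun x => litCount K x ≤ 2 * w
  have hdense : ∀ x, x ∉ D → litCount K x ≤ 3 * w ∧ ∃ s, ∀ b, ∃ c, K (.lit x c s b) :=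
    fun x hx => (litCount_le hK x).resolve_left (by simpa [D] using hx)
  have hval : ∀ x, ∃ s, (x ∈ D →
        ∑ C, ∑ i, (if litVar φ C i = x ∧ litSign φ C i ≠ s then 1 else 0) ≤ p) ∧
      (x ∉ D → ∀ b, ∃ c, K (.lit x c s b)) := by
    intro x
    by_cases hx : x ∈ D
    · obtain ⟨s, hs⟩ := exists_majority (hocc x)
      exact ⟨s, fun _ => hs, fun h => absurd hx h⟩
    · obtain ⟨s, hs⟩ := (hdense x hx).2
      exact ⟨s, fun h => absurd h hx, fun _ => hs⟩
  choose a ha1 ha2 using hval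
  have hwp : p ≤ w := by
    rw [hw]
    exact Nat.le_mul_of_pos_left _ (by positivity)
  have hwp4 : 4 ≤ k → 2 * p + 1 ≤ w := by
    intro h
    have : 2 ^ 2 ≤ 2 ^ (k - 2) := Nat.pow_le_pow_right (by norm_num) (by omega)
    rw [hw]
    nlinarith
  -- The vertex of a literal is not adjacent to the literals on a dense variable in another part.
  have hsel : ∀ C i j, K (.cl C i) → litVar φ C j ∉ D →
      (j < i → a (litVar φ C j) ≠ litSign φ C j) ∧ (j = i → a (litVar φ C j) = litSign φ C j) := by
    intro C i j hi hj
    obtain ⟨b, hb⟩ : ∃ b : Fin 3, b ≠ clausePart i := ⟨clausePart i + 1, by simp⟩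
    obtain ⟨c, hc⟩ := ha2 _ hj b
    constructor
    · intro hji he
      exact hK (.lit _ c _ b) (.cl C i) ⟨j, rfl, .inl ⟨hji, he.symm⟩⟩ hb hc hi
    · intro hji
      by_contra he
      exact hK (.lit _ c _ b) (.cl C i) ⟨j, rfl, .inr ⟨hji, Ne.symm he⟩⟩ hb hc hi
  let bad : Fin φ.clauses.length → Fin k → Prop := fun C i =>
    4 ≤ k ∨ litSign φ C i ≠ a (litVar φ C i)
  have hclause : ∀ C, ∑ i, (if K (.cl C i) then 1 else 0) ≤
      (if ∃ i, a (litVar φ C i) = litSign φ C i then 1 else 0) +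
        ∑ i, if litVar φ C i ∈ D ∧ bad C i then 1 else 0 := by
    intro C
    have h1 : ∑ i, (if K (.cl C i) then 1 else 0) ≤
        ∑ i, (if K (.cl C i) ∧ ¬(litVar φ C i ∈ D ∧ bad C i) then 1 else 0) +
        ∑ i, if litVar φ C i ∈ D ∧ bad C i then 1 else 0 := by
      rw [← sum_add_distrib]
      refine sum_le_sum fun i _ => ?_
      by_cases h1 : K (.cl C i) <;> by_cases h2 : litVar φ C i ∈ D ∧ bad C i <;> simp [h1, h2]
    refine h1.trans (Nat.add_le_add_right ?_ _)
    rw [← card_filter]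
    have htrue : ∀ i, K (.cl C i) ∧ ¬(litVar φ C i ∈ D ∧ bad C i) →
        a (litVar φ C i) = litSign φ C i ∧ (4 ≤ k → litVar φ C i ∉ D) := by
      rintro i ⟨hi, hi'⟩
      by_cases hD : litVar φ C i ∈ D
      · simp only [bad, hD, true_and, not_or, not_not] at hi'
        exact ⟨hi'.2.symm, fun h => absurd h hi'.1⟩
      · exact ⟨(hsel C i i hi hD).2 rfl, fun _ => hD⟩
    split_ifs with hs
    · refine card_le_one.mpr fun i hi j hj => ?_
      simp only [mem_filter, mem_univ, true_and] at hi hj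
      by_cases h4 : 4 ≤ k
      · rcases lt_trichotomy i j with h | h | h
        · exact absurd (htrue i hi).1 ((hsel C j i hj.1 ((htrue i hi).2 h4)).1 h)
        · exact h
        · exact absurd (htrue j hj).1 ((hsel C i j hi.1 ((htrue j hj).2 h4)).1 h)
      · by_contra hne
        refine hK (.cl C i) (.cl C j) rfl (fun h => hne ?_) hi.1 hj.1
        exact clausePart_injective (by omega) h
    · rw [not_exists] at hs
      rw [Nat.le_zero, card_eq_zero, filter_eq_empty_iff]
      exact fun i _ hi => hs i (htrue i hi).1
  have hbad : ∑ C, ∑ i, (if litVar φ C i ∈ D ∧ bad C i then 1 else 0) ≤ D.card * w := by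
    have e : ∑ C, ∑ i, (if litVar φ C i ∈ D ∧ bad C i then 1 else 0) =
        ∑ x ∈ D, ∑ C, ∑ i, if litVar φ C i = x ∧ bad C i then 1 else 0 := by
      rw [sum_comm (s := D)]
      refine sum_congr rfl fun C _ => ?_
      rw [sum_comm (s := D)]
      refine sum_congr rfl fun i _ => ?_
      by_cases hb : bad C i <;> simp [hb]
    rw [e, ← smul_eq_mul]
    refine sum_le_card_nsmul _ _ _ fun x hx => ?_
    by_cases h4 : 4 ≤ k
    · refine le_trans ?_ ((hocc x).trans (hwp4 h4))
      rw [occurrences_eq]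
      simp [bad, h4]
    · refine le_trans (sum_le_sum fun C _ => sum_le_sum fun i _ => ?_) ((ha1 x hx).trans hwp)
      by_cases hx' : litVar φ C i = x
      · subst hx'
        simp [bad, h4]
      · simp [hx']
  have hlit : ∑ x, litCount K x + D.card * w ≤ 3 * w * φ.numVars := by
    have e : D.card * w = ∑ x, if x ∈ D then w else 0 := by simp
    rw [e, ← sum_add_distrib]
    refine (sum_le_card_nsmul univ _ (3 * w) fun x _ => ?_).trans (by simp [mul_comm])
    by_cases hx : x ∈ D
    · have : litCount K x ≤ 2 * w := by simpa [D] using hx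
      rw [if_pos hx]
      omega
    · rw [if_neg hx]
      exact (hdense x hx).1
  have hcl := sum_le_sum fun C (_ : C ∈ univ) => hclause C
  rw [sum_add_distrib] at hcl
  have hsat := numSatisfied_le φ a
  rw [numSatisfied_eq] at hsat
  omega

end BlockGraph

/-! ### The lower bound -/

namespace IsTreeOrder

variable {V : Type*} {A : V → V → Prop} (hA : IsTreeOrder A)

include hA

/-- Let `q` and `r` be incomparable, and let `u` and `v` be comparable elements, comparable to `q`
and to `r`, respectively. Then one of `u` and `v` is below both `q` and `r`. -/
theorem below_both {q r u v : V} (h1 : ¬ A q r) (h2 : ¬ A r q) (hu : A u q ∨ A q u)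
    (hv : A v r ∨ A r v) (huv : A u v ∨ A v u) : A u q ∧ A u r ∨ A v q ∧ A v r := by
  have key : ∀ {q r u v : V}, ¬ A q r → ¬ A r q → (A u q ∨ A q u) → (A v r ∨ A r v) → A u v →
      A u q ∧ A u r := by
    intro q r u v h1 h2 hu hv huv
    have hur : A u r := by
      rcases hv with hv | hv
      · exact hA.trans huv hv
      · rcases hA.chain huv hv with h | h
        · exact h
        · rcases hu with hu | hu
          · exact absurd (hA.trans h hu) h2
          · exact ((hA.chain h hu).elim h2 h1).elim
    exact ⟨hu.resolve_right fun h => h1 (hA.trans h hur), hur⟩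
  rcases huv with h | h
  · exact .inl (key h1 h2 hu hv h)
  · exact .inr (key h2 h1 hv hu h).symm

theorem exists_greatest {s : Finset V} (hs : s.Nonempty) (hc : ∀ u ∈ s, ∀ v ∈ s, A u v ∨ A v u) :
    ∃ q ∈ s, ∀ v ∈ s, A v q := by
  induction hs using Finset.Nonempty.cons_induction with
  | singleton a => exact ⟨a, by simp, by simp [hA.refl]⟩
  | cons a s ha hs ih =>
    obtain ⟨q, hq, hmax⟩ := ih fun u hu v hv => hc u (by simp [hu]) v (by simp [hv])
    rcases hc a (by simp) q (by simp [hq]) with h | h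
    · refine ⟨q, by simp [hq], fun v hv => ?_⟩
      rcases Finset.mem_cons.mp hv with rfl | hv
      · exact h
      · exact hmax v hv
    · refine ⟨a, by simp, fun v hv => ?_⟩
      rcases Finset.mem_cons.mp hv with rfl | hv
      · exact hA.refl _
      · exact hA.trans (hmax v hv) h

/-- For any three elements, there are two of them such that everything below any two of the three
elements is below these two. -/
theorem exists_largest_meet [Fintype V] (q : Fin 3 → V) : ∃ b c : Fin 3, b ≠ c ∧
    ∀ i j, i ≠ j → ∀ v, A v (q i) → A v (q j) → A v (q b) ∧ A v (q c) := by
  classical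
  let M : Fin 3 → Fin 3 → Finset V := fun i j => Finset.univ.filter fun v => A v (q i) ∧ A v (q j)
  have hM : ∀ {i j v}, v ∈ M i j ↔ A v (q i) ∧ A v (q j) := by simp [M]
  have hsymm : ∀ i j, M i j = M j i := by
    intro i j
    ext v
    rw [hM, hM, and_comm]
  -- The elements below `q i` form a chain, so that two of its lower sets are comparable.
  have hsub : ∀ i j l, (M i j).card ≤ (M i l).card → M i j ⊆ M i l := by
    intro i j l hle
    by_contra hn
    obtain ⟨v, hv, hvn⟩ := Finset.not_subset.mp hn
    rw [hM] at hv hvn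
    have hlt : M i l ⊂ M i j := by
      refine Finset.ssubset_iff_of_subset (fun u hu => ?_) |>.mpr
        ⟨v, hM.mpr hv, fun h => hvn (hM.mp h)⟩
      rw [hM] at hu ⊢
      rcases hA.chain hu.1 hv.1 with h | h
      · exact ⟨hu.1, hA.trans h hv.2⟩
      · exact absurd ⟨hv.1, hA.trans h hu.2⟩ hvn
    exact absurd (Finset.card_lt_card hlt) (not_lt.mpr hle)
  obtain ⟨⟨b, c⟩, hbc, hmax⟩ := Finset.exists_max_image
    (Finset.univ.filter fun x : Fin 3 × Fin 3 => x.1 ≠ x.2) (fun x => (M x.1 x.2).card)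
    ⟨(0, 1), by decide⟩
  simp only [Finset.mem_filter, Finset.mem_univ, true_and, Prod.forall] at hbc hmax
  refine ⟨b, c, hbc, fun i j hij v hi hj => ?_⟩
  rw [← hM]
  have hv : v ∈ M i j := hM.mpr ⟨hi, hj⟩
  have hle := hmax i j hij
  have h3 : ∀ b c i j : Fin 3, b ≠ c → i ≠ j → i = b ∨ i = c ∨ j = b ∨ j = c := by decide
  rcases h3 b c i j hbc hij with rfl | rfl | rfl | rfl
  · exact hsub _ _ _ hle hv
  · rw [hsymm b] at hle ⊢
    exact hsub _ _ _ hle hv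
  · rw [hsymm i] at hle hv
    exact hsub _ _ _ hle hv
  · rw [hsymm i] at hle hv
    rw [hsymm b] at hle ⊢
    exact hsub _ _ _ hle hv

end IsTreeOrder

namespace BlockGraph

open Finset

variable {k w g : ℕ} {φ : KCNF k}

section counts

open Classical in
/-- The number of literals of a part in a set of vertices. -/
noncomputable def lits (P : FVtx φ w g → Prop) (b : Fin 3) : ℕ :=
  ∑ x, ∑ c, ∑ s, if P (.lit x c s b) then 1 else 0

open Classical in
/-- The number of hubs for variables of the part `b + 1` in a set of vertices. -/
noncomputable def varHubs (P : FVtx φ w g → Prop) (b : Fin 2) : ℕ :=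
  ∑ x, ∑ c, if P (.varHub x c b) then 1 else 0

open Classical in
/-- The number of vertices for literals of clauses in a set of vertices. -/
noncomputable def cls (P : FVtx φ w g → Prop) : ℕ := ∑ C, ∑ i, if P (.cl C i) then 1 else 0

open Classical in
/-- The number of hubs for clauses of a part in a set of vertices. -/
noncomputable def clauseHubs (P : FVtx φ w g → Prop) (b : Fin 3) : ℕ :=
  ∑ C, ∑ c, if P (.clauseHub C c b) then 1 else 0

/-- The number of vertices outside of the special block in a set of vertices. -/
noncomputable def total (P : FVtx φ w g → Prop) : ℕ :=
  lits P 0 + lits P 1 + lits P 2 + varHubs P 0 + varHubs P 1 + cls P + clauseHubs P 0 +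
    clauseHubs P 1 + clauseHubs P 2

variable {P Q : FVtx φ w g → Prop}

theorem indicator_le {p q : Prop} [Decidable p] [Decidable q] (h : p → q) :
    (if p then 1 else 0) ≤ if q then 1 else 0 := by
  by_cases hp : p
  · simp [hp, h hp]
  · simp [hp]

open Classical in
theorem lits_mono (h : ∀ v, P v → Q v) (b : Fin 3) : lits P b ≤ lits Q b :=
  sum_le_sum fun _ _ => sum_le_sum fun _ _ => sum_le_sum fun _ _ => indicator_le (h _)

open Classical in
theorem cls_mono (h : ∀ v, P v → Q v) : cls P ≤ cls Q :=
  sum_le_sum fun _ _ => sum_le_sum fun _ _ => indicator_le (h _)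

theorem sum_litCount (P : FVtx φ w g → Prop) :
    ∑ x, litCount P x = lits P 0 + lits P 1 + lits P 2 := by
  simp only [litCount, lits, Fin.sum_univ_three, sum_add_distrib]

theorem lits_add_lits_not (P : FVtx φ w g → Prop) (b : Fin 3) :
    lits P b + lits (fun v => ¬ P v) b = 2 * (w * φ.numVars) := by
  classical
  simp only [lits, ← sum_add_distrib]
  rw [sum_congr rfl fun x _ => sum_congr rfl fun c _ => sum_congr rfl fun s _ => show _ = 1 by
    by_cases h : P (.lit x c s b) <;> simp [h]]
  simp
  ring

theorem cls_add_cls_not (P : FVtx φ w g → Prop) :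
    cls P + cls (fun v => ¬ P v) = k * φ.numClauses := by
  classical
  simp only [cls, ← sum_add_distrib]
  rw [sum_congr rfl fun C _ => sum_congr rfl fun i _ => show _ = 1 by
    by_cases h : P (.cl C i) <;> simp [h]]
  simp [KCNF.numClauses, mul_comm]

open Classical in
theorem card_filter_eq_total (P : FVtx φ w g → Prop) :
    (univ.filter fun v => P v ∧ ∀ a, v ≠ .special a).card = total P := by
  rw [card_filter, Vtx.sum_eq]
  simp only [Fintype.sum_prod_type, total, lits, varHubs, cls, clauseHubs, Fin.sum_univ_three,
    Fin.sum_univ_two, sum_add_distrib]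
  simp
  ring

/-- A set of vertices that contains the hubs of a part has the corresponding size. -/
theorem le_of_hubs {b : Fin 3} (h : ∀ v, v.isHub = true → v.part = b → P v) :
    g * φ.numClauses ≤ clauseHubs P b ∧ (b.val = 0 → 2 * (w * φ.numVars) ≤ lits P 0) ∧
      (b.val = 1 → w * φ.numVars ≤ varHubs P 0) ∧ (b.val = 2 → w * φ.numVars ≤ varHubs P 1) := by
  refine ⟨?_, fun hb => ?_, fun hb => ?_, fun hb => ?_⟩
  · have : ∀ C c, P (.clauseHub C c b) := fun C c => h _ rfl rfl
    simp [clauseHubs, this, KCNF.numClauses, mul_comm]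
  · have : ∀ x c s, P (.lit x c s 0) := fun x c s => h _ rfl (Fin.ext hb).symm
    simp [lits, this]
    exact le_of_eq (by ring)
  · have : ∀ x c, P (.varHub x c 0) := fun x c => h _ rfl (Fin.ext hb).symm
    simp [varHubs, this, mul_comm]
  · have : ∀ x c, P (.varHub x c 1) := fun x c => h _ rfl (Fin.ext hb).symm
    simp [varHubs, this, mul_comm]

theorem add_le_sum_fin_three (f : Fin 3 → ℕ) {a b : Fin 3} (h : a ≠ b) :
    f a + f b ≤ f 0 + f 1 + f 2 := by
  rw [← Fin.sum_univ_three, ← sum_pair h]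
  exact sum_le_sum_of_subset (subset_univ _)

/-- The size of a set of vertices that contains the hubs of the parts `b` and `c`, and `2 * w * n`
literals in the parts `a` and `a'`. Since the literals of part `0` are hubs, these are not to be in
part `0` if `b` or `c` is `0`. -/
theorem le_total {b c a a' : Fin 3} (hbc : b ≠ c)
    (hb : ∀ v, v.isHub = true → v.part = b → P v) (hc : ∀ v, v.isHub = true → v.part = c → P v)
    (haa : a ≠ a') (h0 : b = 0 ∨ c = 0 → a ≠ 0 ∧ a' ≠ 0)
    (hl : 2 * (w * φ.numVars) ≤ lits P a + lits P a') :
    4 * (w * φ.numVars) + 2 * (g * φ.numClauses) ≤ total P := by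
  obtain ⟨b1, b2, b3, b4⟩ := le_of_hubs hb
  obtain ⟨c1, c2, c3, c4⟩ := le_of_hubs hc
  have e1 := add_le_sum_fin_three (clauseHubs P) hbc
  have e2 := add_le_sum_fin_three (lits P) haa
  have e3 : b = 0 ∨ c = 0 → lits P a + lits P a' ≤ lits P 1 + lits P 2 := by
    intro h
    have key : ∀ a a' : Fin 3, a ≠ a' → a ≠ 0 ∧ a' ≠ 0 → a = 1 ∧ a' = 2 ∨ a = 2 ∧ a' = 1 := by
      decide
    rcases key a a' haa (h0 h) with ⟨rfl, rfl⟩ | ⟨rfl, rfl⟩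
    · exact le_rfl
    · exact (add_comm _ _).le
  simp only [ne_eq, Fin.ext_iff, Fin.val_zero] at hbc e3
  have := b.isLt
  have := c.isLt
  clear h0 hb hc haa
  unfold total
  generalize w * φ.numVars = W at *
  generalize g * φ.numClauses = G at *
  have hv : b.val ≠ 0 ∧ c.val ≠ 0 → 2 * W ≤ varHubs P 0 + varHubs P 1 := by omega
  have hv' : 2 * W ≤ lits P 0 ∧ W ≤ varHubs P 0 + varHubs P 1 ∨ b.val ≠ 0 ∧ c.val ≠ 0 := by omega
  clear b2 b3 b4 c2 c3 c4
  omega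

end counts

end BlockGraph

namespace BlockGraph

open Finset

variable {k w g : ℕ} {φ : KCNF k}

/-- The path to a vertex comparable to its whole part can be extended by a special vertex. -/
theorem total_add_one_le {A : FVtx φ w g → FVtx φ w g → Prop} (hA : IsTreeOrder A) {d : ℕ}
    (hd : ∀ v (s : Finset (FVtx φ w g)), (∀ u ∈ s, A u v) → s.card ≤ d)
    {q : FVtx φ w g} (hq : ∀ v, v.part = q.part → A v q ∨ A q v) :
    total (fun v => A v q) + 1 ≤ d := by
  classical
  rw [← card_filter_eq_total, ← card_insert_of_notMem (a := Vtx.special q.part) (by simp)]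
  -- The special vertex of the part is comparable to `q`, and one of the two is above the other.
  rcases hq (.special q.part) rfl with h | h
  · refine hd q _ fun u hu => ?_
    rcases mem_insert.mp hu with rfl | hu
    · exact h
    · exact (mem_filter.mp hu).2.1
  · refine hd (.special q.part) _ fun u hu => ?_
    rcases mem_insert.mp hu with rfl | hu
    · exact hA.refl _
    · exact hA.trans (mem_filter.mp hu).2.1 h

section lower

variable {A : FVtx φ w g → FVtx φ w g → Prop} (hA : IsTreeOrder A)
  (hadj : ∀ u v, Vtx.Adj (litVar φ) (litSign φ) u v → A u v ∨ A v u)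

include hA hadj

/-- The hubs of a part form a chain, and all vertices of the part are comparable to its largest
element. -/
theorem exists_greatest_hub (hw : 1 ≤ w) (hn : 1 ≤ φ.numVars) (b : Fin 3) :
    ∃ q, q.isHub = true ∧ q.part = b ∧ (∀ v, v.isHub = true → v.part = b → A v q) ∧
      ∀ v, v.part = b → A v q ∨ A q v := by
  have hcomp : ∀ u v : FVtx φ w g, u.isHub = true → u.part = v.part → A v u ∨ A u v := by
    intro u v hu hp
    by_cases e : u = v
    · subst e
      exact .inl (hA.refl _)
    · exact (hadj u v ⟨e, by rw [if_pos hp]; exact .inl hu⟩).symm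
  have hne : (univ.filter fun v : FVtx φ w g => v.isHub = true ∧ v.part = b).Nonempty := by
    rcases Fin.eq_zero_or_eq_succ b with rfl | ⟨b, rfl⟩
    · exact ⟨.lit ⟨0, hn⟩ ⟨0, hw⟩ true 0, mem_filter.mpr ⟨mem_univ _, rfl, rfl⟩⟩
    · exact ⟨.varHub ⟨0, hn⟩ ⟨0, hw⟩ b, mem_filter.mpr ⟨mem_univ _, rfl, rfl⟩⟩
  obtain ⟨q, hq, hmax⟩ := hA.exists_greatest hne fun u hu v hv => by
    simp only [mem_filter, mem_univ, true_and] at hu hv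
    exact (hcomp u v hu.1 (hu.2.trans hv.2.symm)).symm
  simp only [mem_filter, mem_univ, true_and] at hq hmax
  exact ⟨q, hq.1, hq.2, fun v h1 h2 => hmax v ⟨h1, h2⟩,
    fun v hv => hcomp q v hq.1 (hq.2.trans hv.symm)⟩

/-- If the largest hubs of two parts are incomparable, then half of the literals in these parts are
below both of them. -/
theorem le_lits_add_lits {q r : FVtx φ w g} (hq : ∀ v, v.part = q.part → A v q ∨ A q v)
    (hr : ∀ v, v.part = r.part → A v r ∨ A r v) (hp : q.part ≠ r.part) (h1 : ¬ A q r)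
    (h2 : ¬ A r q) : 2 * (w * φ.numVars) ≤
      lits (fun v => A v q ∧ A v r) q.part + lits (fun v => A v q ∧ A v r) r.part := by
  classical
  have h : ∀ x c s, (A (.lit x c s q.part) q ∧ A (.lit x c s q.part) r) ∨
      (A (.lit x c (!s) r.part) q ∧ A (.lit x c (!s) r.part) r) := by
    intro x c s
    exact hA.below_both h1 h2 (hq (.lit x c s q.part) rfl) (hr (.lit x c (!s) r.part) rfl)
      (hadj _ _ (Vtx.adj_of_cross ⟨rfl, by simp⟩ hp))
  generalize hS : (fun v => A v q ∧ A v r) = S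
  have h' : ∀ x c s, 1 ≤ (if S (.lit x c s q.part) then 1 else 0) +
      if S (.lit x c (!s) r.part) then 1 else 0 := by
    intro x c s
    subst hS
    rcases h x c s with h | h
    · rw [if_pos h]; omega
    · rw [if_pos h]; omega
  have e : lits S r.part = ∑ x, ∑ c, ∑ s, if S (.lit x c (!s) r.part) then 1 else 0 := by
    simp only [lits, Fintype.sum_bool, Bool.not_true, Bool.not_false]
    refine sum_congr rfl fun x _ => sum_congr rfl fun c _ => ?_
    rw [add_comm]
  rw [e, lits]
  simp only [← sum_add_distrib]
  calc 2 * (w * φ.numVars) = ∑ x : Fin φ.numVars, ∑ c : Fin w, ∑ s : Bool, 1 := by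
        simp
        ring
    _ ≤ _ := sum_le_sum fun x _ => sum_le_sum fun c _ => sum_le_sum fun s _ => by
        convert h' x c s

/-- The lower bound for the depth if the largest hubs of two parts are comparable. -/
theorem le_of_comparable {d : ℕ}
    (hd : ∀ v (s : Finset (FVtx φ w g)), (∀ u ∈ s, A u v) → s.card ≤ d) {q : Fin 3 → FVtx φ w g}
    (hpart : ∀ b, (q b).part = b)
    (hhub : ∀ b v, v.isHub = true → v.part = b → A v (q b))
    (hcomp : ∀ b v, v.part = b → A v (q b) ∨ A (q b) v) {b c : Fin 3} (hbc : b ≠ c)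
    (h : A (q b) (q c)) :
    4 * (w * φ.numVars) + 2 * (g * φ.numClauses) + 1 ≤ d := by
  have hup : ∀ {i j}, A (q i) (q j) → ∀ v, v.isHub = true → v.part = i → A v (q j) :=
    fun hij v h1 h2 => hA.trans (hhub _ v h1 h2) hij
  have htot : ∀ j, total (fun v => A v (q j)) + 1 ≤ d := fun j =>
    total_add_one_le hA hd fun v hv => hcomp j v (hv.trans (hpart j))
  -- If all hubs are below one vertex, then so are all literals of part `0`.
  have hall : ∀ j, (∀ i, A (q i) (q j)) → 4 * (w * φ.numVars) + 2 * (g * φ.numClauses) + 1 ≤ d := by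
    intro j hj
    refine le_trans (Nat.add_le_add_right ?_ 1) (htot j)
    refine le_total (b := 1) (c := 2) (a := 0) (a' := 1) (by decide) (hup (hj 1)) (hup (hj 2))
      (by decide) (by decide) ?_
    exact le_add_right ((le_of_hubs (P := fun v => A v (q j)) (hup (hj 0))).2.1 rfl)
  have hpair : ∀ i j, i ≠ j → ¬ A (q i) (q j) → ¬ A (q j) (q i) → 2 * (w * φ.numVars) ≤
      lits (fun v => A v (q i) ∧ A v (q j)) i + lits (fun v => A v (q i) ∧ A v (q j)) j := by
    intro i j hij h1 h2
    have := le_lits_add_lits hA hadj (q := q i) (r := q j)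
      (fun v hv => hcomp i v (hv.trans (hpart i))) (fun v hv => hcomp j v (hv.trans (hpart j)))
      (by rwa [hpart, hpart]) h1 h2
    rwa [hpart, hpart] at this
  obtain ⟨a, hab, hac, habc⟩ : ∃ a, a ≠ b ∧ a ≠ c ∧ ∀ i, i = a ∨ i = b ∨ i = c := by
    have h3 : ∀ b c : Fin 3, b ≠ c → ∃ a, a ≠ b ∧ a ≠ c ∧ ∀ i, i = a ∨ i = b ∨ i = c := by decide
    exact h3 b c hbc
  by_cases h1 : A (q a) (q c)
  · refine hall c fun i => ?_
    rcases habc i with rfl | rfl | rfl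
    exacts [h1, h, hA.refl _]
  by_cases h2 : A (q c) (q a)
  · refine hall a fun i => ?_
    rcases habc i with rfl | rfl | rfl
    exacts [hA.refl _, hA.trans h h2, h2]
  have hac' := hpair a c hac h1 h2
  by_cases hc : c = 0
  · by_cases h3 : A (q b) (q a)
    · refine le_trans (Nat.add_le_add_right ?_ 1) (htot a)
      refine le_total (b := a) (c := b) (a := a) (a' := c) hab (hhub a) (hup h3) hac (by
        rintro (rfl | rfl)
        · exact absurd hc.symm hac
        · exact absurd hc.symm hbc) (hac'.trans ?_)
      exact add_le_add (lits_mono (fun v hv => hv.1) _) (lits_mono (fun v hv => hv.1) _)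
    · have hab' := hpair a b hab (fun h4 => h1 (hA.trans h4 h)) h3
      refine le_trans (Nat.add_le_add_right ?_ 1) (htot c)
      refine le_total (b := b) (c := c) (a := a) (a' := b) hbc (hup h) (hhub c) hab
        (fun _ => ⟨hc ▸ hac, hc ▸ hbc⟩) (hab'.trans ?_)
      exact add_le_add (lits_mono (fun v hv => hA.trans hv.2 h) _)
        (lits_mono (fun v hv => hA.trans hv.2 h) _)
  · refine le_trans (Nat.add_le_add_right ?_ 1) (htot c)
    refine le_total (b := b) (c := c) (a := a) (a' := c) hbc (hup h) (hhub c) hac (by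
      rintro (rfl | rfl)
      · exact ⟨hab, hc⟩
      · exact absurd rfl hc) (hac'.trans ?_)
    exact add_le_add (lits_mono (fun v hv => hv.2) _) (lits_mono (fun v hv => hv.2) _)

/-- The lower bound for the depth if the largest hubs of the parts are pairwise incomparable. The
vertices for literals which are not below the two hubs with the largest common trunk have no edges
between different parts. -/
theorem le_of_incomparable {p d : ℕ} (hk : 2 ≤ k) (hp : 1 ≤ p) (hw : w = 2 ^ (k - 2) * p)
    (hocc : ∀ x, φ.occurrences x ≤ 2 * p + 1)
    (hd : ∀ v (s : Finset (FVtx φ w g)), (∀ u ∈ s, A u v) → s.card ≤ d) {q : Fin 3 → FVtx φ w g}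
    (hpart : ∀ b, (q b).part = b)
    (hhub : ∀ b v, v.isHub = true → v.part = b → A v (q b))
    (hcomp : ∀ b v, v.part = b → A v (q b) ∨ A (q b) v)
    (h : ∀ b c, b ≠ c → ¬ A (q b) (q c)) :
    4 * (w * φ.numVars) + g * φ.numClauses + k * φ.numClauses + 1 ≤ d + φ.maxSatisfiable := by
  classical
  obtain ⟨b, c, hb, hmeet⟩ : ∃ b c : Fin 3, b ≠ 0 ∧
      ∀ i j, i ≠ j → ∀ v, A v (q i) → A v (q j) → A v (q b) ∧ A v (q c) := by
    obtain ⟨b, c, hbc, hm⟩ := hA.exists_largest_meet q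
    by_cases hb : b = 0
    · exact ⟨c, b, fun hc => hbc (hb.trans hc.symm),
        fun i j hij v h1 h2 => (hm i j hij v h1 h2).symm⟩
    · exact ⟨b, c, hb, hm⟩
  let S : FVtx φ w g → Prop := fun v => A v (q b) ∧ A v (q c)
  have hK := card_le_of_cross (K := fun v => ¬ S v) hk hp hw hocc fun u v huv hne hu hv => by
    have h1 := hA.below_both (h _ _ hne) (h _ _ hne.symm) (hcomp _ u rfl) (hcomp _ v rfl)
      (hadj u v (Vtx.adj_of_cross huv hne))
    rcases h1 with h1 | ⟨h1, h2⟩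
    · exact hu (hmeet _ _ hne u h1.1 h1.2)
    · exact hv (hmeet _ _ hne v h1 h2)
  rw [sum_litCount] at hK
  have hcl : cls (fun v => ¬ S v) = ∑ C, ∑ i, if ¬ S (.cl C i) then 1 else 0 := by
    simp only [cls]
    congr!
  have htot : total (fun v => A v (q b)) + 1 ≤ d :=
    total_add_one_le hA hd fun v hv => hcomp b v (hv.trans (hpart b))
  have hS : ∀ v, S v → A v (q b) := fun v hv => hv.1
  have l0 := lits_mono hS 0
  have l1 := lits_mono hS 1
  have l2 := lits_mono hS 2
  have l3 := cls_mono hS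
  have k0 := lits_add_lits_not S 0
  have k1 := lits_add_lits_not S 1
  have k2 := lits_add_lits_not S 2
  have k3 := cls_add_cls_not S
  obtain ⟨g1, -, g2, g3⟩ := le_of_hubs (P := fun v => A v (q b)) (hhub b)
  have g4 : w * φ.numVars + g * φ.numClauses ≤ varHubs (fun v => A v (q b)) 0 +
      varHubs (fun v => A v (q b)) 1 + clauseHubs (fun v => A v (q b)) 0 +
      clauseHubs (fun v => A v (q b)) 1 + clauseHubs (fun v => A v (q b)) 2 := by
    have h3 : ∀ b : Fin 3, b ≠ 0 → b = 1 ∨ b = 2 := by decide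
    rcases h3 b hb with rfl | rfl
    · have := g2 rfl
      omega
    · have := g3 rfl
      omega
  unfold total at htot
  have hK' : lits (fun v => ¬ S v) 0 + lits (fun v => ¬ S v) 1 + lits (fun v => ¬ S v) 2 +
      cls (fun v => ¬ S v) ≤ 3 * w * φ.numVars + φ.maxSatisfiable := by
    rw [hcl]
    convert hK
  rw [mul_assoc] at hK'
  omega

end lower

/-- Every elimination forest of the graph of a formula has at least the depth given by an optimal
valuation. -/
theorem le_treedepth_add_maxSatisfiable {p : ℕ} (hk : 2 ≤ k) (hp : 1 ≤ p)
    (hw : w = 2 ^ (k - 2) * p) (hg : k ≤ g) (hocc : ∀ x, φ.occurrences x ≤ 2 * p + 1) :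
    4 * w * φ.numVars + (k + g) * φ.numClauses + 1 ≤
      (formulaGraph φ w g).graph.treedepth + φ.maxSatisfiable := by
  obtain ⟨B, hB, hBadj, hBd⟩ := (formulaGraph φ w g).graph.exists_isTreeOrder
  obtain ⟨e, he, hadj, -⟩ := exists_embedding (w := w) (g := g) φ
  have hA : IsTreeOrder fun u v => B (e u) (e v) :=
    ⟨fun _ => hB.refl _, hB.trans, fun h h' => he (hB.antisymm h h'), hB.chain⟩
  have hAadj : ∀ u v, Vtx.Adj (litVar φ) (litSign φ) u v → B (e u) (e v) ∨ B (e v) (e u) :=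
    fun u v h => hBadj _ _ ((hadj u v).mpr h)
  have hAd : ∀ v (s : Finset (FVtx φ w g)), (∀ u ∈ s, B (e u) (e v)) →
      s.card ≤ (formulaGraph φ w g).graph.treedepth := by
    intro v s hs
    rw [← card_map ⟨e, he⟩]
    refine hBd (e v) _ fun i hi => ?_
    obtain ⟨u, hu, rfl⟩ := mem_map.mp hi
    exact hs u hu
  rcases Nat.eq_zero_or_pos φ.numVars with hn | hn
  · -- Without variables there are no clauses.
    have hm : φ.numClauses = 0 := by
      rw [KCNF.numClauses, List.length_eq_zero_iff, List.eq_nil_iff_forall_not_mem]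
      intro C _
      have := (C.lit ⟨0, by omega⟩).var.isLt
      omega
    have := hAd (.special 0) {.special 0} (by simp [hB.refl])
    rw [card_singleton] at this
    rw [hn, hm]
    omega
  · have hw1 : 1 ≤ w := by
      rw [hw]
      exact Nat.mul_pos (by positivity) hp
    choose q _ hpart hhub hcomp using exists_greatest_hub hA hAadj hw1 hn
    rw [mul_assoc, add_mul]
    by_cases h : ∃ b c, b ≠ c ∧ B (e (q b)) (e (q c))
    · obtain ⟨b, c, hbc, h⟩ := h
      have h1 := le_of_comparable hA hAadj hAd hpart hhub hcomp hbc h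
      have h2 := Nat.mul_le_mul_right φ.numClauses hg
      omega
    · push Not at h
      have h1 := le_of_incomparable hA hAadj hk hp hw hocc hAd hpart hhub hcomp h
      omega

/-- There are few clauses, since each of them has an occurrence of a variable. -/
theorem numClauses_le {p : ℕ} (hk : 1 ≤ k) (hocc : ∀ x, φ.occurrences x ≤ p) :
    φ.numClauses ≤ p * φ.numVars := by
  have h1 : ∑ x, φ.occurrences x = φ.numClauses * k := by
    simp only [occurrences_eq]
    rw [sum_comm]
    rw [sum_congr rfl fun C _ => sum_comm]
    simp [KCNF.numClauses]
  have h2 := sum_le_card_nsmul univ φ.occurrences p fun x _ => hocc x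
  rw [h1, card_univ, Fintype.card_fin, smul_eq_mul, mul_comm _ p] at h2
  exact (Nat.le_mul_of_pos_right _ hk).trans h2

end BlockGraph

open BlockGraph in
theorem mainTheorem6 (k p : ℕ) (hk : 2 ≤ k) (hp : 1 ≤ p) :
    ∃ H : BoundedKCNF k (2 * p + 1) → FinGraph,
      Nonempty (Turing.TM2ComputableInPolyTime
        (fun φ : BoundedKCNF k (2 * p + 1) => φ.1.encode) FinGraph.encode H) ∧
      (∃ c : ℕ, ∀ φ, 1 ≤ φ.1.numVars → (H φ).order ≤ c * φ.1.numVars) ∧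
      ∀ φ, ((H φ).graph.treedepth : ℤ) =
        2 * (2 ^ k - 1) * φ.1.numClauses - φ.1.maxSatisfiable + 2 ^ k * p * φ.1.numVars + 1 := by
  obtain ⟨l, rfl⟩ : ∃ l, k = l + 2 := ⟨k - 2, by omega⟩
  obtain ⟨w, hw⟩ : ∃ w, w = 2 ^ l * p := ⟨_, rfl⟩
  have hpow : l + 1 ≤ 2 ^ l := Nat.lt_two_pow_self
  -- The number `g` of hubs of a clause is such that `k + g = 2 * (2 ^ k - 1)`.
  obtain ⟨g, hg⟩ : ∃ g, (l + 2) + g + 2 = 8 * 2 ^ l := ⟨8 * 2 ^ l - (l + 2) - 2, by omega⟩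
  refine ⟨fun φ => formulaGraph φ.1 w g, ?_, ?_, fun φ => ?_⟩
  · exact polyTime_listGraph _ bit (blockGraph (l + 2) w g) fun u v => Iff.rfl
  · refine ⟨(2 * p + 3) * Fintype.card (Typ (l + 2) w g), fun φ hn => ?_⟩
    have h1 : (formulaGraph φ.1 w g).order = _ := length_vertexList φ.1
    have h2 := numClauses_le (by omega) φ.2
    rw [h1, mul_right_comm]
    refine Nat.mul_le_mul_right _ ?_
    rw [KCNF.numClauses] at h2
    nlinarith
  · have h1 := le_treedepth_add_maxSatisfiable (w := w) (g := g) hk hp (by simpa using hw)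
      (by omega) φ.2
    obtain ⟨a, -, ha⟩ := Finset.exists_mem_eq_sup Finset.univ
      ⟨fun _ => true, Finset.mem_univ _⟩ φ.1.numSatisfied
    have h2 := treedepth_add_numSatisfied_le (w := w) (g := g) a
    rw [← ha] at h2
    have h3 : (formulaGraph φ.1 w g).graph.treedepth + φ.1.maxSatisfiable =
        4 * w * φ.1.numVars + (l + 2 + g) * φ.1.numClauses + 1 := le_antisymm h2 h1
    zify at h3 hg hw
    have h4 : ((l : ℤ) + 2 + g) = 8 * 2 ^ l - 2 := by linarith
    rw [h4, hw] at h3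
    rw [pow_add]
    linear_combination h3
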